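/- Let $G$ be a connected, simply connected three-dimensional Lie group. Let $\mathcal I\subset\mathbb R$ be an open interval with $0\in\mathcal I$, let $\{\beta_t\}_{t\in\mathcal I}$ be a smooth family of positive functions on $G$ and $\{\mathfrak e^t=(e^t_u,e^t_l,e^t_n)\}_{t\in\mathcal I}$ a smooth family of coframes on $G$, put $h_{\mathfrak e^t}=e^t_u\otimes e^t_u+e^t_l\otimes e^t_l+e^t_n\otimes e^t_n$ and $\Theta_t=-\frac1{2\beta_t}\partial_t h_{\mathfrak e^t}$, and write $\Theta_t(\alpha)=\Theta_t(\alpha^\sharp,\cdot)$, $\mathrm d\beta_t(\alpha)=\mathrm d\beta_t(\alpha^\sharp)$ for a one-form $\alpha$, where $\sharp$ is taken with respect to $h_{\mathfrak e^t}$. Assume that $\{\beta_t,\mathfrak e^t\}_{t\in\mathcal I}$ is a parallel spinor flow, that is, for $a\in\{u,l,n\}$ and $t\in\mathcal I$, $$\partial_t e^t_a+\mathrm d\beta_t(e^t_a)\,e^t_u+\beta_t\Theta_t(e^t_a)=\delta_{au}\,\mathrm d\beta_t,\qquad \mathrm d e^t_a=\Theta_t(e^t_a)\wedge e^t_u,$$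 $$\partial_t(\Theta_t(e^t_u))+\mathrm d(\mathrm d\beta_t(e^t_u))=0,\qquad [\Theta_t(e^t_u)]=0\in H^1(G,\mathbb R),$$ and that it is left-invariant: all $\beta_t$ and $e^t_a$ are left-invariant (so each $\beta_t$ is constant on $G$). Put $e_a=e_a^0$ and $\Theta_0=\sum_{a,b}\Theta_{ab}\,e_a\otimes e_b$ with $\Theta_{ab}=\Theta_{ba}\in\mathbb R$, and $$\lambda=\sqrt{\Theta_{ul}^2+\Theta_{un}^2},\quad \theta=\begin{pmatrix}\Theta_{ll}&\Theta_{ln}\\ \Theta_{ln}&\Theta_{nn}\end{pmatrix},\quad T=\operatorname{Tr}\theta,\quad \Delta=\det\theta,\quad \mathcal B_t=\int_0^t\beta_\tau\,\mathrm d\tau,$$ and, if $\lambda\ne0$, $y_t=\lambda\mathcal B_t+\arctan(\Theta_{uu}/\lambda)$. Write $\alpha\odot\gamma=\alpha\otimes\gamma+\gamma\otimes\alpha$. Denote by $\mathrm E(1,1)$, $\tau_2\oplus\mathbb R$ and $\tau_{3,\mu}$ the semidirect products $\mathbb R\ltimes\mathbb R^2$ in which $s\in\mathbb R$ acts on $\mathbb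 R^2$ by $\mathrm{diag}(e^s,e^{-s})$, $\mathrm{diag}(e^s,1)$ and $\mathrm{diag}(e^s,e^{\mu s})$ respectively (the simply connected Lie groups with Lie algebras $[f_1,f_2]=f_2$, $[f_1,f_3]=c f_3$, $[f_2,f_3]=0$ for $c=-1,0,\mu$). 1. Let $\lambda=0$. If $\Theta_{uu}\ne0$, put $\rho_\pm=\frac{T\pm\sqrt{T^2-4\Delta}}{2\Theta_{uu}}$. There is an orthogonal matrix $Q$ with $\theta/\Theta_{uu}=Q\,\mathrm{diag}(\rho_+,\rho_-)\,Q^*$, and for each such $Q$ and every $t\in\mathcal I$ one has $1-\Theta_{uu}\mathcal B_t>0$ and $$h_{\mathfrak e^t}=(1-\Theta_{uu}\mathcal B_t)^2e_u\otimes e_u+(e_l,e_n)\,Q\begin{pmatrix}(1-\Theta_{uu}\mathcal B_t)^{2\rho_+}&0\\0&(1-\Theta_{uu}\mathcal B_t)^{2\rho_-}\end{pmatrix}Q^*\begin{pmatrix}e_l\\e_n\end{pmatrix}.$$ If $\Theta_{uu}=0$, put $\kappa_\pm=\frac{T\pm\sqrt{T^2-4\Delta}}2$. There is an orthogonal $Q$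 with $\theta=Q\,\mathrm{diag}(\kappa_+,\kappa_-)\,Q^*$, and for each such $Q$ and every $t\in\mathcal I$ (this is the limit $\Theta_{uu}\to0$ of the previous formula) $$h_{\mathfrak e^t}=e_u\otimes e_u+(e_l,e_n)\,Q\begin{pmatrix}e^{-2\kappa_+\mathcal B_t}&0\\0&e^{-2\kappa_-\mathcal B_t}\end{pmatrix}Q^*\begin{pmatrix}e_l\\e_n\end{pmatrix}.$$ As a Lie group, $G\cong\mathbb R^3$ if $\theta=0$; $G\cong\mathrm E(1,1)$ if $T=0$ and $\theta\neq0$; $G\cong\tau_2\oplus\mathbb R$ if $T\ne0$ and $\Delta=0$; and $G\cong\tau_{3,\mu}$ with $\mu=\frac{T-\operatorname{sign}(T)\sqrt{T^2-4\Delta}}{T+\operatorname{sign}(T)\sqrt{T^2-4\Delta}}\in(-1,1]\setminus\{0\}$ if $T\neq0$ and $\Delta\ne0$. 2. Let $\Theta_{ul}=0$ and $\Theta_{un}\neq0$. Then $G\cong\tau_2\oplus\mathbb R$, and for every $t\in\mathcal I$ one has $|y_t|<\frac\pi2$ and $$\begin{aligned}h_{\mathfrak e^t}={}&\Big((1-\Theta_{uu}\mathcal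 B_t)^2\sec^2y_t+\tfrac{\Theta_{uu}^2}{\lambda^2}-\tfrac{2\Theta_{uu}}{\lambda}(1-\Theta_{uu}\mathcal B_t)\tan y_t\Big)e_u\otimes e_u\\&+\Big(\tfrac{\Theta_{uu}}{\Theta_{un}}-\Theta_{un}\mathcal B_t\sec^2y_t\,(1-\Theta_{uu}\mathcal B_t)-\tfrac{\lambda}{\Theta_{un}}\tan y_t\,(1-2\Theta_{uu}\mathcal B_t)\Big)e_u\odot e_n\\&+e_l\otimes e_l+\big(1+\lambda^2\mathcal B_t^2\sec^2y_t+2\mathcal B_t\lambda\tan y_t\big)e_n\otimes e_n.\end{aligned}$$ If $\Theta_{ul}\ne0$ and $\Theta_{un}=0$, the same holds with the indices $l$ and $n$ exchanged. 3. Let $\Theta_{ul}\Theta_{un}\ne0$. Then $G\cong\tau_2\oplus\mathbb R$, and for every $t\in\mathcal I$ one has $|y_t|<\frac\pi2$ and $$\begin{aligned}h_{\mathfrak e^t}={}&\Big((1+T\mathcal B_t)^2+\big(\tan y_t\,(1+T\mathcal B_t)+\tfrac T\lambda\big)^2\Big)e_u\otimes e_u\\&-\Big(\tfrac T{\lambda^2}+\tfrac{\tan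 y_t}\lambda(1+2T\mathcal B_t)+\mathcal B_t(1+T\mathcal B_t)\sec^2y_t\Big)(\Theta_{ul}\,e_u\odot e_l+\Theta_{un}\,e_u\odot e_n)\\&+\Big(1+\Theta_{ul}^2\mathcal B_t\big(\mathcal B_t\sec^2y_t+\tfrac{2\tan y_t}\lambda\big)\Big)e_l\otimes e_l+\Theta_{ul}\Theta_{un}\mathcal B_t\sec^2y_t\Big(\mathcal B_t+\tfrac{\sin2y_t}\lambda\Big)e_l\odot e_n\\&+\Big(1+\Theta_{un}^2\mathcal B_t\big(\mathcal B_t\sec^2y_t+\tfrac{2\tan y_t}\lambda\big)\Big)e_n\otimes e_n.\end{aligned}$$ 4. Suppose in addition that $\beta_t$ is given for all $t\in\mathbb R$, as a smooth family of positive left-invariant functions. Call the flow globally defined if $\{\mathfrak e^t\}_{t\in\mathcal I}$ extends to a family of coframes on $t\in\mathbb R$ that together with $\{\beta_t\}_{t\in\mathbb R}$ is a left-invariant parallel spinor flow. If $\lambda=0$, the flow is globally defined if and only if there is no $t_0\in\mathbb R$ with $\Theta_{uu}\int_0^{t_0}\beta_\tau\,\mathrm d\tau=1$; that is, if and only if $\int_0^\infty\beta_\tau\,\mathrm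 d\tau\le|\Theta_{uu}^{-1}|$ in case $\Theta_{uu}>0$, if and only if $\int_{-\infty}^0\beta_\tau\,\mathrm d\tau\le|\Theta_{uu}^{-1}|$ in case $\Theta_{uu}<0$, and always in case $\Theta_{uu}=0$. If $\lambda\ne0$, the flow is globally defined if and only if $|y_t|<\frac\pi2$ for all $t\in\mathbb R$. -/

import Mathlib

open scoped Manifold ContDiff

namespace ParallelSpinor

noncomputable section

/-- The labels `u, l, n` of the elements of a coframe `(e_u, e_l, e_n)`. -/
inductive FrameIndex : Type
  | u | l | n
  deriving DecidableEq

instance : Fintype FrameIndex := ⟨{.u, .l, .n}, fun a => by cases a <;> simp⟩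

/-! ### Tensors on a three-manifold -/

section Manifold

/-- One-forms on a three-manifold. -/
abbrev OneForm (M : Type*) [TopologicalSpace M] [ChartedSpace (EuclideanSpace ℝ (Fin 3)) M] :=
  (p : M) → TangentSpace (𝓡 3) p →L[ℝ] ℝ

/-- Covariant two-tensors on a three-manifold, as functions of a point and two tangent vectors. -/
abbrev TwoTensor (M : Type*) [TopologicalSpace M] [ChartedSpace (EuclideanSpace ℝ (Fin 3)) M] :=
  (p : M) → TangentSpace (𝓡 3) p → TangentSpace (𝓡 3) p → ℝ

variable {M : Type*} [TopologicalSpace M] [ChartedSpace (EuclideanSpace ℝ (Fin 3)) M]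

/-- `α ⊗ γ`. -/
def tensorProd (α γ : OneForm M) : TwoTensor M := fun p v w => α p v * γ p w

/-- `α ⊙ γ = α ⊗ γ + γ ⊗ α`. -/
def symProd (α γ : OneForm M) : TwoTensor M := tensorProd α γ + tensorProd γ α

/-- `α ∧ γ = α ⊗ γ - γ ⊗ α`. -/
def wedge (α γ : OneForm M) : TwoTensor M := tensorProd α γ - tensorProd γ α

/-- The tensor `(α, γ) A (α, γ)ᵀ` of a two by two matrix `A`. -/
def matrixTensor (A : Matrix (Fin 2) (Fin 2) ℝ) (α γ : OneForm M) : TwoTensor M :=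
  A 0 0 • tensorProd α α + A 0 1 • tensorProd α γ + A 1 0 • tensorProd γ α +
    A 1 1 • tensorProd γ γ

/-- The differential `df` of a function. -/
def differential (f : M → ℝ) : OneForm M := fun p => mfderiv (𝓡 3) 𝓘(ℝ, ℝ) f p

/-- The metric `h_𝔢 = e_u ⊗ e_u + e_l ⊗ e_l + e_n ⊗ e_n` of a coframe. -/
def coframeMetric (e : FrameIndex → OneForm M) : TwoTensor M :=
  ∑ a, tensorProd (e a) (e a)

/-- The metric dual `α^♯` of a one-form with respect to the metric of the coframe `e`:
the vector `v` with `h_𝔢(v, ·) = α`. It exists and is unique when `e` is a coframe. -/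
def sharp (e : FrameIndex → OneForm M) (α : OneForm M) (p : M) : TangentSpace (𝓡 3) p :=
  Classical.epsilon fun v => ∀ w, coframeMetric e p v w = α p w

/-- The shape operator `Θ_t = -(1 / (2 β_t)) ∂_t h_{𝔢^t}`. -/
def shapeOperator (β : ℝ → M → ℝ) (e : ℝ → FrameIndex → OneForm M) (t : ℝ) : TwoTensor M :=
  fun p v w => -(1 / (2 * β t p)) * deriv (fun s => coframeMetric (e s) p v w) t

/-- The components `Θ^t_{ab} = Θ_t((e_a^t)^♯, (e_b^t)^♯)` of the shape operator, that is,
`Θ_t = ∑_{a, b} Θ^t_{ab} e_a^t ⊗ e_b^t`. -/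
def shapeComponents (β : ℝ → M → ℝ) (e : ℝ → FrameIndex → OneForm M) (t : ℝ) (p : M) :
    Matrix FrameIndex FrameIndex ℝ :=
  Matrix.of fun a b =>
    shapeOperator β e t p (sharp (e t) (e t a) p) (sharp (e t) (e t b) p)

/-- The one-form `Θ_t(e_a^t) = Θ_t((e_a^t)^♯, ·) = ∑_b Θ^t_{ab} e_b^t`. -/
def shapeOn (β : ℝ → M → ℝ) (e : ℝ → FrameIndex → OneForm M) (t : ℝ) (a : FrameIndex) :
    OneForm M :=
  fun p => ∑ b, shapeComponents β e t p a b • e t b p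

/-- The function `dβ_t(e_a^t) = dβ_t((e_a^t)^♯)`. -/
def lapseDeriv (β : ℝ → M → ℝ) (e : ℝ → FrameIndex → OneForm M) (t : ℝ) (a : FrameIndex) :
    M → ℝ :=
  fun p => differential (β t) p (sharp (e t) (e t a) p)

variable [IsManifold (𝓡 3) ∞ M]

/-- Smooth vector fields. -/
def IsSmoothVectorField (X : (p : M) → TangentSpace (𝓡 3) p) : Prop :=
  ContMDiff (𝓡 3) (𝓡 3).tangent ∞ fun p => (⟨p, X p⟩ : TangentBundle (𝓡 3) M)

/-- `dα = η`, through `dα(X, Y) = X(α(Y)) - Y(α(X)) - α([X, Y])` for smooth vector fields. -/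
def IsExtDeriv (α : OneForm M) (η : TwoTensor M) : Prop :=
  ∀ X Y : (p : M) → TangentSpace (𝓡 3) p, IsSmoothVectorField X → IsSmoothVectorField Y →
    ∀ p : M, η p (X p) (Y p) =
      differential (fun q => α q (Y q)) p (X p) - differential (fun q => α q (X q)) p (Y p) -
        α p (VectorField.mlieBracket (𝓡 3) X Y p)

/-- `[α] = 0` in the first de Rham cohomology: `α` is closed and is the differential of a smooth
function. -/
def IsZeroInCohomology (α : OneForm M) : Prop :=
  IsExtDeriv α 0 ∧ ∃ f : M → ℝ, ContMDiff (𝓡 3) 𝓘(ℝ, ℝ) ∞ f ∧ differential f = α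

/-- `{β_t}`, `t ∈ J`, is a smooth family of strictly positive functions. -/
structure IsLapse (J : Set ℝ) (β : ℝ → M → ℝ) : Prop where
  smooth : ContMDiffOn (𝓘(ℝ, ℝ).prod (𝓡 3)) 𝓘(ℝ, ℝ) ∞
    (fun q : ℝ × M => β q.1 q.2) (J ×ˢ Set.univ)
  pos : ∀ t ∈ J, ∀ p, 0 < β t p

/-- `{𝔢^t}`, `t ∈ J`, is a smooth family of coframes. -/
structure IsCoframeFamily (J : Set ℝ) (e : ℝ → FrameIndex → OneForm M) : Prop where
  smooth : ∀ X : (p : M) → TangentSpace (𝓡 3) p, IsSmoothVectorField X → ∀ a,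
    ContMDiffOn (𝓘(ℝ, ℝ).prod (𝓡 3)) 𝓘(ℝ, ℝ) ∞
      (fun q : ℝ × M => e q.1 a q.2 (X q.2)) (J ×ˢ Set.univ)
  linearIndependent : ∀ t ∈ J, ∀ p, LinearIndependent ℝ fun a => e t a p

/-- A parallel spinor flow `{β_t, 𝔢^t}`, `t ∈ J`, on a three-manifold, where `J` is an open
interval containing `0`. -/
structure IsParallelSpinorFlow (J : Set ℝ) (β : ℝ → M → ℝ) (e : ℝ → FrameIndex → OneForm M) :
    Prop where
  isOpen : IsOpen J
  ordConnected : J.OrdConnected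
  zero_mem : (0 : ℝ) ∈ J
  lapse : IsLapse J β
  coframe : IsCoframeFamily J e
  /-- `∂_t e_a^t + dβ_t(e_a^t) e_u^t + β_t Θ_t(e_a^t) = δ_{au} dβ_t` -/
  evolution : ∀ t ∈ J, ∀ a p v,
    deriv (fun s => e s a p v) t + lapseDeriv β e t a p * e t .u p v +
      β t p * shapeOn β e t a p v = if a = .u then differential (β t) p v else 0
  /-- `d e_a^t = Θ_t(e_a^t) ∧ e_u^t` -/
  structure_eq : ∀ t ∈ J, ∀ a, IsExtDeriv (e t a) (wedge (shapeOn β e t a) (e t .u))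
  /-- `∂_t (Θ_t(e_u^t)) + d(dβ_t(e_u^t)) = 0` -/
  evolution_shape : ∀ t ∈ J, ∀ p v,
    deriv (fun s => shapeOn β e s .u p v) t + differential (lapseDeriv β e t .u) p v = 0
  /-- `[Θ_t(e_u^t)] = 0` in `H¹` -/
  cohomology : ∀ t ∈ J, IsZeroInCohomology (shapeOn β e t .u)

end Manifold

/-! ### Left-invariance on a three-dimensional Lie group -/

section LieGroup

variable {G : Type*} [TopologicalSpace G] [ChartedSpace (EuclideanSpace ℝ (Fin 3)) G] [Group G]

/-- Left-invariant one-forms: `L_g^* α = α` for every `g`. -/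
def IsLeftInvariantForm (α : OneForm G) : Prop :=
  ∀ g p : G, ∀ v : TangentSpace (𝓡 3) p,
    α (g * p) (mfderiv (𝓡 3) (𝓡 3) (fun x => g * x) p v) = α p v

/-- Left-invariant functions. -/
def IsLeftInvariantFun (f : G → ℝ) : Prop := ∀ g p : G, f (g * p) = f p

variable [LieGroup (𝓡 3) ∞ G]

/-- Left-invariant parallel spinor flows. -/
structure IsLeftInvariantFlow (J : Set ℝ) (β : ℝ → G → ℝ) (e : ℝ → FrameIndex → OneForm G) :
    Prop where
  flow : IsParallelSpinorFlow J β e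
  lapse_invariant : ∀ t ∈ J, IsLeftInvariantFun (β t)
  coframe_invariant : ∀ t ∈ J, ∀ a, IsLeftInvariantForm (e t a)

/-- The left-invariant parallel spinor flow `{β_t, 𝔢^t}`, `t ∈ J`, is globally defined: with the
lapse `β_t`, `t ∈ ℝ`, the family of coframes extends to a left-invariant parallel spinor flow
on the whole real line. -/
def IsGloballyDefined (J : Set ℝ) (β : ℝ → G → ℝ) (e : ℝ → FrameIndex → OneForm G) : Prop :=
  ∃ e' : ℝ → FrameIndex → OneForm G,
    (∀ t ∈ J, e' t = e t) ∧ IsLeftInvariantFlow Set.univ β e'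

/-- `𝓑_t = ∫_0^t β_τ dτ`, for functions `β_τ` that are constant on `G`. -/
def lapseIntegral (β : ℝ → G → ℝ) (t : ℝ) : ℝ := ∫ τ in (0 : ℝ)..t, β τ 1

end LieGroup

/-! ### The simply connected Lie groups that occur -/

section Models

/-- The semidirect product `ℝ ⋉ ℝ²` where `s ∈ ℝ` acts on `ℝ²` by `diag(exp (a s), exp (b s))`.
It is the simply connected Lie group whose Lie algebra has a basis `f₁, f₂, f₃` with
`[f₁, f₂] = a f₂`, `[f₁, f₃] = b f₃`, `[f₂, f₃] = 0`. -/
def SemidirectLine (_a _b : ℝ) : Type := ℝ × ℝ × ℝ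

variable {a b : ℝ}

instance : TopologicalSpace (SemidirectLine a b) := inferInstanceAs (TopologicalSpace (ℝ × ℝ × ℝ))

instance : ChartedSpace (ℝ × ℝ × ℝ) (SemidirectLine a b) :=
  inferInstanceAs (ChartedSpace (ℝ × ℝ × ℝ) (ℝ × ℝ × ℝ))

instance : Group (SemidirectLine a b) where
  mul x y := (x.1 + y.1, x.2.1 + Real.exp (a * x.1) * y.2.1, x.2.2 + Real.exp (b * x.1) * y.2.2)
  one := (0, 0, 0)
  inv x := (-x.1, -(Real.exp (-(a * x.1)) * x.2.1), -(Real.exp (-(b * x.1)) * x.2.2))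
  mul_assoc x y z := by
    refine Prod.ext ?_ (Prod.ext ?_ ?_)
    · exact add_assoc x.1 y.1 z.1
    · change (x.2.1 + Real.exp (a * x.1) * y.2.1) + Real.exp (a * (x.1 + y.1)) * z.2.1 =
        x.2.1 + Real.exp (a * x.1) * (y.2.1 + Real.exp (a * y.1) * z.2.1)
      rw [mul_add, Real.exp_add]; ring
    · change (x.2.2 + Real.exp (b * x.1) * y.2.2) + Real.exp (b * (x.1 + y.1)) * z.2.2 =
        x.2.2 + Real.exp (b * x.1) * (y.2.2 + Real.exp (b * y.1) * z.2.2)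
      rw [mul_add, Real.exp_add]; ring
  one_mul x := by
    refine Prod.ext ?_ (Prod.ext ?_ ?_)
    · exact zero_add x.1
    · change (0 : ℝ) + Real.exp (a * 0) * x.2.1 = x.2.1
      simp
    · change (0 : ℝ) + Real.exp (b * 0) * x.2.2 = x.2.2
      simp
  mul_one x := by
    refine Prod.ext ?_ (Prod.ext ?_ ?_)
    · exact add_zero x.1
    · change x.2.1 + Real.exp (a * x.1) * 0 = x.2.1
      simp
    · change x.2.2 + Real.exp (b * x.1) * 0 = x.2.2
      simp
  inv_mul_cancel x := by
    refine Prod.ext ?_ (Prod.ext ?_ ?_)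
    · exact neg_add_cancel x.1
    · change -(Real.exp (-(a * x.1)) * x.2.1) + Real.exp (a * -x.1) * x.2.1 = 0
      rw [mul_neg]; ring
    · change -(Real.exp (-(b * x.1)) * x.2.2) + Real.exp (b * -x.1) * x.2.2 = 0
      rw [mul_neg]; ring

instance : IsManifold 𝓘(ℝ, ℝ × ℝ × ℝ) ∞ (SemidirectLine a b) :=
  inferInstanceAs (IsManifold 𝓘(ℝ, ℝ × ℝ × ℝ) ∞ (ℝ × ℝ × ℝ))

instance : LieGroup 𝓘(ℝ, ℝ × ℝ × ℝ) ∞ (SemidirectLine a b) where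
  contMDiff_mul := by
    have h : ContDiff ℝ ∞ fun q : (ℝ × ℝ × ℝ) × (ℝ × ℝ × ℝ) =>
        (q.1.1 + q.2.1, q.1.2.1 + Real.exp (a * q.1.1) * q.2.2.1,
          q.1.2.2 + Real.exp (b * q.1.1) * q.2.2.2) := by fun_prop
    have h' := h.contMDiff
    rw [modelWithCornersSelf_prod, ← chartedSpaceSelf_prod] at h'
    exact h'
  contMDiff_inv := by
    have h : ContDiff ℝ ∞ fun x : ℝ × ℝ × ℝ =>
        (-x.1, -(Real.exp (-(a * x.1)) * x.2.1), -(Real.exp (-(b * x.1)) * x.2.2)) := by fun_prop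
    exact h.contMDiff

/-- `E(1,1)`: the translations and boosts of the Minkowski plane, in null coordinates. -/
abbrev E11 : Type := SemidirectLine 1 (-1)

/-- `τ₂ ⊕ ℝ`: the product of the group of orientation preserving affine maps of the line
(Lie algebra `[f₁, f₂] = f₂`) and `ℝ`. -/
abbrev Tau2R : Type := SemidirectLine 1 0

/-- `τ_{3,μ}`, with Lie algebra `[f₁, f₂] = f₂`, `[f₁, f₃] = μ f₃`. -/
abbrev Tau3 (μ : ℝ) : Type := SemidirectLine 1 μ

variable (G : Type*) [TopologicalSpace G] [ChartedSpace (EuclideanSpace ℝ (Fin 3)) G] [Group G]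

/-- `G` is isomorphic, as a Lie group, to the additive group `ℝ³`. -/
def IsIsoR3 : Prop :=
  ∃ φ : Diffeomorph (𝓡 3) (𝓡 3) G (EuclideanSpace ℝ (Fin 3)) ∞,
    ∀ g h : G, φ (g * h) = φ g + φ h

/-- `G` is isomorphic, as a Lie group, to `H`. -/
def IsIsoTo (H : Type*) [TopologicalSpace H] [ChartedSpace (ℝ × ℝ × ℝ) H] [Group H] : Prop :=
  ∃ φ : Diffeomorph (𝓡 3) 𝓘(ℝ, ℝ × ℝ × ℝ) G H ∞, ∀ g h : G, φ (g * h) = φ g * φ h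

end Models

end

end ParallelSpinor

open ParallelSpinor

/-! Left invariance makes the lapse constant on `G`, so the flow is an ordinary differential
equation at the identity: `∂_t e_a = -β ∑ Θ_ab e_b`, while the structure equations become the Lie
brackets of the group. The form `w = Θ(e_u)` is closed and independent of time, so `e_u^t = e_u -
B_t w`. Closedness of `w` makes `Θ_ul`, `Θ_un` constant and yields the Riccati equation `∂_t Θ_uu =
β (Θ_uu² + λ²)`; the Jacobi identity yields `Θ_al Θ_un = Θ_an Θ_ul`. All this is collected in
`IsLeftInvariantFlow.invariantEvolution`.

If `λ = 0`, then `e_u` is rescaled by `1 - Θ_uu B_t`. As brackets do not depend on time, the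
remaining two forms solve a linear system with matrix `θ` times the scalar `β / (1 - Θ_uu B)`, which
is integrated in an eigenbasis of `θ` (`InvariantEvolution.coframe_quasidiagonal`). If `λ ≠ 0`, the
algebraic relations force `θ = -Θ_uu λ⁻² m ⊗ m` with `m = (Θ_ul, Θ_un)`, the Riccati equation gives
`Θ_uu = λ tan y_t`, and `k = -Θ_un e_l + Θ_ul e_n` is conserved. The forms `e_u^t`, `w`, `k` then
determine the coframe, and both metric formulas expand the single identity `coframeMetric_rotating`.

The group is read off from a left-invariant coframe with `dα = 0`, `dα₁ = a α₁ ∧ α`, `dα₂ = b α₂ ∧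
α`. On a simply connected group `α = df`, and `exp (a f) α₁`, `exp (b f) α₂` are closed, hence
exact. The three primitives form a homomorphism to `ℝ ⋉ ℝ²` with invertible derivative, which is a
covering of a simply connected group and therefore an isomorphism (`isIsoTo_semidirectLine`). The
coframe consists of a multiple of `e_u` and eigenforms of `θ` if `λ = 0`, and of `-w`, `e_u`, `k`
otherwise; for `θ = 0` the action is trivial.

For global existence, the explicit coframes solve the flow equations as long as the formulas make
sense (`of_matrix`); conversely, the bounds on `1 - Θ_uu B_t` and `y_t` hold along every flow, in
particular along a global extension. -/

namespace ParallelSpinor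

/-! ### Gluing local primitives over a simply connected space. -/

/-- The real numbers with the discrete topology. -/
structure DiscreteReal where
  /-- The underlying real number. -/
  val : ℝ

instance : TopologicalSpace DiscreteReal := ⊥

instance : DiscreteTopology DiscreteReal := ⟨rfl⟩

open Filter Topology Set in
/-- On a simply connected space, a family of functions on an open cover whose differences are
locally constant glues, up to locally constant functions, to a global function. -/
theorem exists_glue_of_locally_const_sub {M ι : Type*} [TopologicalSpace M]
    [SimplyConnectedSpace M] [LocallyPathConnectedSpace M] (U : ι → Set M)
    (hU : ∀ i, IsOpen (U i)) (hcov : ∀ x, ∃ i, x ∈ U i) (f : ι → M → ℝ)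
    (hf : ∀ i j, ∀ x ∈ U i ∩ U j, ∀ᶠ y in 𝓝 x, f i y - f j y = f i x - f j x) :
    ∃ F : M → ℝ, ∀ i, ∀ x ∈ U i, ∀ᶠ y in 𝓝 x, F y - f i y = F x - f i x := by
  classical
  choose idx hidx using hcov
  -- A point `v` of the fibre in chart `i` stands for the value `f i x + v` of the function to be
  -- found; this value is unchanged by the transition maps.
  let Z : FiberBundleCore ι M DiscreteReal :=
    { baseSet := U
      isOpen_baseSet := hU
      indexAt := idx
      mem_baseSet_at := hidx
      coordChange := fun i j x v => ⟨v.val + (f i x - f j x)⟩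
      coordChange_self := fun i x _ v => by
        simp
      continuousOn_coordChange := by
        rintro i j ⟨x, v⟩ ⟨hx, -⟩
        apply ContinuousAt.continuousWithinAt
        have h1 : ∀ᶠ q : M × DiscreteReal in 𝓝 (x, v), q.2 = v := by
          rw [nhds_prod_eq]
          have : ∀ᶠ w in 𝓝 v, w = v := by simp [nhds_discrete]
          exact this.prod_inr _
        have h2 : ∀ᶠ q : M × DiscreteReal in 𝓝 (x, v), f i q.1 - f j q.1 = f i x - f j x := by
          rw [nhds_prod_eq]
          exact (hf i j x hx).prod_inl _
        refine (continuousAt_const (y := (⟨v.val + (f i x - f j x)⟩ : DiscreteReal))).congr ?_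
        filter_upwards [h1, h2] with q hq1 hq2
        rw [hq1, hq2]
      coordChange_comp := fun i j k x _ v => by
        congr 1
        ring }
  have hcover : IsCoveringMap Z.proj := FiberBundle.isCoveringMap (F := DiscreteReal) (E := Z.Fiber)
  obtain ⟨x₀⟩ : Nonempty M := inferInstance
  -- Simple connectedness lifts the identity through the covering, that is, provides a global
  -- section.
  obtain ⟨s, ⟨-, hs⟩, -⟩ := hcover.existsUnique_continuousMap_lifts (ContinuousMap.id M) x₀
    ⟨x₀, DiscreteReal.mk 0⟩ rfl
  have hs' : ∀ x, (s x).1 = x := fun x => congrFun hs x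
  refine ⟨fun x => f (idx x) x + DiscreteReal.val (s x).2, fun i x hx => ?_⟩
  have hcont : ContinuousAt (fun y => ((Z.localTriv i) (s y)).2) x := by
    have hx' : s x ∈ (Z.localTriv i).source := by
      rw [FiberBundleCore.mem_localTriv_source]
      change (s x).1 ∈ U i
      rw [hs']; exact hx
    exact continuous_snd.continuousAt.comp
      (((Z.localTriv i).toOpenPartialHomeomorph.continuousAt hx').comp s.continuous.continuousAt)
  have hev : ∀ᶠ y in 𝓝 x, ((Z.localTriv i) (s y)).2 = ((Z.localTriv i) (s x)).2 := by
    have := hcont.eventually (p := fun w => w = ((Z.localTriv i) (s x)).2)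
      (by simp [nhds_discrete])
    exact this
  have key : ∀ y, ((Z.localTriv i) (s y)).2.val = f (idx y) y + DiscreteReal.val (s y).2 - f i y := by
    intro y
    have : ((Z.localTriv i) (s y)).2 =
      ⟨DiscreteReal.val (s y).2 + (f (idx (s y).1) (s y).1 - f i (s y).1)⟩ := rfl
    rw [this, hs']
    ring
  filter_upwards [hev] with y hy
  have := congrArg DiscreteReal.val hy
  rwa [key, key] at this

/-! ### Left-invariant vector fields, and exactness of closed one-forms. -/

section ClosedForms

variable {G : Type*} [TopologicalSpace G] [ChartedSpace (EuclideanSpace ℝ (Fin 3)) G] [Group G]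
  [LieGroup (𝓡 3) ∞ G]

/-- The regularity at which `GroupLieAlgebra` is a Lie ring, needed for the Jacobi identity. -/
instance lieGroup_minSmoothness : LieGroup (𝓡 3) (minSmoothness ℝ 3) G := by
  rw [minSmoothness_of_isRCLikeNormedField]
  infer_instance

theorem mdifferentiable_mul_left (g : G) : MDifferentiable (𝓡 3) (𝓡 3) (fun x : G => g * x) :=
  (contMDiff_mul_left (I := 𝓡 3) (n := ∞) (a := g)).mdifferentiable (by simp)

theorem isInvertible_mfderiv_mul_left (g h : G) :
    (mfderiv (𝓡 3) (𝓡 3) (fun x : G => g * x) h).IsInvertible := by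
  have h1 : ∀ a b : G, (mfderiv (𝓡 3) (𝓡 3) (fun x : G => a⁻¹ * x) (a * b)).comp
      (mfderiv (𝓡 3) (𝓡 3) (fun x : G => a * x) b) =
      mfderiv (𝓡 3) (𝓡 3) (id : G → G) b := by
    intro a b
    rw [← mfderiv_comp (I' := 𝓡 3) b (mdifferentiable_mul_left _ _)
      (mdifferentiable_mul_left _ _)]
    congr 1
    ext x
    simp
  have h2 := h1 g⁻¹ (g * h)
  rw [inv_inv, inv_mul_cancel_left] at h2
  refine ContinuousLinearMap.IsInvertible.of_inverse
    (g := mfderiv (𝓡 3) (𝓡 3) (fun x : G => g⁻¹ * x) (g * h)) ?_ ?_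
  · exact h2.trans mfderiv_id
  · exact (h1 g h).trans mfderiv_id

open Bundle in
/-- Left-invariant vector fields are smooth. -/
theorem isSmoothVectorField_mulInvariantVectorField (v : GroupLieAlgebra (𝓡 3) G) :
    IsSmoothVectorField (mulInvariantVectorField v : (g : G) → TangentSpace (𝓡 3) g) := by
  let fg : G → TangentBundle (𝓡 3) G := fun g ↦ TotalSpace.mk' _ g 0
  have sfg : ContMDiff (𝓡 3) (𝓡 3).tangent ∞ fg := contMDiff_zeroSection _ _
  let fv : G → TangentBundle (𝓡 3) G := fun _ ↦ TotalSpace.mk' _ 1 v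
  have sfv : ContMDiff (𝓡 3) (𝓡 3).tangent ∞ fv := contMDiff_const
  let F₁ : G → (TangentBundle (𝓡 3) G × TangentBundle (𝓡 3) G) := fun g ↦ (fg g, fv g)
  have S₁ : ContMDiff (𝓡 3) ((𝓡 3).tangent.prod (𝓡 3).tangent) ∞ F₁ := sfg.prodMk sfv
  let F₂ : (TangentBundle (𝓡 3) G × TangentBundle (𝓡 3) G) →
      TangentBundle ((𝓡 3).prod (𝓡 3)) (G × G) :=
    (equivTangentBundleProd (𝓡 3) G (𝓡 3) G).symm
  have S₂ : ContMDiff ((𝓡 3).tangent.prod (𝓡 3).tangent) ((𝓡 3).prod (𝓡 3)).tangent ∞ F₂ :=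
    contMDiff_equivTangentBundleProd_symm
  let F₃ : TangentBundle ((𝓡 3).prod (𝓡 3)) (G × G) → TangentBundle (𝓡 3) G :=
    tangentMap ((𝓡 3).prod (𝓡 3)) (𝓡 3) (fun (p : G × G) ↦ p.1 * p.2)
  have S₃ : ContMDiff ((𝓡 3).prod (𝓡 3)).tangent (𝓡 3).tangent ∞ F₃ :=
    ContMDiff.contMDiff_tangentMap (contMDiff_mul (𝓡 3) ∞) (by simp)
  let S := (S₃.comp S₂).comp S₁
  refine S.congr fun g => ?_
  -- The invariant field at `g` is the derivative of multiplication at `(g, 1)` applied to `(0, v)`,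
  -- hence depends smoothly on `g`.
  have hd := mfderiv_prod_eq_add_apply (I := 𝓡 3) (I' := 𝓡 3) (I'' := 𝓡 3)
    (f := fun p : G × G => p.1 * p.2) (p := (g, 1)) (v := ((0 : TangentSpace (𝓡 3) g), v))
    ((contMDiff_mul (𝓡 3) ∞).mdifferentiableAt (by simp))
  have h0 : mfderiv (𝓡 3) (𝓡 3) (fun z : G => z * 1) g (0 : TangentSpace (𝓡 3) g) = 0 :=
    map_zero _
  have h : F₃ (F₂ (F₁ g)) = ⟨g * 1, mulInvariantVectorField v g⟩ := by
    change (⟨g * 1, _⟩ : TangentBundle (𝓡 3) G) = _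
    congr 1
    exact hd.trans ((congrArg₂ (· + ·) h0 rfl).trans (zero_add _))
  change _ = F₃ (F₂ (F₁ g))
  rw [h]
  ext
  · simp
  · rfl

end ClosedForms

section ClosedForms

/-- Smooth one-forms: smooth on smooth vector fields. -/
def IsSmoothForm {M : Type*} [TopologicalSpace M] [ChartedSpace (EuclideanSpace ℝ (Fin 3)) M]
    [IsManifold (𝓡 3) ∞ M] (α : OneForm M) : Prop :=
  ∀ X : (p : M) → TangentSpace (𝓡 3) p, IsSmoothVectorField X →
    ContMDiff (𝓡 3) 𝓘(ℝ, ℝ) ∞ fun q => α q (X q)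

variable {G : Type*} [TopologicalSpace G] [ChartedSpace (EuclideanSpace ℝ (Fin 3)) G] [Group G]
  [LieGroup (𝓡 3) ∞ G]

local notation "E3" => EuclideanSpace ℝ (Fin 3)

theorem mlieBracket_eq_lieBracket (V W : (z : E3) → TangentSpace 𝓘(ℝ, E3) z) (z : E3) :
    VectorField.mlieBracket 𝓘(ℝ, E3) V W z = VectorField.lieBracket ℝ V W z := by
  rw [← VectorField.mlieBracketWithin_univ, VectorField.mlieBracketWithin_eq_lieBracketWithin]
  exact congrFun (VectorField.lieBracketWithin_univ (𝕜 := ℝ) (V := V) (W := W)) z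

theorem contMDiffAt_extChartAt_symm (x : G) {z : E3} (hz : z ∈ (extChartAt (𝓡 3) x).target) :
    ContMDiffAt 𝓘(ℝ, E3) (𝓡 3) ∞ (extChartAt (𝓡 3) x).symm z := by
  have h := contMDiffWithinAt_extChartAt_symm_target (I := 𝓡 3) (n := ∞) x hz
  exact h.contMDiffAt ((isOpen_extChartAt_target x).mem_nhds hz)

theorem isInvertible_mfderiv_extChartAt_symm (x : G) {z : E3}
    (hz : z ∈ (extChartAt (𝓡 3) x).target) :
    (mfderiv 𝓘(ℝ, E3) (𝓡 3) (extChartAt (𝓡 3) x).symm z).IsInvertible := by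
  have h := isInvertible_mfderivWithin_extChartAt_symm (I := 𝓡 3) (x := x) hz
  rwa [ModelWithCorners.range_eq_univ, mfderivWithin_univ] at h

/-- The coordinate expression of the left-invariant vector field with value `v` at the
identity. -/
noncomputable def chartField (x : G) (v : GroupLieAlgebra (𝓡 3) G) (z : E3) : E3 :=
  VectorField.mpullback 𝓘(ℝ, E3) (𝓡 3) (extChartAt (𝓡 3) x).symm
    (mulInvariantVectorField v : (g : G) → TangentSpace (𝓡 3) g) z

/-- The coordinate expression of a one-form. -/
noncomputable def chartForm (x : G) (α : OneForm G) (z : E3) : E3 →L[ℝ] ℝ :=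
  (α ((extChartAt (𝓡 3) x).symm z)).comp (mfderiv 𝓘(ℝ, E3) (𝓡 3) (extChartAt (𝓡 3) x).symm z)

theorem contDiffOn_chartField (x : G) (v : GroupLieAlgebra (𝓡 3) G) :
    ContDiffOn ℝ ∞ (chartField x v) (extChartAt (𝓡 3) x).target := by
  intro z hz
  apply ContDiffAt.contDiffWithinAt
  have h := ContMDiffAt.mpullback_vectorField_preimage (m := ∞) (n := ∞)
    ((isSmoothVectorField_mulInvariantVectorField v).contMDiffAt)
    (contMDiffAt_extChartAt_symm x hz) (isInvertible_mfderiv_extChartAt_symm x hz) (by simp)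
  exact ((contMDiff_snd_tangentBundle_modelSpace E3 𝓘(ℝ, E3)).contMDiffAt.comp z h).contDiffAt

theorem chartForm_chartField (x : G) (α : OneForm G) (v : GroupLieAlgebra (𝓡 3) G) {z : E3}
    (hz : z ∈ (extChartAt (𝓡 3) x).target) :
    chartForm x α z (chartField x v z) = α ((extChartAt (𝓡 3) x).symm z)
      (mulInvariantVectorField v ((extChartAt (𝓡 3) x).symm z)) :=
  congrArg (α ((extChartAt (𝓡 3) x).symm z))
    ((isInvertible_mfderiv_extChartAt_symm x hz).self_apply_inverse _)

/-- The matrix of the left-invariant vector fields in coordinates. -/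
noncomputable def chartFrame (x : G) (z : E3) : E3 →L[ℝ] E3 :=
  (mfderiv 𝓘(ℝ, E3) (𝓡 3) (extChartAt (𝓡 3) x).symm z).inverse.comp
    (mfderiv (𝓡 3) (𝓡 3) (fun y : G => (extChartAt (𝓡 3) x).symm z * y) 1 : E3 →L[ℝ] E3)

theorem isInvertible_chartFrame (x : G) {z : E3} (hz : z ∈ (extChartAt (𝓡 3) x).target) :
    (chartFrame x z).IsInvertible :=
  (isInvertible_mfderiv_extChartAt_symm x hz).inverse.comp
    (isInvertible_mfderiv_mul_left ((extChartAt (𝓡 3) x).symm z) 1)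

/-- `IsSmoothForm` only tests globally defined fields. The left-invariant ones form a global frame,
so the coordinate expression is the smooth row of values on this frame times the inverse of the
frame matrix; no cutoff functions are needed. -/
theorem contDiffOn_chartForm (x : G) {α : OneForm G} (hα : IsSmoothForm α) :
    ContDiffOn ℝ ∞ (chartForm x α) (extChartAt (𝓡 3) x).target := by
  have hP : ContDiffOn ℝ ∞ (chartFrame x) (extChartAt (𝓡 3) x).target := by
    rw [contDiffOn_clm_apply]
    exact fun v => contDiffOn_chartField x v
  have hPi : ContDiffOn ℝ ∞ (fun z => (chartFrame x z).inverse) (extChartAt (𝓡 3) x).target :=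
    fun z hz => (isInvertible_chartFrame x hz).contDiffAt_map_inverse.comp_contDiffWithinAt z
      (hP z hz)
  have hR : ContDiffOn ℝ ∞ (fun z => (chartForm x α z).comp (chartFrame x z))
      (extChartAt (𝓡 3) x).target := by
    rw [contDiffOn_clm_apply]
    intro v
    have h1 : ContDiffOn ℝ ∞ (fun z => α ((extChartAt (𝓡 3) x).symm z)
      (mulInvariantVectorField (v : GroupLieAlgebra (𝓡 3) G) ((extChartAt (𝓡 3) x).symm z)))
        (extChartAt (𝓡 3) x).target := by
      intro z hz
      apply ContDiffAt.contDiffWithinAt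
      exact ((hα _ (isSmoothVectorField_mulInvariantVectorField v)).contMDiffAt.comp z
        (contMDiffAt_extChartAt_symm x hz)).contDiffAt
    exact h1.congr fun z hz => chartForm_chartField x α v hz
  refine (hR.clm_comp hPi).congr fun z hz => ?_
  rw [ContinuousLinearMap.comp_assoc, (isInvertible_chartFrame x hz).self_comp_inverse,
    ContinuousLinearMap.comp_id]

/-- Closedness is known through brackets of global fields. Evaluated on invariant fields in
coordinates, the derivatives of the fields cancel against the bracket, and the symmetry of the
derivative of the form remains. -/
theorem fderiv_chartForm_symm (x : G) {α : OneForm G} (hα : IsSmoothForm α)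
    (hcl : IsExtDeriv α 0) {z : E3} (hz : z ∈ (extChartAt (𝓡 3) x).target) (a b : E3) :
    fderiv ℝ (chartForm x α) z a b = fderiv ℝ (chartForm x α) z b a := by
  have hnz : (extChartAt (𝓡 3) x).target ∈ nhds z := (isOpen_extChartAt_target x).mem_nhds hz
  obtain ⟨v, rfl⟩ := (isInvertible_chartFrame x hz).surjective a
  obtain ⟨w, rfl⟩ := (isInvertible_chartFrame x hz).surjective b
  set ψ := (extChartAt (𝓡 3) x).symm with hψ
  have hω : DifferentiableAt ℝ (chartForm x α) z :=
    ((contDiffOn_chartForm x hα).contDiffAt hnz).differentiableAt (by simp)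
  have hX : ∀ u : E3, DifferentiableAt ℝ (chartField (G := G) x u) z := fun u =>
    ((contDiffOn_chartField x u).contDiffAt hnz).differentiableAt (by simp)
  have hψd : MDifferentiableAt 𝓘(ℝ, E3) (𝓡 3) ψ z :=
    (contMDiffAt_extChartAt_symm x hz).mdifferentiableAt (by simp)
  have key : ∀ u u' : E3,
      differential (fun q => α q (mulInvariantVectorField (u : GroupLieAlgebra (𝓡 3) G) q)) (ψ z)
        (mulInvariantVectorField (u' : GroupLieAlgebra (𝓡 3) G) (ψ z)) =
      chartForm x α z (fderiv ℝ (chartField (G := G) x u) z (chartFrame x z u')) +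
        fderiv ℝ (chartForm x α) z (chartFrame x z u') (chartFrame x z u) := by
    intro u u'
    have h1 : HasFDerivAt (fun y => chartForm x α y (chartField x u y)) _ z :=
      hω.hasFDerivAt.clm_apply (hX u).hasFDerivAt
    have h2 : MDifferentiableAt (𝓡 3) 𝓘(ℝ, ℝ)
        (fun q => α q (mulInvariantVectorField (u : GroupLieAlgebra (𝓡 3) G) q)) (ψ z) :=
      (hα _ (isSmoothVectorField_mulInvariantVectorField u)).mdifferentiableAt (by simp)
    have h3 := (h2.hasMFDerivAt.comp z hψd.hasMFDerivAt).hasFDerivAt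
    have h4 := (h1.congr_of_eventuallyEq (f₁ := fun y => α (ψ y)
      (mulInvariantVectorField (u : GroupLieAlgebra (𝓡 3) G) (ψ y)))
      (Filter.eventually_of_mem hnz fun y hy => (chartForm_chartField x α u hy).symm)).unique h3
    have h5 := DFunLike.congr_fun h4 (chartFrame x z u')
    refine Eq.trans ?_ h5.symm
    refine congrArg (differential _ (ψ z)) ?_
    exact ((isInvertible_mfderiv_extChartAt_symm x hz).self_apply_inverse _).symm
  -- The bracket commutes with pullback to the chart, where it is `DW V - DV W`.
  have hbr : α (ψ z) (VectorField.mlieBracket (𝓡 3)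
      (mulInvariantVectorField (v : GroupLieAlgebra (𝓡 3) G))
      (mulInvariantVectorField (w : GroupLieAlgebra (𝓡 3) G)) (ψ z)) =
      chartForm x α z (fderiv ℝ (chartField (G := G) x w) z (chartFrame x z v) -
        fderiv ℝ (chartField (G := G) x v) z (chartFrame x z w)) := by
    have h1 := VectorField.mpullback_mlieBracket (I := 𝓘(ℝ, E3)) (I' := 𝓡 3) (n := ∞) (f := ψ)
      (x₀ := z)
      (V := (mulInvariantVectorField (v : GroupLieAlgebra (𝓡 3) G)))
      (W := (mulInvariantVectorField (w : GroupLieAlgebra (𝓡 3) G)))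
      ((isSmoothVectorField_mulInvariantVectorField v).mdifferentiableAt (by simp))
      ((isSmoothVectorField_mulInvariantVectorField w).mdifferentiableAt (by simp))
      (contMDiffAt_extChartAt_symm x hz) (by
        rw [minSmoothness_of_isRCLikeNormedField]; exact WithTop.coe_le_coe.2 le_top)
    have h2 : VectorField.mlieBracket 𝓘(ℝ, E3) (chartField (G := G) x v)
        (chartField (G := G) x w) z = VectorField.lieBracket ℝ (chartField (G := G) x v)
        (chartField (G := G) x w) z := mlieBracket_eq_lieBracket _ _ _
    have h3 := h1.trans h2
    rw [VectorField.lieBracket_eq] at h3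
    refine Eq.trans ?_ (congrArg (chartForm x α z) h3)
    exact congrArg (α (ψ z))
      ((isInvertible_mfderiv_extChartAt_symm x hz).self_apply_inverse _).symm
  have hc := hcl _ _ (isSmoothVectorField_mulInvariantVectorField (G := G) v)
    (isSmoothVectorField_mulInvariantVectorField w) (ψ z)
  rw [key, key, hbr, map_sub] at hc
  simp only [Pi.zero_apply] at hc
  linarith

open Set Filter Topology in
/-- A function with vanishing derivative on an open set is locally constant there. -/
theorem eventually_eq_of_hasMFDerivAt_zero {U : Set G} (hU : IsOpen U) {f : G → ℝ} {x : G}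
    (hx : x ∈ U) (hf : ∀ y ∈ U, HasMFDerivAt (𝓡 3) 𝓘(ℝ, ℝ) f y 0) :
    ∀ᶠ y in 𝓝 x, f y = f x := by
  set φ := extChartAt (𝓡 3) x
  have hW : IsOpen (φ.target ∩ φ.symm ⁻¹' U) :=
    (continuousOn_extChartAt_symm x).isOpen_inter_preimage (isOpen_extChartAt_target x) hU
  have hxW : φ x ∈ φ.target ∩ φ.symm ⁻¹' U := by
    refine ⟨mem_extChartAt_target x, ?_⟩
    rw [mem_preimage, extChartAt_to_inv]
    exact hx
  obtain ⟨r, hr, hball⟩ := Metric.isOpen_iff.1 hW _ hxW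
  have hd : ∀ z ∈ Metric.ball (φ x) r, HasFDerivAt (f ∘ φ.symm) (0 : E3 →L[ℝ] ℝ) z := by
    intro z hz
    have h1 := (hf _ (hball hz).2).comp z
      ((contMDiffAt_extChartAt_symm x (hball hz).1).mdifferentiableAt (by simp)).hasMFDerivAt
    exact (h1.congr_mfderiv (ContinuousLinearMap.zero_comp _)).hasFDerivAt
  have hconst : ∀ z ∈ Metric.ball (φ x) r, (f ∘ φ.symm) z = (f ∘ φ.symm) (φ x) := fun z hz =>
    (convex_ball (φ x) r).is_const_of_fderivWithin_eq_zero
      (fun y hy => (hd y hy).differentiableAt.differentiableWithinAt)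
      (fun y hy => by
        rw [fderivWithin_of_isOpen Metric.isOpen_ball hy]; exact (hd y hy).fderiv)
      hz (Metric.mem_ball_self hr)
  have hn : φ.source ∩ φ ⁻¹' Metric.ball (φ x) r ∈ 𝓝 x :=
    ((continuousOn_extChartAt x).isOpen_inter_preimage (isOpen_extChartAt_source x)
      Metric.isOpen_ball).mem_nhds ⟨mem_extChartAt_source x, Metric.mem_ball_self hr⟩
  filter_upwards [hn] with y hy
  have h := hconst _ hy.2
  rwa [Function.comp_apply, Function.comp_apply, φ.left_inv hy.1,
    φ.left_inv (mem_extChartAt_source x)] at h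

open Set Filter Topology in
/-- A function with vanishing derivative on a connected group is constant. -/
theorem eq_of_hasMFDerivAt_zero [PreconnectedSpace G] {f : G → ℝ}
    (hf : ∀ y, HasMFDerivAt (𝓡 3) 𝓘(ℝ, ℝ) f y 0) (x y : G) : f x = f y :=
  (IsLocallyConstant.iff_eventually_eq f).2 (fun x => eventually_eq_of_hasMFDerivAt_zero
    isOpen_univ (mem_univ x) fun y _ => hf y) |>.apply_eq_of_preconnectedSpace x y

open Set Filter Topology in
/-- Closed one-forms have local primitives. -/
theorem exists_local_primitive {α : OneForm G} (hα : IsSmoothForm α) (hcl : IsExtDeriv α 0)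
    (x : G) : ∃ U : Set G, IsOpen U ∧ x ∈ U ∧ ∃ f : G → ℝ, ContMDiffOn (𝓡 3) 𝓘(ℝ, ℝ) ∞ f U ∧
      ∀ y ∈ U, HasMFDerivAt (𝓡 3) 𝓘(ℝ, ℝ) f y (α y) := by
  obtain ⟨r, hr, hball⟩ := Metric.isOpen_iff.1 (isOpen_extChartAt_target (I := 𝓡 3) x) _
    (mem_extChartAt_target (I := 𝓡 3) x)
  set φ := extChartAt (𝓡 3) x
  -- Poincaré lemma on a ball in the chart.
  obtain ⟨F, hF⟩ := (convex_ball (φ x) r).exists_forall_hasFDerivAt_of_fderiv_symmetric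
    Metric.isOpen_ball (((contDiffOn_chartForm x hα).mono hball).differentiableOn (by simp))
    (fun z hz a b => fderiv_chartForm_symm x hα hcl (hball hz) a b)
  have hFs : ContDiffOn ℝ ∞ F (Metric.ball (φ x) r) := by
    rw [contDiffOn_infty_iff_fderiv_of_isOpen Metric.isOpen_ball]
    exact ⟨fun z hz => (hF z hz).differentiableAt.differentiableWithinAt,
      ((contDiffOn_chartForm x hα).mono hball).congr fun z hz => (hF z hz).fderiv⟩
  refine ⟨φ.source ∩ φ ⁻¹' Metric.ball (φ x) r, ?_, ?_, F ∘ φ, ?_, ?_⟩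
  · exact (continuousOn_extChartAt x).isOpen_inter_preimage (isOpen_extChartAt_source x)
      Metric.isOpen_ball
  · exact ⟨mem_extChartAt_source x, Metric.mem_ball_self hr⟩
  · refine hFs.contMDiffOn.comp ((contMDiffOn_extChartAt (I := 𝓡 3) (x := x)).mono ?_)
      fun y hy => hy.2
    rw [← extChartAt_source (𝓡 3)]
    exact inter_subset_left
  · rintro y ⟨hy, hyb⟩
    obtain ⟨z, hz, rfl⟩ : ∃ z ∈ φ.target, φ.symm z = y := ⟨φ y, φ.map_source hy, φ.left_inv hy⟩
    have hφz : φ (φ.symm z) = z := φ.right_inv hz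
    rw [mem_preimage, hφz] at hyb
    have h1 : HasMFDerivAt (𝓡 3) 𝓘(ℝ, E3) φ (φ.symm z) (mfderiv (𝓡 3) 𝓘(ℝ, E3) φ (φ.symm z)) :=
      (mdifferentiableAt_extChartAt (by rwa [← extChartAt_source (𝓡 3)])).hasMFDerivAt
    have h2 : HasFDerivAt F (chartForm x α z) (φ (φ.symm z)) := by
      rw [hφz]; exact hF z hyb
    have h3 := h2.hasMFDerivAt.comp (φ.symm z) h1
    have h4 := mfderivWithin_extChartAt_symm_comp_mfderiv_extChartAt (I := 𝓡 3) hz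
    rw [ModelWithCorners.range_eq_univ, mfderivWithin_univ] at h4
    exact h3.congr_mfderiv ((congrArg (fun L => (α (φ.symm z)).comp L) h4).trans
      (ContinuousLinearMap.comp_id _))

open Set Filter Topology in
/-- On a simply connected Lie group, a closed one-form is the differential of a smooth function
that vanishes at the identity. -/
theorem exists_primitive [SimplyConnectedSpace G] {α : OneForm G} (hα : IsSmoothForm α)
    (hcl : IsExtDeriv α 0) :
    ∃ f : G → ℝ, ContMDiff (𝓡 3) 𝓘(ℝ, ℝ) ∞ f ∧ f 1 = 0 ∧
      ∀ y, HasMFDerivAt (𝓡 3) 𝓘(ℝ, ℝ) f y (α y) := by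
  have : LocallyPathConnectedSpace G := ChartedSpace.locallyPathConnectedSpace E3 G
  choose U hU hxU f hf hdf using exists_local_primitive hα hcl
  -- Two local primitives differ by a function with zero derivative, hence by a locally constant
  -- one.
  obtain ⟨F, hF⟩ := exists_glue_of_locally_const_sub U hU (fun x => ⟨x, hxU x⟩) f
    (fun i j x hx => eventually_eq_of_hasMFDerivAt_zero ((hU i).inter (hU j)) hx fun y hy => by
      exact ((hdf i y hy.1).sub (hdf j y hy.2)).congr_mfderiv (sub_self _))
  have hloc : ∀ x, (fun y => F y - F 1) =ᶠ[𝓝 x] fun y => f x y + (F x - f x x - F 1) := by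
    intro x
    filter_upwards [hF x x (hxU x)] with y hy
    linarith
  refine ⟨fun y => F y - F 1, fun x => ?_, sub_self _, fun x => ?_⟩
  · exact (((hf x).contMDiffAt ((hU x).mem_nhds (hxU x))).add contMDiffAt_const).congr_of_eventuallyEq
      (hloc x)
  · have h := (hdf x x (hxU x)).add (hasMFDerivAt_const (F x - f x x - F 1) x)
    exact (h.congr_mfderiv (add_zero _)).congr_of_eventuallyEq (hloc x)

end ClosedForms

/-! ### Homomorphisms onto semidirect products. -/

section Isomorphism

variable {G : Type*} [TopologicalSpace G] [ChartedSpace (EuclideanSpace ℝ (Fin 3)) G] [Group G]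
  [LieGroup (𝓡 3) ∞ G]

local notation "E3" => EuclideanSpace ℝ (Fin 3)

open Set Filter Topology in
/-- The inverse function theorem for maps from a Lie group to a vector space. -/
theorem exists_local_inverse {F : Type*} [NormedAddCommGroup F] [NormedSpace ℝ F]
    [CompleteSpace F] {φ : G → F}
    (hφ : ContMDiff (𝓡 3) 𝓘(ℝ, F) ∞ φ) (x : G)
    (hx : (mfderiv (𝓡 3) 𝓘(ℝ, F) φ x : E3 →L[ℝ] F).IsInvertible) :
    ∃ g : F → G, ContMDiffAt 𝓘(ℝ, F) (𝓡 3) ∞ g (φ x) ∧ g (φ x) = x ∧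
      (∀ᶠ y in 𝓝 (φ x), φ (g y) = y) ∧ ∀ᶠ y in 𝓝 x, g (φ y) = y := by
  set χ := extChartAt (𝓡 3) x
  have hz : χ x ∈ χ.target := mem_extChartAt_target x
  have hχx : χ.symm (χ x) = x := extChartAt_to_inv x
  -- Read in a chart, the map goes between normed spaces and the usual inverse function theorem
  -- applies.
  have hF : ContDiffAt ℝ ∞ (φ ∘ χ.symm) (χ x) :=
    (hφ.contMDiffAt.comp (χ x) (contMDiffAt_extChartAt_symm x hz)).contDiffAt
  have hinv : (fderiv ℝ (φ ∘ χ.symm) (χ x)).IsInvertible := by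
    have h1 : HasMFDerivAt 𝓘(ℝ, E3) 𝓘(ℝ, F) (φ ∘ χ.symm) (χ x)
        ((mfderiv (𝓡 3) 𝓘(ℝ, F) φ (χ.symm (χ x))).comp
          (mfderiv 𝓘(ℝ, E3) (𝓡 3) χ.symm (χ x))) :=
      ((hφ.mdifferentiableAt (by simp)).hasMFDerivAt).comp (χ x)
        ((contMDiffAt_extChartAt_symm x hz).mdifferentiableAt (by simp)).hasMFDerivAt
    have h3 : (mfderiv (𝓡 3) 𝓘(ℝ, F) φ (χ.symm (χ x)) : E3 →L[ℝ] F).IsInvertible := by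
      rw [hχx]; exact hx
    obtain ⟨A, hA⟩ : ∃ A : E3 ≃L[ℝ] F, (A : E3 →L[ℝ] F) = _ :=
      h3.comp (isInvertible_mfderiv_extChartAt_symm x hz)
    have h4 : HasFDerivAt (φ ∘ χ.symm) (A : E3 →L[ℝ] F) (χ x) :=
      (h1.congr_mfderiv hA.symm).hasFDerivAt
    exact ⟨A, h4.fderiv.symm⟩
  obtain ⟨L, hL⟩ := hinv
  have hd : HasFDerivAt (φ ∘ χ.symm) (L : E3 →L[ℝ] F) (χ x) :=
    hL ▸ (hF.differentiableAt (by simp)).hasFDerivAt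
  have hn : (∞ : WithTop ℕ∞) ≠ 0 := by simp
  set g₀ := hF.localInverse hd hn
  have hpt : (φ ∘ χ.symm) (χ x) = φ x := by rw [Function.comp_apply, hχx]
  have hs : HasStrictFDerivAt (φ ∘ χ.symm) (L : E3 →L[ℝ] F) (χ x) := hF.hasStrictFDerivAt' hd hn
  have hg₀ : ContDiffAt ℝ ∞ g₀ (φ x) := hpt ▸ hF.to_localInverse hd hn
  have hg₀x : g₀ (φ x) = χ x := hpt ▸ hs.localInverse_apply_image
  have hright : ∀ᶠ y in 𝓝 (φ x), (φ ∘ χ.symm) (g₀ y) = y := hpt ▸ hs.eventually_right_inverse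
  have hleft : ∀ᶠ z in 𝓝 (χ x), g₀ ((φ ∘ χ.symm) z) = z := hs.eventually_left_inverse
  refine ⟨χ.symm ∘ g₀, ?_, ?_, hright, ?_⟩
  · refine ContMDiffAt.comp (φ x) ?_ hg₀.contMDiffAt
    rw [hg₀x]
    exact contMDiffAt_extChartAt_symm x hz
  · rw [Function.comp_apply, hg₀x, hχx]
  · have h1 := (continuousAt_extChartAt (I := 𝓡 3) x).eventually hleft
    filter_upwards [h1, extChartAt_source_mem_nhds (I := 𝓡 3) x] with y hy hys
    have hy' : χ.symm (χ y) = y := χ.left_inv hys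
    change χ.symm (g₀ (φ y)) = y
    rw [Function.comp_apply, hy'] at hy
    rw [hy, hy']

open Set Filter Topology in
/-- A smooth homomorphism with invertible derivative from a connected Lie group to a
semidirect product `ℝ ⋉ ℝ²` is an isomorphism. -/
theorem isIsoTo_semidirectLine_of_hom [ConnectedSpace G] {a b : ℝ} (φ : G → ℝ × ℝ × ℝ)
    (hφ : ContMDiff (𝓡 3) 𝓘(ℝ, ℝ × ℝ × ℝ) ∞ φ)
    (hinv : ∀ x, (mfderiv (𝓡 3) 𝓘(ℝ, ℝ × ℝ × ℝ) φ x : E3 →L[ℝ] ℝ × ℝ × ℝ).IsInvertible)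
    (hmul : ∀ g h : G, φ (g * h) = ((φ g).1 + (φ h).1,
      (φ g).2.1 + Real.exp (a * (φ g).1) * (φ h).2.1,
      (φ g).2.2 + Real.exp (b * (φ g).1) * (φ h).2.2)) :
    IsIsoTo G (SemidirectLine a b) := by
  have : IsTopologicalGroup G := topologicalGroup_of_lieGroup (𝓡 3) ∞
  have : IsTopologicalGroup (SemidirectLine a b) :=
    topologicalGroup_of_lieGroup 𝓘(ℝ, ℝ × ℝ × ℝ) ∞
  have : ConnectedSpace (SemidirectLine a b) := inferInstanceAs (ConnectedSpace (ℝ × ℝ × ℝ))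
  have : SimplyConnectedSpace (SemidirectLine a b) :=
    inferInstanceAs (SimplyConnectedSpace (ℝ × ℝ × ℝ))
  have : LocallyPathConnectedSpace (SemidirectLine a b) :=
    inferInstanceAs (LocallyPathConnectedSpace (ℝ × ℝ × ℝ))
  let Φ : G →* SemidirectLine a b := MonoidHom.mk' φ hmul
  have hcont : Continuous Φ := hφ.continuous
  choose g hgs hgx hgr hgl using fun x => exists_local_inverse hφ x (hinv x)
  have hopen : IsOpenMap Φ := by
    rw [isOpenMap_iff_nhds_le]
    intro x s hs
    have h1 : Tendsto (g x) (𝓝 (φ x)) (𝓝 x) := by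
      have := (hgs x).continuousAt.tendsto
      rwa [hgx] at this
    filter_upwards [h1 hs, hgr x] with y hy1 hy2
    have : φ (g x y) ∈ s := hy1
    rwa [hy2] at this
  -- The image is an open subgroup, hence also closed, and the target is connected.
  have hsurj : Function.Surjective Φ := by
    have h1 : IsOpen (Φ.range : Set (SemidirectLine a b)) := by
      rw [MonoidHom.coe_range]; exact hopen.isOpen_range
    have h2 : IsClopen (Φ.range : Set (SemidirectLine a b)) :=
      ⟨Subgroup.isClosed_of_isOpen _ h1, h1⟩
    have h3 := h2.eq_univ ⟨1, Φ.range.one_mem⟩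
    rwa [MonoidHom.coe_range, range_eq_univ] at h3
  have hquot : IsQuotientMap Φ := hopen.isQuotientMap hcont hsurj
  -- Local injectivity isolates each point of the kernel, so the quotient by it is a covering.
  have hdisc : IsDiscrete (Φ.ker : Set G) := by
    refine IsDiscrete.of_nhdsWithin fun x hx => ?_
    rw [le_pure_iff, mem_nhdsWithin_iff_eventually]
    filter_upwards [hgl x] with y hy h
    have h' : φ y = φ x := (MonoidHom.mem_ker.1 h).trans (MonoidHom.mem_ker.1 hx).symm
    rw [h', hgx] at hy
    exact hy.symm
  have hcov : IsCoveringMap Φ :=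
    (hquot.isQuotientCoveringMap_of_isDiscrete_ker_monoidHom hdisc).isCoveringMap
  obtain ⟨s, ⟨hs1, hs⟩, -⟩ := hcov.existsUnique_continuousMap_lifts
    (ContinuousMap.id (SemidirectLine a b)) 1 1 (map_one Φ)
  have hΦs : ∀ y, Φ (s y) = y := fun y => congrFun hs y
  -- Both `s ∘ Φ` and `id` lift `Φ` and agree at `1`; lifts from the connected group `G` are unique.
  have hsΦ : s ∘ Φ = id := by
    refine hcov.eq_of_comp_eq (s.continuous.comp hcont) continuous_id ?_ 1 ?_
    · ext1 y; exact hΦs _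
    · rw [Function.comp_apply, map_one, hs1]; rfl
  -- The continuous global inverse agrees locally with the smooth local inverses.
  have hsm : ∀ x, ∀ᶠ y in 𝓝 (φ x), s y = g x y := by
    intro x
    filter_upwards [hgr x] with y hy
    have h1 : s (Φ (g x y)) = g x y := congrFun hsΦ _
    rw [← h1]
    exact congrArg s hy.symm
  have hsmooth : ContMDiff 𝓘(ℝ, ℝ × ℝ × ℝ) (𝓡 3) ∞ (s : ℝ × ℝ × ℝ → G) := by
    intro y
    obtain ⟨x, rfl⟩ := hsurj y
    exact (hgs x).congr_of_eventuallyEq (hsm x)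
  exact ⟨⟨⟨φ, s, fun x => congrFun hsΦ x, hΦs⟩, hφ, hsmooth⟩, hmul⟩

end Isomorphism

theorem isInvertible_of_injective {L : EuclideanSpace ℝ (Fin 3) →L[ℝ] ℝ × ℝ × ℝ}
    (hL : Function.Injective L) : L.IsInvertible := by
  refine ⟨ContinuousLinearEquiv.ofBijective L (LinearMap.ker_eq_bot.2 hL)
    (LinearMap.range_eq_top.2 ((LinearMap.injective_iff_surjective_of_finrank_eq_finrank
      (f := (L : EuclideanSpace ℝ (Fin 3) →ₗ[ℝ] ℝ × ℝ × ℝ)) (by simp)).1 hL)), ?_⟩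
  ext1 v
  rfl

/-! ### Exterior derivatives of products and sums. -/

section FormCalculus

variable {M : Type*} [TopologicalSpace M] [ChartedSpace (EuclideanSpace ℝ (Fin 3)) M]

theorem differential_mul {F f : M → ℝ} {p : M} (hF : MDifferentiableAt (𝓡 3) 𝓘(ℝ, ℝ) F p)
    (hf : MDifferentiableAt (𝓡 3) 𝓘(ℝ, ℝ) f p) (v : TangentSpace (𝓡 3) p) :
    differential (fun q => F q * f q) p v = F p * differential f p v + f p * differential F p v := by
  have h := (hF.hasMFDerivAt.mul hf.hasMFDerivAt).mfderiv
  exact DFunLike.congr_fun h v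

theorem differential_add {F f : M → ℝ} {p : M} (hF : MDifferentiableAt (𝓡 3) 𝓘(ℝ, ℝ) F p)
    (hf : MDifferentiableAt (𝓡 3) 𝓘(ℝ, ℝ) f p) (v : TangentSpace (𝓡 3) p) :
    differential (fun q => F q + f q) p v = differential F p v + differential f p v := by
  have h := (hF.hasMFDerivAt.add hf.hasMFDerivAt).mfderiv
  exact DFunLike.congr_fun h v

theorem differential_const (c : ℝ) (p : M) (v : TangentSpace (𝓡 3) p) :
    differential (fun _ : M => c) p v = 0 := by
  have h := (hasMFDerivAt_const (I := 𝓡 3) (I' := 𝓘(ℝ, ℝ)) c p).mfderiv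
  exact DFunLike.congr_fun h v

variable [IsManifold (𝓡 3) ∞ M]

theorem IsSmoothForm.add {α γ : OneForm M} (hα : IsSmoothForm α) (hγ : IsSmoothForm γ) :
    IsSmoothForm (α + γ) :=
  fun X hX => (hα X hX).add (hγ X hX)

theorem IsSmoothForm.mul {α : OneForm M} (hα : IsSmoothForm α) {F : M → ℝ}
    (hF : ContMDiff (𝓡 3) 𝓘(ℝ, ℝ) ∞ F) : IsSmoothForm (fun p => F p • α p) :=
  fun X hX => hF.mul (hα X hX)

theorem IsSmoothForm.const_smul {α : OneForm M} (hα : IsSmoothForm α) (c : ℝ) :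
    IsSmoothForm (c • α) :=
  hα.mul contMDiff_const

/-- `d(F α) = dF ∧ α + F dα`. -/
theorem IsExtDeriv.mul {α : OneForm M} {η : TwoTensor M} (h : IsExtDeriv α η)
    (hα : IsSmoothForm α) {F : M → ℝ} (hF : ContMDiff (𝓡 3) 𝓘(ℝ, ℝ) ∞ F) :
    IsExtDeriv (fun p => F p • α p)
      (fun p v w => wedge (differential F) α p v w + F p * η p v w) := by
  intro X Y hX hY p
  have hFd : MDifferentiableAt (𝓡 3) 𝓘(ℝ, ℝ) F p := hF.mdifferentiableAt (by simp)
  have h1 := differential_mul hFd ((hα Y hY).mdifferentiableAt (x := p) (by simp)) (X p)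
  have h2 := differential_mul hFd ((hα X hX).mdifferentiableAt (x := p) (by simp)) (Y p)
  have h3 := h X Y hX hY p
  change _ = differential (fun q => F q * α q (Y q)) p (X p) -
    differential (fun q => F q * α q (X q)) p (Y p) -
      F p * α p (VectorField.mlieBracket (𝓡 3) X Y p)
  rw [h1, h2]
  simp only [wedge, tensorProd, Pi.sub_apply, h3]
  ring

theorem IsExtDeriv.const_smul {α : OneForm M} {η : TwoTensor M} (h : IsExtDeriv α η)
    (hα : IsSmoothForm α) (c : ℝ) : IsExtDeriv (c • α) (c • η) := by
  intro X Y hX hY p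
  refine Eq.trans ?_ (h.mul hα (F := fun _ => c) contMDiff_const X Y hX hY p)
  simp [wedge, tensorProd, differential_const]

theorem IsExtDeriv.add {α γ : OneForm M} {η ζ : TwoTensor M} (h : IsExtDeriv α η)
    (h' : IsExtDeriv γ ζ) (hα : IsSmoothForm α) (hγ : IsSmoothForm γ) :
    IsExtDeriv (α + γ) (η + ζ) := by
  intro X Y hX hY p
  have h1 := differential_add ((hα Y hY).mdifferentiableAt (x := p) (by simp))
    ((hγ Y hY).mdifferentiableAt (x := p) (by simp)) (X p)
  have h2 := differential_add ((hα X hX).mdifferentiableAt (x := p) (by simp))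
    ((hγ X hX).mdifferentiableAt (x := p) (by simp)) (Y p)
  have h3 := h X Y hX hY p
  have h4 := h' X Y hX hY p
  change η p (X p) (Y p) + ζ p (X p) (Y p) =
    differential (fun q => α q (Y q) + γ q (Y q)) p (X p) -
    differential (fun q => α q (X q) + γ q (X q)) p (Y p) -
      (α p (VectorField.mlieBracket (𝓡 3) X Y p) + γ p (VectorField.mlieBracket (𝓡 3) X Y p))
  rw [h1, h2, h3, h4]
  ring

end FormCalculus

/-! ### Recognizing the group from a left-invariant coframe. -/

section LeftInvariant

variable {G : Type*} [TopologicalSpace G] [ChartedSpace (EuclideanSpace ℝ (Fin 3)) G] [Group G]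

theorem IsLeftInvariantForm.add {α γ : OneForm G} (hα : IsLeftInvariantForm α)
    (hγ : IsLeftInvariantForm γ) : IsLeftInvariantForm (α + γ) := fun g p v =>
  congrArg₂ (· + ·) (hα g p v) (hγ g p v)

theorem IsLeftInvariantForm.const_smul {α : OneForm G} (hα : IsLeftInvariantForm α) (c : ℝ) :
    IsLeftInvariantForm (c • α) := fun g p v => congrArg (c * ·) (hα g p v)

variable [LieGroup (𝓡 3) ∞ G]

/-- A primitive `f` of `exp (a f₀) α`, where `α` is left-invariant and `f₀` is a homomorphism to
the additive group of real numbers, is a crossed homomorphism. -/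
theorem primitive_mul [PreconnectedSpace G] {α : OneForm G} (hα : IsLeftInvariantForm α) {a : ℝ}
    {f₀ f : G → ℝ} (hf₀ : ∀ g h, f₀ (g * h) = f₀ g + f₀ h) (hf1 : f 1 = 0)
    (hf : ∀ y, HasMFDerivAt (𝓡 3) 𝓘(ℝ, ℝ) f y (Real.exp (a * f₀ y) • α y)) (g h : G) :
    f (g * h) = f g + Real.exp (a * f₀ g) * f h := by
  -- Left translation by `g` multiplies `exp (a f₀) α` by the constant `exp (a f₀ g)`, so the two
  -- terms have the same differential.
  have hd : ∀ y, HasMFDerivAt (𝓡 3) 𝓘(ℝ, ℝ)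
      (fun x => f (g * x) - Real.exp (a * f₀ g) * f x) y 0 := by
    intro y
    have h1 := (hf (g * y)).comp y ((mdifferentiable_mul_left g y).hasMFDerivAt)
    have h2 := (hf y).const_smul (Real.exp (a * f₀ g))
    refine (h1.sub h2).congr_mfderiv ?_
    ext v
    have h3 := hα g y v
    change Real.exp (a * f₀ (g * y)) * α (g * y) (mfderiv (𝓡 3) (𝓡 3) (fun x => g * x) y v) -
      Real.exp (a * f₀ g) * (Real.exp (a * f₀ y) * α y v) = 0
    rw [h3, hf₀, mul_add, Real.exp_add]
    ring
  have := eq_of_hasMFDerivAt_zero hd h 1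
  simp only [mul_one, hf1, mul_zero, sub_zero] at this
  linarith

/-- A left-invariant form that is injective at the identity is injective everywhere. -/
theorem eq_zero_of_leftInvariant {α α₁ α₂ : OneForm G} (hα : IsLeftInvariantForm α)
    (hα₁ : IsLeftInvariantForm α₁) (hα₂ : IsLeftInvariantForm α₂)
    (hinj : ∀ v : TangentSpace (𝓡 3) (1 : G), α 1 v = 0 → α₁ 1 v = 0 → α₂ 1 v = 0 → v = 0)
    (p : G) (v : TangentSpace (𝓡 3) p) (h : α p v = 0) (h₁ : α₁ p v = 0) (h₂ : α₂ p v = 0) :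
    v = 0 := by
  have key : ∀ γ : OneForm G, IsLeftInvariantForm γ →
      ∀ w : TangentSpace (𝓡 3) (1 : G),
      γ p (mfderiv (𝓡 3) (𝓡 3) (fun x => p * x) 1 w : EuclideanSpace ℝ (Fin 3)) = γ 1 w := by
    intro γ hγ w
    have h := hγ p 1 w
    rw [mul_one] at h
    exact h
  obtain ⟨w, hw⟩ := (isInvertible_mfderiv_mul_left p (1 : G)).surjective
    (v : EuclideanSpace ℝ (Fin 3))
  have hz : w = 0 := hinj w
    ((key α hα w).symm.trans ((congrArg (α p) hw).trans h))
    ((key α₁ hα₁ w).symm.trans ((congrArg (α₁ p) hw).trans h₁))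
    ((key α₂ hα₂ w).symm.trans ((congrArg (α₂ p) hw).trans h₂))
  rw [hz] at hw
  exact hw.symm.trans (map_zero _)

/-- A simply connected Lie group with a left-invariant coframe `α, α₁, α₂` such that `dα = 0`,
`dα₁ = a α₁ ∧ α` and `dα₂ = b α₂ ∧ α` is a semidirect product `ℝ ⋉ ℝ²`. -/
theorem isIsoTo_semidirectLine [SimplyConnectedSpace G] {a b : ℝ} {α α₁ α₂ : OneForm G}
    (hα : IsLeftInvariantForm α) (hα₁ : IsLeftInvariantForm α₁) (hα₂ : IsLeftInvariantForm α₂)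
    (hs : IsSmoothForm α) (hs₁ : IsSmoothForm α₁) (hs₂ : IsSmoothForm α₂)
    (hinj : ∀ v : TangentSpace (𝓡 3) (1 : G), α 1 v = 0 → α₁ 1 v = 0 → α₂ 1 v = 0 → v = 0)
    (hd : IsExtDeriv α 0) (hd₁ : IsExtDeriv α₁ (a • wedge α₁ α))
    (hd₂ : IsExtDeriv α₂ (b • wedge α₂ α)) : IsIsoTo G (SemidirectLine a b) := by
  obtain ⟨f, hfs, hf1, hf⟩ := exists_primitive hs hd
  -- For `a = 0` a crossed homomorphism is a homomorphism.
  have hfm : ∀ g h, f (g * h) = f g + f h := by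
    intro g h
    have := primitive_mul (a := 0) (f₀ := fun _ => 0) hα (by simp) hf1
      (fun y => (hf y).congr_mfderiv (by simp; rfl)) g h
    simpa using this
  have hdf : differential f = α := funext fun p => (hf p).mfderiv
  have aux : ∀ (c : ℝ) (γ : OneForm G), IsLeftInvariantForm γ → IsSmoothForm γ →
      IsExtDeriv γ (c • wedge γ α) → ∃ k : G → ℝ, ContMDiff (𝓡 3) 𝓘(ℝ, ℝ) ∞ k ∧
        (∀ y, HasMFDerivAt (𝓡 3) 𝓘(ℝ, ℝ) k y (Real.exp (c * f y) • γ y)) ∧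
        ∀ g h, k (g * h) = k g + Real.exp (c * f g) * k h := by
    intro c γ hγ hγs hγd
    have hFs : ContMDiff (𝓡 3) 𝓘(ℝ, ℝ) ∞ (fun y => Real.exp (c * f y)) :=
      (Real.contDiff_exp.comp (contDiff_const.mul contDiff_id)).contMDiff.comp hfs
    have hdF : ∀ p v, differential (fun y => Real.exp (c * f y)) p v =
        Real.exp (c * f p) * (c * α p v) := by
      intro p v
      have h1 : HasDerivAt (fun s : ℝ => Real.exp (c * s)) (Real.exp (c * f p) * c) (f p) := by
        simpa using ((hasDerivAt_id (f p)).const_mul c).exp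
      have h2 := (h1.hasFDerivAt.hasMFDerivAt.comp p (hf p)).mfderiv
      have h3 := DFunLike.congr_fun h2 v
      refine h3.trans ?_
      change α p v * (Real.exp (c * f p) * c) = _
      ring
    -- The integrating factor: `d(exp (c f)) ∧ γ = c exp (c f) α ∧ γ` cancels `exp (c f) dγ = c exp
    -- (c f) γ ∧ α`.
    have hcl : IsExtDeriv (fun p => Real.exp (c * f p) • γ p) 0 := by
      have h1 := hγd.mul hγs hFs
      convert h1 using 1
      funext p v w
      simp only [wedge, tensorProd, Pi.sub_apply, Pi.smul_apply, hdF, Pi.zero_apply, smul_eq_mul]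
      ring
    obtain ⟨k, hks, hk1, hk⟩ := exists_primitive (hγs.mul hFs) hcl
    exact ⟨k, hks, hk, primitive_mul hγ hfm hk1 hk⟩
  obtain ⟨k₁, hk₁s, hk₁, hk₁m⟩ := aux a α₁ hα₁ hs₁ hd₁
  obtain ⟨k₂, hk₂s, hk₂, hk₂m⟩ := aux b α₂ hα₂ hs₂ hd₂
  refine isIsoTo_semidirectLine_of_hom (fun x => (f x, k₁ x, k₂ x))
    (hfs.prodMk_space (hk₁s.prodMk_space hk₂s)) ?_ ?_
  · intro x
    have hD : ∀ (ℓ : ℝ × ℝ × ℝ →L[ℝ] ℝ) (L : TangentSpace (𝓡 3) x →L[ℝ] ℝ),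
        HasMFDerivAt (𝓡 3) 𝓘(ℝ, ℝ) (fun x => ℓ (f x, k₁ x, k₂ x)) x L → ∀ v,
        ℓ (mfderiv (𝓡 3) 𝓘(ℝ, ℝ × ℝ × ℝ) (fun x => (f x, k₁ x, k₂ x)) x v) = L v := by
      intro ℓ L hL v
      have h1 := (ℓ.hasFDerivAt (x := (f x, k₁ x, k₂ x))).hasMFDerivAt.comp x
        ((hfs.prodMk_space (hk₁s.prodMk_space hk₂s)).mdifferentiableAt (x := x)
          (by simp)).hasMFDerivAt
      exact DFunLike.congr_fun (hasMFDerivAt_unique h1 hL) v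
    -- The components of the derivative are nonzero multiples of `α`, `α₁`, `α₂`, which have no
    -- common kernel.
    have hinjx : Function.Injective (mfderiv (𝓡 3) 𝓘(ℝ, ℝ × ℝ × ℝ) (fun x => (f x, k₁ x, k₂ x)) x :
        EuclideanSpace ℝ (Fin 3) →L[ℝ] ℝ × ℝ × ℝ) := by
      rw [injective_iff_map_eq_zero]
      intro v hv
      have e1 : α x v = 0 := (hD (.fst ℝ ℝ (ℝ × ℝ)) _ (hf x) v).symm.trans
        ((congrArg _ hv).trans (map_zero _))
      have e2 : Real.exp (a * f x) * α₁ x v = 0 :=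
        (hD ((ContinuousLinearMap.fst ℝ ℝ ℝ).comp (.snd ℝ ℝ (ℝ × ℝ))) _ (hk₁ x) v).symm.trans
          ((congrArg _ hv).trans (map_zero _))
      have e3 : Real.exp (b * f x) * α₂ x v = 0 :=
        (hD ((ContinuousLinearMap.snd ℝ ℝ ℝ).comp (.snd ℝ ℝ (ℝ × ℝ))) _ (hk₂ x) v).symm.trans
          ((congrArg _ hv).trans (map_zero _))
      exact eq_zero_of_leftInvariant hα hα₁ hα₂ hinj x v e1
        ((mul_eq_zero.1 e2).resolve_left (Real.exp_ne_zero _))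
        ((mul_eq_zero.1 e3).resolve_left (Real.exp_ne_zero _))
    exact isInvertible_of_injective hinjx
  · intro g h
    simp only [hfm, hk₁m, hk₂m]

end LeftInvariant

theorem FrameIndex.sum_eq {N : Type*} [AddCommMonoid N] (f : FrameIndex → N) :
    ∑ a, f a = f .u + (f .l + f .n) := by
  have : (Finset.univ : Finset FrameIndex) = {.u, .l, .n} := rfl
  rw [this, Finset.sum_insert (by simp), Finset.sum_insert (by simp), Finset.sum_singleton]

/-! ### Linear algebra of coframes and of the shape operator. -/

section Coframe

local notation "E3" => EuclideanSpace ℝ (Fin 3)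

theorem card_frameIndex : Fintype.card FrameIndex = 3 := rfl

/-- The joint kernel of a basis of the dual space is trivial. -/
theorem eq_zero_of_linearIndependent {ε : FrameIndex → E3 →L[ℝ] ℝ} (h : LinearIndependent ℝ ε)
    {v : E3} (hv : ∀ a, ε a v = 0) : v = 0 := by
  have h' : LinearIndependent ℝ fun a => (ε a : E3 →ₗ[ℝ] ℝ) :=
    h.map' (ContinuousLinearMap.coeLM ℝ) (LinearMap.ker_eq_bot.2
      ContinuousLinearMap.coe_injective)
  have hspan := h'.span_eq_top_of_card_eq_finrank' (by
    rw [card_frameIndex, Module.finrank_linearMap_self]; simp)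
  refine (Module.forall_dual_apply_eq_zero_iff ℝ v).1 fun f => ?_
  have hf : f ∈ Submodule.span ℝ (Set.range fun a => (ε a : E3 →ₗ[ℝ] ℝ)) :=
    hspan ▸ Submodule.mem_top
  induction hf using Submodule.span_induction with
  | mem f hf => obtain ⟨a, rfl⟩ := hf; exact hv a
  | zero => rfl
  | add f g _ _ hf hg => rw [LinearMap.add_apply, hf, hg, add_zero]
  | smul c f _ hf => rw [LinearMap.smul_apply, hf, smul_zero]

/-- Three functionals on a three-dimensional space with trivial joint kernel separate
coordinates. -/
theorem exists_dual_basis {ε : FrameIndex → E3 →L[ℝ] ℝ} (h : ∀ v, (∀ a, ε a v = 0) → v = 0) :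
    ∃ x : FrameIndex → E3, ∀ a c, ε a (x c) = if a = c then 1 else 0 := by
  let L : E3 →ₗ[ℝ] (FrameIndex → ℝ) := LinearMap.pi fun a => (ε a : E3 →ₗ[ℝ] ℝ)
  have hinj : Function.Injective L := by
    rw [injective_iff_map_eq_zero]
    exact fun v hv => h v fun a => congrFun hv a
  have hsurj : Function.Surjective L :=
    (LinearMap.injective_iff_surjective_of_finrank_eq_finrank (by
      simp [card_frameIndex])).1 hinj
  choose x hx using fun c => hsurj (fun a => if a = c then 1 else 0)
  exact ⟨x, fun a c => congrFun (hx c) a⟩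

theorem linearIndependent_of_joint_kernel {ε : FrameIndex → E3 →L[ℝ] ℝ}
    (h : ∀ v, (∀ a, ε a v = 0) → v = 0) : LinearIndependent ℝ ε := by
  obtain ⟨x, hx⟩ := exists_dual_basis h
  rw [Fintype.linearIndependent_iff]
  intro g hg a
  have := DFunLike.congr_fun hg (x a)
  simpa [hx] using this

variable {M : Type*} [TopologicalSpace M] [ChartedSpace (EuclideanSpace ℝ (Fin 3)) M]

theorem coframeMetric_apply (e : FrameIndex → OneForm M) (p : M) (v w : TangentSpace (𝓡 3) p) :
    coframeMetric e p v w = ∑ a, e a p v * e a p w := by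
  simp only [coframeMetric, Finset.sum_apply, tensorProd]

theorem sharp_apply {e : FrameIndex → OneForm M} {p : M}
    (h : LinearIndependent ℝ fun a => e a p) (a c : FrameIndex) :
    e c p (sharp e (e a) p) = if c = a then 1 else 0 := by
  obtain ⟨x, hx⟩ : ∃ x : FrameIndex → TangentSpace (𝓡 3) p,
      ∀ a c, e a p (x c) = if a = c then 1 else 0 :=
    exists_dual_basis (ε := fun a => e a p) fun v hv => eq_zero_of_linearIndependent h hv
  -- The dual basis vector `x a` witnesses that `sharp` is not a junk value.
  have hs : ∀ w, coframeMetric e p (sharp e (e a) p) w = e a p w :=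
    Classical.epsilon_spec (p := fun v => ∀ w, coframeMetric e p v w = e a p w)
      ⟨x a, fun w => by simp [coframeMetric_apply, hx]⟩
  have := hs (x c)
  simpa [coframeMetric_apply, hx, eq_comm] using this

/-- The components of the shape operator are its coefficients in the coframe. -/
theorem shapeComponents_eq {β : ℝ → M → ℝ} {e : ℝ → FrameIndex → OneForm M} {t : ℝ} {p : M}
    (h : LinearIndependent ℝ fun a => e t a p) {A : Matrix FrameIndex FrameIndex ℝ}
    (hA : ∀ v w, shapeOperator β e t p v w = ∑ a, ∑ c, A a c * e t a p v * e t c p w) :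
    shapeComponents β e t p = A := by
  ext a c
  simp only [shapeComponents, Matrix.of_apply, hA, sharp_apply h]
  simp

/-- The shape operator of a family of coframes that evolves by `∂_t e = - β A e` with `A`
symmetric is given by `A`. -/
theorem shapeComponents_eq_of_hasDerivAt {β : ℝ → M → ℝ} {e : ℝ → FrameIndex → OneForm M} {t : ℝ}
    {p : M} (h : LinearIndependent ℝ fun a => e t a p) (hβ : β t p ≠ 0)
    {A : Matrix FrameIndex FrameIndex ℝ} (hsymm : ∀ a c, A a c = A c a)
    (hd : ∀ a v, HasDerivAt (fun s => e s a p v) (-(β t p * ∑ c, A a c * e t c p v)) t) :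
    shapeComponents β e t p = A := by
  refine shapeComponents_eq h fun v w => ?_
  have h1 : HasDerivAt (fun s => coframeMetric (e s) p v w)
      (∑ a, (-(β t p * ∑ c, A a c * e t c p v) * e t a p w +
        e t a p v * -(β t p * ∑ c, A a c * e t c p w))) t := by
    simp only [coframeMetric_apply]
    exact HasDerivAt.fun_sum fun a _ => (hd a v).mul (hd a w)
  rw [shapeOperator, h1.deriv]
  simp only [FrameIndex.sum_eq]
  rw [hsymm .l .u, hsymm .n .u, hsymm .n .l]
  field_simp
  ring

theorem shapeComponents_symm (β : ℝ → M → ℝ) (e : ℝ → FrameIndex → OneForm M) (t : ℝ) (p : M)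
    (a c : FrameIndex) : shapeComponents β e t p a c = shapeComponents β e t p c a := by
  simp only [shapeComponents, Matrix.of_apply, shapeOperator, coframeMetric_apply, mul_comm]

theorem shapeOn_apply (β : ℝ → M → ℝ) (e : ℝ → FrameIndex → OneForm M) (t : ℝ) (a : FrameIndex)
    (p : M) (v : TangentSpace (𝓡 3) p) :
    shapeOn β e t a p v = ∑ c, shapeComponents β e t p a c * e t c p v := by
  simp only [shapeOn, FrameIndex.sum_eq]
  rfl

end Coframe

/-! ### Reduction of the flow to an evolution at the identity. -/

section Invariant

variable {G : Type*} [TopologicalSpace G] [ChartedSpace (EuclideanSpace ℝ (Fin 3)) G] [Group G]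

theorem IsLeftInvariantForm.apply_mulInvariantVectorField {γ : OneForm G}
    (hγ : IsLeftInvariantForm γ) (w : GroupLieAlgebra (𝓡 3) G) (p : G) :
    γ p (mulInvariantVectorField w p) = γ 1 w := by
  have h := hγ p 1 w
  rw [mul_one] at h
  exact h

theorem IsLeftInvariantFun.eq_one {G : Type*} [Group G] {f : G → ℝ} (hf : IsLeftInvariantFun f)
    (p : G) :
    f p = f 1 := by
  simpa using hf p 1

theorem mulInvariantVectorField_one (v : GroupLieAlgebra (𝓡 3) G) :
    mulInvariantVectorField v (1 : G) = v := by
  have h1 : (fun x : G => 1 * x) = id := funext one_mul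
  have h2 : mfderiv (𝓡 3) (𝓡 3) (fun x : G => 1 * x) 1 =
      mfderiv (𝓡 3) (𝓡 3) (id : G → G) 1 := by rw [h1]
  exact (DFunLike.congr_fun h2 v).trans (DFunLike.congr_fun mfderiv_id v)

variable [LieGroup (𝓡 3) ∞ G]

theorem exists_mulInvariantVectorField_eq (p : G) (v : TangentSpace (𝓡 3) p) :
    ∃ w : GroupLieAlgebra (𝓡 3) G, mulInvariantVectorField w p = v :=
  (isInvertible_mfderiv_mul_left p (1 : G)).surjective (v : EuclideanSpace ℝ (Fin 3))

theorem IsLeftInvariantForm.ext {γ γ' : OneForm G} (hγ : IsLeftInvariantForm γ)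
    (hγ' : IsLeftInvariantForm γ') (h : ∀ v, γ 1 v = γ' 1 v) : γ = γ' := by
  funext p
  ext v
  obtain ⟨w, rfl⟩ := exists_mulInvariantVectorField_eq p v
  rw [hγ.apply_mulInvariantVectorField, hγ'.apply_mulInvariantVectorField, h]

/-- The exterior derivative of a left-invariant form is given by the Lie bracket. -/
theorem IsExtDeriv.apply_one {γ : OneForm G} {η : TwoTensor G} (h : IsExtDeriv γ η)
    (hγ : IsLeftInvariantForm γ) (v w : GroupLieAlgebra (𝓡 3) G) : η 1 v w = - γ 1 ⁅v, w⁆ := by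
  have h1 := h _ _ (isSmoothVectorField_mulInvariantVectorField v)
    (isSmoothVectorField_mulInvariantVectorField w) 1
  simp only [hγ.apply_mulInvariantVectorField, differential_const,
    mulInvariantVectorField_one] at h1
  rw [h1, sub_zero, zero_sub]
  rfl

end Invariant

/-- The evolution at the identity of a left-invariant parallel spinor flow: `E t` is the coframe,
`A t` the matrix of the shape operator, `b` the lapse and `br` the Lie bracket. -/
structure InvariantEvolution {V : Type*} [AddCommGroup V] [Module ℝ V] (J : Set ℝ) (b : ℝ → ℝ)
    (A : ℝ → Matrix FrameIndex FrameIndex ℝ) (E : ℝ → FrameIndex → V →ₗ[ℝ] ℝ) (br : V → V → V) :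
    Prop where
  isOpen : IsOpen J
  ordConnected : J.OrdConnected
  zero_mem : (0 : ℝ) ∈ J
  symm : ∀ t a c, A t a c = A t c a
  hasDerivAt : ∀ t ∈ J, ∀ a v,
    HasDerivAt (fun s => E s a v) (-(b t * ∑ c, A t a c * E t c v)) t
  shape_const : ∀ t ∈ J, ∀ v, ∑ c, A t .u c * E t c v = ∑ c, A 0 .u c * E 0 c v
  eq_zero : ∀ t ∈ J, ∀ v, (∀ a, E t a v = 0) → v = 0
  exists_dual : ∀ t ∈ J, ∃ x : FrameIndex → V, ∀ a c, E t a (x c) = if a = c then 1 else 0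
  differentiableAt : ∀ t ∈ J, ∀ c, DifferentiableAt ℝ (fun s => A s .u c) t
  bracket : ∀ t ∈ J, ∀ a v w, E t a (br v w) =
    (∑ c, A t a c * E t c w) * E t .u v - (∑ c, A t a c * E t c v) * E t .u w
  jacobi : ∀ t ∈ J, ∀ a, A t a .l * A t .u .n = A t a .n * A t .u .l
  closed_l : ∀ t ∈ J, ∑ a, A t .u a * A t a .l = 0
  closed_n : ∀ t ∈ J, ∑ a, A t .u a * A t a .n = 0

section Geometry

variable {G : Type*} [TopologicalSpace G] [ChartedSpace (EuclideanSpace ℝ (Fin 3)) G] [Group G]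

theorem differential_eq_zero_of_leftInvariant {f : G → ℝ} (hf : IsLeftInvariantFun f) :
    differential f = 0 := by
  have : f = fun _ => f 1 := funext hf.eq_one
  funext p
  ext v
  rw [this]
  exact differential_const _ _ _

variable [LieGroup (𝓡 3) ∞ G] {J : Set ℝ} {β : ℝ → G → ℝ} {e : ℝ → FrameIndex → OneForm G}

namespace IsLeftInvariantFlow

theorem differential_lapse (h : IsLeftInvariantFlow J β e) {t : ℝ} (ht : t ∈ J) : differential
    (β t) = 0 :=
  differential_eq_zero_of_leftInvariant (h.lapse_invariant t ht)

theorem lapseDeriv_eq_zero (h : IsLeftInvariantFlow J β e) {t : ℝ} (ht : t ∈ J) (a : FrameIndex) :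
    lapseDeriv β e t a = 0 := by
  funext p
  rw [lapseDeriv, h.differential_lapse ht]
  rfl

theorem lapse_eq (h : IsLeftInvariantFlow J β e) {t : ℝ} (ht : t ∈ J) (p : G) : β t p = β t 1 :=
  (h.lapse_invariant t ht).eq_one p

theorem contDiffOn_coframe (h : IsLeftInvariantFlow J β e) (a : FrameIndex)
    (v : GroupLieAlgebra (𝓡 3) G) :
    ContDiffOn ℝ ∞ (fun s => e s a 1 v) J := by
  have h1 := h.flow.coframe.smooth _ (isSmoothVectorField_mulInvariantVectorField v) a
  have h2 : ContMDiffOn 𝓘(ℝ, ℝ) (𝓘(ℝ, ℝ).prod (𝓡 3)) ∞ (fun s : ℝ => (s, (1 : G))) J :=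
    (contMDiff_id.prodMk contMDiff_const).contMDiffOn
  have h3 := (h1.comp h2 fun s hs => ⟨hs, trivial⟩).contDiffOn
  refine h3.congr fun s _ => ?_
  change _ = e s a 1 (mulInvariantVectorField v 1)
  rw [mulInvariantVectorField_one]

theorem contDiffOn_lapse (h : IsLeftInvariantFlow J β e) : ContDiffOn ℝ ∞ (fun s => β s 1) J := by
  have h2 : ContMDiffOn 𝓘(ℝ, ℝ) (𝓘(ℝ, ℝ).prod (𝓡 3)) ∞ (fun s : ℝ => (s, (1 : G))) J :=
    (contMDiff_id.prodMk contMDiff_const).contMDiffOn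
  exact (h.flow.lapse.smooth.comp h2 fun s hs => ⟨hs, trivial⟩).contDiffOn

theorem isSmoothForm (h : IsLeftInvariantFlow J β e) {t : ℝ} (ht : t ∈ J) (a : FrameIndex) :
    IsSmoothForm (e t a) := by
  intro X hX
  have h2 : ContMDiff (𝓡 3) (𝓘(ℝ, ℝ).prod (𝓡 3)) ∞ (fun p : G => (t, p)) :=
    contMDiff_const.prodMk contMDiff_id
  have h1 := (h.flow.coframe.smooth X hX a).comp (h2.contMDiffOn (s := Set.univ))
    fun p _ => ⟨ht, trivial⟩
  exact contMDiffOn_univ.1 h1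

/-- A left-invariant lapse has `dβ = 0`, so the evolution equation loses its inhomogeneous terms.
Smoothness of the family turns the equation for `deriv` into an actual derivative. -/
theorem hasDerivAt_coframe (h : IsLeftInvariantFlow J β e) {t : ℝ} (ht : t ∈ J) (a : FrameIndex)
    (v : GroupLieAlgebra (𝓡 3) G) :
    HasDerivAt (fun s => e s a 1 v)
      (-(β t 1 * ∑ c, shapeComponents β e t 1 a c * e t c 1 v)) t := by
  have h1 := h.flow.evolution t ht a 1 v
  rw [h.lapseDeriv_eq_zero ht, h.differential_lapse ht, shapeOn_apply] at h1
  have h2 : DifferentiableAt ℝ (fun s => e s a 1 v) t :=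
    ((h.contDiffOn_coframe a v).contDiffAt (h.flow.isOpen.mem_nhds ht)).differentiableAt (by simp)
  have h3 : (if a = .u then ((0 : OneForm G) 1) v else 0) = (0 : ℝ) := by split_ifs <;> rfl
  rw [h3] at h1
  simp only [Pi.zero_apply, zero_mul, add_zero] at h1
  rw [← eq_neg_of_add_eq_zero_left h1]
  exact h2.hasDerivAt

theorem linearIndependent (h : IsLeftInvariantFlow J β e) {t : ℝ} (ht : t ∈ J) (p : G) :
    LinearIndependent ℝ fun a => e t a p := h.flow.coframe.linearIndependent t ht p

theorem coframe_eq_zero (h : IsLeftInvariantFlow J β e) {t : ℝ} (ht : t ∈ J) {p : G}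
    {v : TangentSpace (𝓡 3) p}
    (hv : ∀ a, e t a p v = 0) : v = 0 :=
  eq_zero_of_linearIndependent (h.linearIndependent ht p) hv

theorem shapeComponents_eq_one (h : IsLeftInvariantFlow J β e) {t : ℝ} (ht : t ∈ J) (p : G) :
    shapeComponents β e t p = shapeComponents β e t 1 := by
  have hop : ∀ v w : GroupLieAlgebra (𝓡 3) G, shapeOperator β e t p
      (mulInvariantVectorField v p) (mulInvariantVectorField w p) =
        shapeOperator β e t 1 v w := by
    intro v w
    have h1 : (fun s => coframeMetric (e s) p (mulInvariantVectorField v p)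
        (mulInvariantVectorField w p)) =ᶠ[nhds t] fun s => coframeMetric (e s) 1 v w := by
      filter_upwards [h.flow.isOpen.mem_nhds ht] with s hs
      simp only [coframeMetric_apply,
        (h.coframe_invariant s hs _).apply_mulInvariantVectorField]
    rw [shapeOperator, shapeOperator, h1.deriv_eq, h.lapse_eq ht]
  have hsh : ∀ a, sharp (e t) (e t a) p =
      mulInvariantVectorField (sharp (e t) (e t a) 1 : GroupLieAlgebra (𝓡 3) G) p := by
    intro a
    rw [← sub_eq_zero]
    refine h.coframe_eq_zero ht fun c => ?_
    rw [map_sub, (h.coframe_invariant t ht c).apply_mulInvariantVectorField,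
      sharp_apply (h.linearIndependent ht p), sharp_apply (h.linearIndependent ht 1),
      sub_self]
  ext a c
  simp only [shapeComponents, Matrix.of_apply]
  rw [hsh, hsh, hop]

theorem shapeOn_eq (h : IsLeftInvariantFlow J β e) {t : ℝ} (ht : t ∈ J) (a : FrameIndex) :
    shapeOn β e t a = ∑ c, shapeComponents β e t 1 a c • e t c := by
  funext p
  rw [shapeOn, h.shapeComponents_eq_one ht]
  simp only [FrameIndex.sum_eq]
  rfl

theorem shapeOn_leftInvariant (h : IsLeftInvariantFlow J β e) {t : ℝ} (ht : t ∈ J)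
    (a : FrameIndex) :
    IsLeftInvariantForm (shapeOn β e t a) := by
  rw [h.shapeOn_eq ht, FrameIndex.sum_eq]
  have := h.coframe_invariant t ht
  exact ((this _).const_smul _).add (((this _).const_smul _).add ((this _).const_smul _))

/-- For left-invariant forms `dγ(v, w) = -γ([v, w])`, so the structure equations are the structure
constants of the Lie algebra. -/
theorem bracket (h : IsLeftInvariantFlow J β e) {t : ℝ} (ht : t ∈ J) (a : FrameIndex)
    (v w : GroupLieAlgebra (𝓡 3) G) :
    e t a 1 ⁅v, w⁆ =
      (∑ c, shapeComponents β e t 1 a c * e t c 1 w) * e t .u 1 v -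
        (∑ c, shapeComponents β e t 1 a c * e t c 1 v) * e t .u 1 w := by
  have h1 := (h.flow.structure_eq t ht a).apply_one (h.coframe_invariant t ht a) v w
  simp only [wedge, tensorProd, Pi.sub_apply, shapeOn_apply] at h1
  linarith

theorem shapeOn_bracket (h : IsLeftInvariantFlow J β e) {t : ℝ} (ht : t ∈ J)
    (v w : GroupLieAlgebra (𝓡 3) G) :
    ∑ c, shapeComponents β e t 1 .u c * e t c 1 ⁅v, w⁆ = 0 := by
  have h1 := ((h.flow.cohomology t ht).1).apply_one (h.shapeOn_leftInvariant ht .u) v w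
  rw [shapeOn_apply] at h1
  simpa using h1

/-- The form `w = Θ(e_u)` is conserved, since the term with `dβ` drops out of its evolution
equation. -/
theorem shapeOn_const (h : IsLeftInvariantFlow J β e) {t : ℝ} (ht : t ∈ J)
    (v : GroupLieAlgebra (𝓡 3) G) :
    ∑ c, shapeComponents β e t 1 .u c * e t c 1 v =
      ∑ c, shapeComponents β e 0 1 .u c * e 0 c 1 v := by
  -- A vanishing `deriv` says nothing without differentiability; this expression through the smooth
  -- coframe and lapse supplies it.
  have hJ : ∀ s ∈ J, ∑ c, shapeComponents β e s 1 .u c * e s c 1 v =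
      -(deriv (fun r => e r .u 1 v) s / β s 1) := by
    intro s hs
    rw [(h.hasDerivAt_coframe hs .u v).deriv]
    have := (h.flow.lapse.pos s hs 1).ne'
    field_simp
  have hd : ∀ s ∈ J, HasDerivAt (fun r => ∑ c, shapeComponents β e r 1 .u c * e r c 1 v) 0 s := by
    intro s hs
    have hn := h.flow.isOpen.mem_nhds hs
    have h1 : DifferentiableAt ℝ (fun r => -(deriv (fun r => e r .u 1 v) r / β r 1)) s := by
      have h2 : ContDiffOn ℝ ∞ (deriv (fun r => e r .u 1 v)) J :=
        (contDiffOn_infty_iff_deriv_of_isOpen h.flow.isOpen).1 (h.contDiffOn_coframe .u v) |>.2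
      exact (((h2.contDiffAt hn).differentiableAt (by simp)).div
        ((h.contDiffOn_lapse.contDiffAt hn).differentiableAt (by simp))
        (h.flow.lapse.pos s hs 1).ne').neg
    have h3 : DifferentiableAt ℝ (fun r => ∑ c, shapeComponents β e r 1 .u c * e r c 1 v) s :=
      h1.congr_of_eventuallyEq (Filter.eventually_of_mem hn hJ)
    have h4 := h.flow.evolution_shape s hs 1 v
    rw [h.lapseDeriv_eq_zero hs] at h4
    have h5 : differential (0 : G → ℝ) 1 v = 0 := differential_const 0 1 v
    rw [h5, add_zero] at h4
    simp only [shapeOn_apply] at h4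
    rw [← h4]
    exact h3.hasDerivAt
  have hconv : Convex ℝ J := h.flow.ordConnected.convex
  refine hconv.is_const_of_fderivWithin_eq_zero (𝕜 := ℝ)
    (f := fun r => ∑ c, shapeComponents β e r 1 .u c * e r c 1 v)
    (fun s hs => (hd s hs).differentiableAt.differentiableWithinAt) (fun s hs => ?_)
    ht h.flow.zero_mem
  rw [fderivWithin_of_isOpen h.flow.isOpen hs]
  have := (hd s hs).hasFDerivAt.fderiv
  rw [this]
  ext
  simp

/-- `Θ_uc` is the fixed form `w` evaluated on the `c`-th dual vector at time `s`. The dual basis is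
the inverse of the matrix `L s` of the coframe, and inversion is smooth. -/
theorem differentiableAt_shapeComponents (h : IsLeftInvariantFlow J β e) {t : ℝ} (ht : t ∈ J)
    (c : FrameIndex) :
    DifferentiableAt ℝ (fun s => shapeComponents β e s 1 .u c) t := by
  let W : EuclideanSpace ℝ (Fin 3) →L[ℝ] ℝ := shapeOn β e 0 .u 1
  let L : ℝ → EuclideanSpace ℝ (Fin 3) →L[ℝ] (FrameIndex → ℝ) := fun s =>
    ContinuousLinearMap.pi fun a => e s a 1
  have hL : ContDiffOn ℝ ∞ L J := by
    rw [contDiffOn_clm_apply]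
    exact fun v => contDiffOn_pi.2 fun a => h.contDiffOn_coframe a v
  have hinj : ∀ s ∈ J, Function.Injective (L s) := by
    intro s hs
    rw [injective_iff_map_eq_zero]
    exact fun v hv => h.coframe_eq_zero hs (p := 1) fun a => congrFun hv a
  have hinv : ∀ s ∈ J, (L s).IsInvertible := by
    intro s hs
    refine ⟨ContinuousLinearEquiv.ofBijective (L s) (LinearMap.ker_eq_bot.2 (hinj s hs))
      (LinearMap.range_eq_top.2 ((LinearMap.injective_iff_surjective_of_finrank_eq_finrank
        (f := (L s : EuclideanSpace ℝ (Fin 3) →ₗ[ℝ] FrameIndex → ℝ))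
        (by simp [card_frameIndex])).1 (hinj s hs))), ?_⟩
    ext1 v
    rfl
  have hn := h.flow.isOpen.mem_nhds ht
  have hd : DifferentiableAt ℝ (fun s => W ((L s).inverse (Pi.single c 1))) t := by
    have h1 : ContDiffAt ℝ ∞ (fun s => (L s).inverse) t :=
      (hinv t ht).contDiffAt_map_inverse.comp t (hL.contDiffAt hn)
    exact W.differentiableAt.comp t
      ((h1.differentiableAt (by simp)).clm_apply (differentiableAt_const _))
  refine hd.congr_of_eventuallyEq (Filter.eventually_of_mem hn fun s hs => ?_)
  have h1 : L s ((L s).inverse (Pi.single c 1)) = Pi.single c 1 :=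
    (hinv s hs).self_apply_inverse _
  obtain ⟨x, hx⟩ : ∃ x : GroupLieAlgebra (𝓡 3) G, x = (L s).inverse (Pi.single c 1) := ⟨_, rfl⟩
  rw [← hx] at h1
  have h2 : ∀ a, e s a 1 x = (Pi.single c 1 : FrameIndex → ℝ) a := fun a => congrFun h1 a
  have h3 : W x = ∑ a, shapeComponents β e s 1 .u a * e s a 1 x :=
    (shapeOn_apply β e 0 .u 1 x).trans (h.shapeOn_const hs x).symm
  refine Eq.trans ?_ (h3.symm.trans (congrArg W hx))
  simp [h2, Pi.single_apply]

/-- A left-invariant parallel spinor flow, seen at the identity. -/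
theorem invariantEvolution (h : IsLeftInvariantFlow J β e) : InvariantEvolution
    (V := GroupLieAlgebra (𝓡 3) G) J (fun t => β t 1)
    (fun t => shapeComponents β e t 1) (fun t a => (e t a 1 : _ →ₗ[ℝ] ℝ)) (fun v w => ⁅v, w⁆) := by
  have hdual : ∀ t ∈ J, ∃ x : FrameIndex → GroupLieAlgebra (𝓡 3) G,
      ∀ a c, e t a 1 (x c) = if a = c then 1 else 0 := fun t ht =>
    ⟨fun c => sharp (e t) (e t c) 1, fun a c => sharp_apply (h.linearIndependent ht 1) c a⟩
  -- Closedness of `w` evaluated on the bracket of the dual vectors `x_u` and `x_c`.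
  have hcl : ∀ t ∈ J, ∀ c ≠ FrameIndex.u,
      ∑ a, shapeComponents β e t 1 .u a * shapeComponents β e t 1 a c = 0 := by
    intro t ht c hc
    obtain ⟨x, hx⟩ := hdual t ht
    have h1 := h.shapeOn_bracket ht (x .u) (x c)
    simpa [h.bracket ht, hx, hc, hc.symm] using h1
  refine ⟨h.flow.isOpen, h.flow.ordConnected, h.flow.zero_mem,
    fun t => shapeComponents_symm β e t 1,
    fun t ht => h.hasDerivAt_coframe ht, fun t ht => h.shapeOn_const ht,
    fun t ht v hv => h.coframe_eq_zero ht hv, hdual,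
    fun t ht => h.differentiableAt_shapeComponents ht, fun t ht => h.bracket ht, ?_,
    fun t ht => hcl t ht .l (by simp), fun t ht => hcl t ht .n (by simp)⟩
  intro t ht a
  obtain ⟨x, hx⟩ := hdual t ht
  -- Every bracket carries a factor `e_u`, so the kernel of `e_u` is abelian and the Jacobi identity
  -- for `x_u, x_l, x_n` has only two terms.
  have hln : ⁅x .l, x .n⁆ = 0 := by
    refine h.coframe_eq_zero ht fun c => ?_
    rw [h.bracket ht]
    simp [hx]
  have hj := lie_jacobi (x .u) (x .l) (x .n)
  rw [hln, lie_zero, zero_add] at hj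
  have h1 := congrArg (e t a 1) hj
  rw [map_add, map_zero, h.bracket ht, h.bracket ht] at h1
  simp only [h.bracket ht, hx] at h1
  simp at h1
  linarith

end IsLeftInvariantFlow

end Geometry

theorem eq_of_hasDerivAt_zero {J : Set ℝ} (hJ : J.OrdConnected) {f : ℝ → ℝ}
    (hf : ∀ t ∈ J, HasDerivAt f 0 t) {s t : ℝ} (hs : s ∈ J) (ht : t ∈ J) : f s = f t := by
  have hsub : Set.uIcc s t ⊆ J := hJ.uIcc_subset hs ht
  have h := (convex_uIcc s t).norm_image_sub_le_of_norm_hasDerivWithin_le (f := f)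
    (f' := fun _ => 0) (C := 0) (fun r hr => (hf r (hsub hr)).hasDerivWithinAt) (by simp) Set.left_mem_uIcc
    Set.right_mem_uIcc
  rw [zero_mul, norm_le_zero_iff, sub_eq_zero] at h
  exact h.symm

/-! ### Linear systems with a symmetric two by two matrix. -/

section TwoByTwo

variable {Q θ : Matrix (Fin 2) (Fin 2) ℝ} {κ₁ κ₂ : ℝ}

theorem orthogonal_mul_transpose (hQ : Q ∈ Matrix.orthogonalGroup (Fin 2) ℝ) :
    Q * Q.transpose = 1 :=
  (Matrix.mem_orthogonalGroup_iff (Fin 2) ℝ).1 hQ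

theorem orthogonal_transpose_mul (hQ : Q ∈ Matrix.orthogonalGroup (Fin 2) ℝ) :
    Q.transpose * Q = 1 :=
  (Matrix.mem_orthogonalGroup_iff' (Fin 2) ℝ).1 hQ

/-- The products of matrices that are diagonal in the same orthonormal basis. -/
theorem conj_diagonal_mul (hQ : Q ∈ Matrix.orthogonalGroup (Fin 2) ℝ) (a₁ a₂ c₁ c₂ : ℝ) :
    (Q * Matrix.diagonal ![a₁, a₂] * Q.transpose) * (Q * Matrix.diagonal ![c₁, c₂] * Q.transpose) =
      Q * Matrix.diagonal ![a₁ * c₁, a₂ * c₂] * Q.transpose := by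
  have h : Matrix.diagonal ![a₁, a₂] * Matrix.diagonal ![c₁, c₂] =
      Matrix.diagonal ![a₁ * c₁, a₂ * c₂] := by
    rw [Matrix.diagonal_mul_diagonal]
    congr 1
    funext i
    fin_cases i <;> rfl
  calc _ = Q * Matrix.diagonal ![a₁, a₂] * (Q.transpose * Q) * Matrix.diagonal ![c₁, c₂] *
        Q.transpose := by simp only [Matrix.mul_assoc]
    _ = _ := by
      rw [orthogonal_transpose_mul hQ, Matrix.mul_one, Matrix.mul_assoc Q, h]

theorem conj_diagonal_apply (Q : Matrix (Fin 2) (Fin 2) ℝ) (a₁ a₂ : ℝ) (i j : Fin 2) :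
    (Q * Matrix.diagonal ![a₁, a₂] * Q.transpose) i j =
      Q i 0 * a₁ * Q j 0 + Q i 1 * a₂ * Q j 1 := by
  simp [Matrix.mul_apply, Fin.sum_univ_two, Matrix.diagonal_apply]

/-- The solution of a linear system `∂_t r = -c θ r` with `θ` symmetric. -/
theorem solve_symmetric_system {J : Set ℝ} (hJ : J.OrdConnected) (h0 : (0 : ℝ) ∈ J)
    (hQ : Q ∈ Matrix.orthogonalGroup (Fin 2) ℝ)
    (hθ : θ = Q * Matrix.diagonal ![κ₁, κ₂] * Q.transpose) {c g₁ g₂ r₁ r₂ : ℝ → ℝ}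
    (hg₁ : ∀ t ∈ J, HasDerivAt g₁ (-(c t * κ₁ * g₁ t)) t)
    (hg₂ : ∀ t ∈ J, HasDerivAt g₂ (-(c t * κ₂ * g₂ t)) t)
    (hg₁0 : g₁ 0 = 1) (hg₂0 : g₂ 0 = 1) (hg₁n : ∀ t ∈ J, g₁ t ≠ 0) (hg₂n : ∀ t ∈ J, g₂ t ≠ 0)
    (hr₁ : ∀ t ∈ J, HasDerivAt r₁ (-(c t * (θ 0 0 * r₁ t + θ 0 1 * r₂ t))) t)
    (hr₂ : ∀ t ∈ J, HasDerivAt r₂ (-(c t * (θ 1 0 * r₁ t + θ 1 1 * r₂ t))) t)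
    {t : ℝ} (ht : t ∈ J) {P : Matrix (Fin 2) (Fin 2) ℝ}
    (hP : P = Q * Matrix.diagonal ![g₁ t, g₂ t] * Q.transpose) :
    r₁ t = P 0 0 * r₁ 0 + P 0 1 * r₂ 0 ∧ r₂ t = P 1 0 * r₁ 0 + P 1 1 * r₂ 0 := by
  have hQ1 := orthogonal_mul_transpose hQ
  have hQ2 := orthogonal_transpose_mul hQ
  have o00 : Q 0 0 * Q 0 0 + Q 0 1 * Q 0 1 = 1 := by
    simpa [Matrix.mul_apply, Fin.sum_univ_two] using congrFun (congrFun hQ1 0) 0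
  have o01 : Q 0 0 * Q 1 0 + Q 0 1 * Q 1 1 = 0 := by
    simpa [Matrix.mul_apply, Fin.sum_univ_two] using congrFun (congrFun hQ1 0) 1
  have o11 : Q 1 0 * Q 1 0 + Q 1 1 * Q 1 1 = 1 := by
    simpa [Matrix.mul_apply, Fin.sum_univ_two] using congrFun (congrFun hQ1 1) 1
  have p00 : Q 0 0 * Q 0 0 + Q 1 0 * Q 1 0 = 1 := by
    simpa [Matrix.mul_apply, Fin.sum_univ_two] using congrFun (congrFun hQ2 0) 0
  have p01 : Q 0 0 * Q 0 1 + Q 1 0 * Q 1 1 = 0 := by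
    simpa [Matrix.mul_apply, Fin.sum_univ_two] using congrFun (congrFun hQ2 0) 1
  have p11 : Q 0 1 * Q 0 1 + Q 1 1 * Q 1 1 = 1 := by
    simpa [Matrix.mul_apply, Fin.sum_univ_two] using congrFun (congrFun hQ2 1) 1
  have e00 : θ 0 0 = Q 0 0 * κ₁ * Q 0 0 + Q 0 1 * κ₂ * Q 0 1 := by
    rw [hθ, conj_diagonal_apply]
  have e01 : θ 0 1 = Q 0 0 * κ₁ * Q 1 0 + Q 0 1 * κ₂ * Q 1 1 := by
    rw [hθ, conj_diagonal_apply]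
  have e10 : θ 1 0 = Q 1 0 * κ₁ * Q 0 0 + Q 1 1 * κ₂ * Q 0 1 := by
    rw [hθ, conj_diagonal_apply]
  have e11 : θ 1 1 = Q 1 0 * κ₁ * Q 1 0 + Q 1 1 * κ₂ * Q 1 1 := by
    rw [hθ, conj_diagonal_apply]
  -- Along an eigenvector `(x, y)` of `θ` the system is scalar: `(x r₁ + y r₂) / g` is conserved. It
  -- is applied to the columns of `Q`.
  have aux : ∀ (κ x y : ℝ) (g : ℝ → ℝ), (∀ s ∈ J, HasDerivAt g (-(c s * κ * g s)) s) →
      (∀ s ∈ J, g s ≠ 0) → g 0 = 1 → (x * θ 0 0 + y * θ 1 0 = κ * x) →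
      (x * θ 0 1 + y * θ 1 1 = κ * y) → x * r₁ t + y * r₂ t = g t * (x * r₁ 0 + y * r₂ 0) := by
    intro κ x y g hg hgn hg0 hx hy
    have hd : ∀ s ∈ J, HasDerivAt (fun s => (x * r₁ s + y * r₂ s) / g s) 0 s := by
      intro s hs
      have h1 := (((hr₁ s hs).const_mul x).fun_add ((hr₂ s hs).const_mul y)).fun_div (hg s hs)
        (hgn s hs)
      refine h1.congr_deriv ?_
      rw [div_eq_zero_iff]
      left
      linear_combination (-(c s * g s * r₁ s)) * hx - (c s * g s * r₂ s) * hy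
    have h2 := eq_of_hasDerivAt_zero hJ hd ht h0
    simp only [hg0, div_one] at h2
    rw [div_eq_iff (hgn t ht)] at h2
    rw [h2, mul_comm]
  have s1 := aux κ₁ (Q 0 0) (Q 1 0) g₁ hg₁ hg₁n hg₁0
    (by rw [e00, e10]; linear_combination (κ₁ * Q 0 0) * p00 + (κ₂ * Q 0 1) * p01)
    (by rw [e01, e11]; linear_combination (κ₁ * Q 1 0) * p00 + (κ₂ * Q 1 1) * p01)
  have s2 := aux κ₂ (Q 0 1) (Q 1 1) g₂ hg₂ hg₂n hg₂0
    (by rw [e00, e10]; linear_combination (κ₁ * Q 0 0) * p01 + (κ₂ * Q 0 1) * p11)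
    (by rw [e01, e11]; linear_combination (κ₁ * Q 1 0) * p01 + (κ₂ * Q 1 1) * p11)
  simp only [hP, conj_diagonal_apply]
  constructor
  · linear_combination (Q 0 0) * s1 + (Q 0 1) * s2 - r₁ t * o00 - r₂ t * o01
  · linear_combination (Q 1 0) * s1 + (Q 1 1) * s2 - r₁ t * o01 - r₂ t * o11

end TwoByTwo

/-! ### Integration of the evolution at the identity. -/

namespace InvariantEvolution

variable {V : Type*} [AddCommGroup V] [Module ℝ V] {J : Set ℝ} {b B : ℝ → ℝ}
  {A : ℝ → Matrix FrameIndex FrameIndex ℝ} {E : ℝ → FrameIndex → V →ₗ[ℝ] ℝ} {br : V → V → V}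

theorem coframe_u (h : InvariantEvolution J b A E br) (hB : ∀ t ∈ J, HasDerivAt B (b t) t)
    (hB0 : B 0 = 0) {t : ℝ} (ht : t ∈ J) (v : V) :
    E t .u v = E 0 .u v - B t * ∑ c, A 0 .u c * E 0 c v := by
  have hd : ∀ s ∈ J, HasDerivAt (fun s => E s .u v + B s * ∑ c, A 0 .u c * E 0 c v) 0 s := by
    intro s hs
    refine ((h.hasDerivAt s hs .u v).fun_add ((hB s hs).mul_const _)).congr_deriv ?_
    rw [h.shape_const s hs v]
    ring
  have := eq_of_hasDerivAt_zero h.ordConnected hd ht h.zero_mem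
  simp only [hB0] at this
  linear_combination this

/-- Differentiating the conserved sum `∑ Θ_uk e_k` and evaluating on the dual basis at time `t`
isolates the derivative of each coefficient. -/
theorem hasDerivAt_shape (h : InvariantEvolution J b A E br) {t : ℝ} (ht : t ∈ J)
    (c : FrameIndex) : HasDerivAt (fun s => A s .u c) (b t * ∑ a, A t .u a * A t a c) t := by
  obtain ⟨x, hx⟩ := h.exists_dual t ht
  have hd : ∀ c, HasDerivAt (fun s => A s .u c) (deriv (fun s => A s .u c) t) t :=
    fun c => (h.differentiableAt t ht c).hasDerivAt
  have h1 : HasDerivAt (fun s => ∑ k, A s .u k * E s k (x c)) _ t :=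
    HasDerivAt.fun_sum fun k _ => (hd k).mul (h.hasDerivAt t ht k (x c))
  have h2 : HasDerivAt (fun s => ∑ k, A s .u k * E s k (x c)) 0 t := by
    refine (hasDerivAt_const t (∑ k, A 0 .u k * E 0 k (x c))).congr_of_eventuallyEq ?_
    filter_upwards [h.isOpen.mem_nhds ht] with s hs using h.shape_const s hs _
  have h3 := h1.unique h2
  simp only [hx] at h3
  refine (hd c).congr_deriv ?_
  simp only [Finset.sum_add_distrib, mul_ite, mul_one, mul_zero, Finset.sum_ite_eq',
    Finset.mem_univ, if_true, FrameIndex.sum_eq] at h3 ⊢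
  cases c <;> simp at h3 ⊢ <;> linear_combination h3

theorem shape_ul (h : InvariantEvolution J b A E br) {t : ℝ} (ht : t ∈ J) :
    A t .u .l = A 0 .u .l :=
  eq_of_hasDerivAt_zero (f := fun s => A s .u .l) h.ordConnected
    (fun s hs => (h.hasDerivAt_shape hs .l).congr_deriv (by rw [h.closed_l s hs, mul_zero])) ht
    h.zero_mem

theorem shape_un (h : InvariantEvolution J b A E br) {t : ℝ} (ht : t ∈ J) :
    A t .u .n = A 0 .u .n :=
  eq_of_hasDerivAt_zero (f := fun s => A s .u .n) h.ordConnected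
    (fun s hs => (h.hasDerivAt_shape hs .n).congr_deriv (by rw [h.closed_n s hs, mul_zero])) ht
    h.zero_mem

/-- A Riccati equation with constant `λ²`; its solution is `λ tan y_t` when `λ ≠ 0`. -/
theorem hasDerivAt_shape_uu (h : InvariantEvolution J b A E br) {t : ℝ} (ht : t ∈ J) :
    HasDerivAt (fun s => A s .u .u)
      (b t * (A t .u .u ^ 2 + (A 0 .u .l ^ 2 + A 0 .u .n ^ 2))) t := by
  refine (h.hasDerivAt_shape ht .u).congr_deriv ?_
  rw [FrameIndex.sum_eq, h.symm t .l .u, h.symm t .n .u, h.shape_ul ht, h.shape_un ht]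
  ring

section Rotating

variable {lam : ℝ}

theorem arctan_shape_uu (h : InvariantEvolution J b A E br) (hB : ∀ t ∈ J, HasDerivAt B (b t) t)
    (hB0 : B 0 = 0) (hlam : 0 < lam) (hlam2 : lam ^ 2 = A 0 .u .l ^ 2 + A 0 .u .n ^ 2) {t : ℝ}
    (ht : t ∈ J) :
    Real.arctan (A t .u .u / lam) = lam * B t + Real.arctan (A 0 .u .u / lam) := by
  have hd : ∀ s ∈ J, HasDerivAt (fun s => Real.arctan (A s .u .u / lam) - lam * B s) 0 s := by
    intro s hs
    refine (((h.hasDerivAt_shape_uu hs).div_const lam).arctan.fun_sub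
      ((hB s hs).const_mul lam)).congr_deriv ?_
    rw [← hlam2]
    have : 0 < A s .u .u ^ 2 + lam ^ 2 := by positivity
    field_simp
    ring
  have := eq_of_hasDerivAt_zero h.ordConnected hd ht h.zero_mem
  simp only [hB0] at this
  linear_combination this

/-- The entries of the shape operator transverse to `e_u`. -/
theorem shape_transverse (h : InvariantEvolution J b A E br)
    (hlam2 : lam ^ 2 = A 0 .u .l ^ 2 + A 0 .u .n ^ 2) {t : ℝ} (ht : t ∈ J) :
    lam ^ 2 * A t .l .l = -(A t .u .u * A 0 .u .l ^ 2) ∧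
    lam ^ 2 * A t .l .n = -(A t .u .u * A 0 .u .l * A 0 .u .n) ∧
    lam ^ 2 * A t .n .n = -(A t .u .u * A 0 .u .n ^ 2) := by
  have hl := h.closed_l t ht
  have hn := h.closed_n t ht
  have jl := h.jacobi t ht .l
  have jn := h.jacobi t ht .n
  rw [FrameIndex.sum_eq, h.symm t .n .l, h.shape_ul ht, h.shape_un ht] at hl
  rw [FrameIndex.sum_eq, h.shape_ul ht, h.shape_un ht] at hn
  rw [h.shape_ul ht, h.shape_un ht] at jl jn
  rw [h.symm t .n .l] at jn
  rw [hlam2]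
  -- With `m = (Θ_ul, Θ_un)`, closedness says `θ m = -Θ_uu m`, and the Jacobi identity says that `θ`
  -- annihilates the direction orthogonal to `m`.
  refine ⟨?_, ?_, ?_⟩
  · linear_combination A 0 .u .l * hl + A 0 .u .n * jl
  · linear_combination A 0 .u .n * hl - A 0 .u .l * jl
  · linear_combination A 0 .u .n * hn - A 0 .u .l * jn

theorem trace_transverse (h : InvariantEvolution J b A E br) (hlam : 0 < lam)
    (hlam2 : lam ^ 2 = A 0 .u .l ^ 2 + A 0 .u .n ^ 2) {t : ℝ} (ht : t ∈ J) :
    A t .l .l + A t .n .n = -A t .u .u := by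
  obtain ⟨h1, -, h3⟩ := h.shape_transverse hlam2 ht
  have : lam ^ 2 ≠ 0 := by positivity
  refine mul_left_cancel₀ this ?_
  linear_combination h1 + h3 + A t .u .u * hlam2

/-- The direction orthogonal to `(Θ_ul, Θ_un)` lies in the kernel of `Θ` by the Jacobi identity, so
the corresponding form `k` is conserved. -/
theorem coframe_perp (h : InvariantEvolution J b A E br) {t : ℝ} (ht : t ∈ J) (v : V) :
    -(A 0 .u .n * E t .l v) + A 0 .u .l * E t .n v =
      -(A 0 .u .n * E 0 .l v) + A 0 .u .l * E 0 .n v := by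
  refine eq_of_hasDerivAt_zero
    (f := fun t => -(A 0 .u .n * E t .l v) + A 0 .u .l * E t .n v) h.ordConnected
    (fun s hs => ?_) ht h.zero_mem
  refine (((h.hasDerivAt s hs .l v).const_mul _).fun_neg.fun_add
    ((h.hasDerivAt s hs .n v).const_mul _)).congr_deriv ?_
  have jl := h.jacobi s hs .l
  have jn := h.jacobi s hs .n
  rw [h.shape_ul hs, h.shape_un hs] at jl jn
  rw [h.symm s .n .l] at jn
  simp only [FrameIndex.sum_eq]
  rw [h.symm s .l .u, h.symm s .n .u, h.symm s .n .l, h.shape_ul hs, h.shape_un hs]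
  linear_combination (b s * E s .l v) * jl + (b s * E s .n v) * jn

/-- The coframe at time `t` in terms of the initial one. -/
theorem coframe_rotating (h : InvariantEvolution J b A E br)
    (hlam2 : lam ^ 2 = A 0 .u .l ^ 2 + A 0 .u .n ^ 2) {t : ℝ} (ht : t ∈ J) (v : V) :
    lam ^ 2 * E t .l v = A 0 .u .l * (∑ c, A 0 .u c * E 0 c v - A t .u .u * E t .u v) -
      A 0 .u .n * (-(A 0 .u .n * E 0 .l v) + A 0 .u .l * E 0 .n v) ∧
    lam ^ 2 * E t .n v = A 0 .u .n * (∑ c, A 0 .u c * E 0 c v - A t .u .u * E t .u v) +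
      A 0 .u .l * (-(A 0 .u .n * E 0 .l v) + A 0 .u .l * E 0 .n v) := by
  have h1 := h.shape_const t ht v
  have h2 := h.coframe_perp ht v
  rw [FrameIndex.sum_eq, h.shape_ul ht, h.shape_un ht] at h1
  -- `w - Θ_uu e_u = Θ_ul e_l + Θ_un e_n` and `k` are `e_l`, `e_n` up to a rotation and the factor
  -- `λ`, which is inverted here.
  rw [← h1, ← h2, hlam2]
  constructor <;> ring

end Rotating

section Quasidiagonal

/-- The factor `1 - Θ_uu 𝓑_t` does not vanish. -/
theorem one_sub_pos (h : InvariantEvolution J b A E br) (hB : ∀ t ∈ J, HasDerivAt B (b t) t)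
    (hB0 : B 0 = 0) (hl : A 0 .u .l = 0) (hn : A 0 .u .n = 0) {t : ℝ} (ht : t ∈ J) :
    0 < 1 - A 0 .u .u * B t := by
  have hne : ∀ s ∈ J, 1 - A 0 .u .u * B s ≠ 0 := by
    intro s hs h0
    -- Since `e_u^s = (1 - Θ_uu B_s) e_u`, a zero of the factor would make a member of a coframe
    -- vanish.
    obtain ⟨x, hx⟩ := h.exists_dual s hs
    have h1 := h.coframe_u hB hB0 hs (x .u)
    rw [hx, FrameIndex.sum_eq, hl, hn] at h1
    simp only [if_true] at h1
    have : (1 : ℝ) = 0 := by linear_combination h1 + E 0 .u (x .u) * h0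
    exact one_ne_zero this
  have hcont : ContinuousOn (fun s => 1 - A 0 .u .u * B s) J := fun s hs =>
    (continuousAt_const.sub ((hB s hs).continuousAt.const_mul _)).continuousWithinAt
  by_contra hcon
  have hmem : (0 : ℝ) ∈ (fun s => 1 - A 0 .u .u * B s) '' J :=
    h.ordConnected.isPreconnected.intermediate_value ht h.zero_mem hcont
      ⟨not_lt.1 hcon, by simp [hB0]⟩
  obtain ⟨s, hs, h0⟩ := hmem
  exact hne s hs h0

variable {Q P : Matrix (Fin 2) (Fin 2) ℝ} {κ₁ κ₂ : ℝ} {g₁ g₂ : ℝ → ℝ}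

/-- The matrix `Θ` at time `t` is not known in advance. Computing the same bracket with the coframes
at times `0` and `t` expresses it through the initial `θ`, and the evolution becomes linear. The
functions `g₁`, `g₂` are left abstract so that powers and exponentials can both be inserted. -/
theorem coframe_quasidiagonal (h : InvariantEvolution J b A E br)
    (hB : ∀ t ∈ J, HasDerivAt B (b t) t)
    (hB0 : B 0 = 0) (hl : A 0 .u .l = 0) (hn : A 0 .u .n = 0)
    (hQ : Q ∈ Matrix.orthogonalGroup (Fin 2) ℝ)
    (hθ : !![A 0 .l .l, A 0 .l .n; A 0 .l .n, A 0 .n .n] =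
      Q * Matrix.diagonal ![κ₁, κ₂] * Q.transpose)
    (hg₁ : ∀ t ∈ J, HasDerivAt g₁ (-(b t / (1 - A 0 .u .u * B t) * κ₁ * g₁ t)) t)
    (hg₂ : ∀ t ∈ J, HasDerivAt g₂ (-(b t / (1 - A 0 .u .u * B t) * κ₂ * g₂ t)) t)
    (hg₁0 : g₁ 0 = 1) (hg₂0 : g₂ 0 = 1) (hg₁n : ∀ t ∈ J, g₁ t ≠ 0) (hg₂n : ∀ t ∈ J, g₂ t ≠ 0)
    {t : ℝ} (ht : t ∈ J) (hP : P = Q * Matrix.diagonal ![g₁ t, g₂ t] * Q.transpose) (v : V) :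
    E t .u v = (1 - A 0 .u .u * B t) * E 0 .u v ∧
    E t .l v = P 0 0 * E 0 .l v + P 0 1 * E 0 .n v ∧
    E t .n v = P 1 0 * E 0 .l v + P 1 1 * E 0 .n v := by
  obtain ⟨x, hx⟩ := h.exists_dual 0 h.zero_mem
  have hu : ∀ s ∈ J, ∀ w, E s .u w = (1 - A 0 .u .u * B s) * E 0 .u w := by
    intro s hs w
    rw [h.coframe_u hB hB0 hs w, FrameIndex.sum_eq, hl, hn]
    ring
  have hexp : ∀ w : V, w = E 0 .u w • x .u + (E 0 .l w • x .l + E 0 .n w • x .n) := by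
    intro w
    rw [← sub_eq_zero]
    refine h.eq_zero 0 h.zero_mem _ fun a => ?_
    cases a <;> simp [hx]
  have hlu : A 0 .l .u = 0 := by rw [h.symm, hl]
  have hnu : A 0 .n .u = 0 := by rw [h.symm, hn]
  -- the brackets with the first dual vector
  have hbrl : br (x .u) (x .l) = A 0 .l .l • x .l + A 0 .l .n • x .n := by
    conv_lhs => rw [hexp (br (x .u) (x .l))]
    simp [h.bracket 0 h.zero_mem, hx, hl, h.symm 0 .n .l]
  have hbrn : br (x .u) (x .n) = A 0 .l .n • x .l + A 0 .n .n • x .n := by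
    conv_lhs => rw [hexp (br (x .u) (x .n))]
    simp [h.bracket 0 h.zero_mem, hx, hn]
  have hq : ∀ s ∈ J, 1 - A 0 .u .u * B s ≠ 0 := fun s hs => (h.one_sub_pos hB hB0 hl hn hs).ne'
  -- Apply `e_i^s` to the time-independent bracket `[x_u, x_l]`, known from time `0`.
  have hrel_l : ∀ s ∈ J, ∀ i,
      (1 - A 0 .u .u * B s) * (A s i .l * E s .l (x .l) + A s i .n * E s .n (x .l)) =
        A 0 .l .l * E s i (x .l) + A 0 .l .n * E s i (x .n) := by
    intro s hs i
    have h1 := h.bracket s hs i (x .u) (x .l)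
    rw [hbrl] at h1
    simp only [map_add, map_smul, smul_eq_mul, FrameIndex.sum_eq, hu s hs, hx] at h1
    simp at h1
    linear_combination -h1
  have hrel_n : ∀ s ∈ J, ∀ i,
      (1 - A 0 .u .u * B s) * (A s i .l * E s .l (x .n) + A s i .n * E s .n (x .n)) =
        A 0 .l .n * E s i (x .l) + A 0 .n .n * E s i (x .n) := by
    intro s hs i
    have h1 := h.bracket s hs i (x .u) (x .n)
    rw [hbrn] at h1
    simp only [map_add, map_smul, smul_eq_mul, FrameIndex.sum_eq, hu s hs, hx] at h1
    simp at h1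
    linear_combination -h1
  have hd_l : ∀ i, ∀ s ∈ J, HasDerivAt (fun s => E s i (x .l))
      (-(b s / (1 - A 0 .u .u * B s) *
        (A 0 .l .l * E s i (x .l) + A 0 .l .n * E s i (x .n)))) s := by
    intro i s hs
    refine (h.hasDerivAt s hs i (x .l)).congr_deriv ?_
    rw [← hrel_l s hs i, FrameIndex.sum_eq, hu s hs, hx]
    have := hq s hs
    simp
    field_simp
  have hd_n : ∀ i, ∀ s ∈ J, HasDerivAt (fun s => E s i (x .n))
      (-(b s / (1 - A 0 .u .u * B s) *
        (A 0 .l .n * E s i (x .l) + A 0 .n .n * E s i (x .n)))) s := by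
    intro i s hs
    refine (h.hasDerivAt s hs i (x .n)).congr_deriv ?_
    rw [← hrel_n s hs i, FrameIndex.sum_eq, hu s hs, hx]
    have := hq s hs
    simp
    field_simp
  have hU : ∀ s ∈ J, !![E s .l (x .l), E s .n (x .l); E s .l (x .n), E s .n (x .n)] =
      Q * Matrix.diagonal ![g₁ s, g₂ s] * Q.transpose := by
    intro s hs
    have sl := solve_symmetric_system h.ordConnected h.zero_mem hQ hθ hg₁ hg₂ hg₁0 hg₂0 hg₁n hg₂n
      (hd_l .l) (hd_n .l) hs rfl
    have sn := solve_symmetric_system h.ordConnected h.zero_mem hQ hθ hg₁ hg₂ hg₁0 hg₂0 hg₁n hg₂n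
      (hd_l .n) (hd_n .n) hs rfl
    simp [hx] at sl sn
    ext i j
    fin_cases i <;> fin_cases j <;> simp [sl, sn]
  -- the transverse part of the shape operator at time `s` is a multiple of the initial one
  have hshape : ∀ s ∈ J, (1 - A 0 .u .u * B s) •
      !![A s .l .l, A s .l .n; A s .n .l, A s .n .n] =
        !![A 0 .l .l, A 0 .l .n; A 0 .l .n, A 0 .n .n] := by
    intro s hs
    have hsymm : !![E s .l (x .l), E s .n (x .l); E s .l (x .n), E s .n (x .n)] =
        !![E s .l (x .l), E s .l (x .n); E s .n (x .l), E s .n (x .n)] := by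
      have h01 := congrFun (congrFun (hU s hs) 0) 1
      have h10 := congrFun (congrFun (hU s hs) 1) 0
      rw [conj_diagonal_apply] at h01 h10
      have : E s .n (x .l) = E s .l (x .n) := by
        simp at h01 h10
        linear_combination h01 - h10
      rw [this]
    -- The bracket relations read `(1 - Θ_uu B) Θ_s P = P θ`. The solution `P` is diagonal in the
    -- eigenbasis of `θ`, so it commutes with `θ`; it is then cancelled.
    have hcomm : ((1 - A 0 .u .u * B s) • !![A s .l .l, A s .l .n; A s .n .l, A s .n .n]) *
        (Q * Matrix.diagonal ![g₁ s, g₂ s] * Q.transpose) =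
        !![A 0 .l .l, A 0 .l .n; A 0 .l .n, A 0 .n .n] *
          (Q * Matrix.diagonal ![g₁ s, g₂ s] * Q.transpose) := by
      have hc : !![A 0 .l .l, A 0 .l .n; A 0 .l .n, A 0 .n .n] *
          (Q * Matrix.diagonal ![g₁ s, g₂ s] * Q.transpose) =
          (Q * Matrix.diagonal ![g₁ s, g₂ s] * Q.transpose) *
            !![A 0 .l .l, A 0 .l .n; A 0 .l .n, A 0 .n .n] := by
        rw [hθ, conj_diagonal_mul hQ, conj_diagonal_mul hQ, mul_comm κ₁, mul_comm κ₂]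
      rw [hc, ← hU s hs, hsymm]
      have r1 := hrel_l s hs .l
      have r2 := hrel_l s hs .n
      have r3 := hrel_n s hs .l
      have r4 := hrel_n s hs .n
      ext i j
      fin_cases i <;> fin_cases j <;> simp [Matrix.mul_apply, Fin.sum_univ_two]
      · linear_combination r1
      · linear_combination r3
      · linear_combination r2
      · linear_combination r4
    have hinv : (Q * Matrix.diagonal ![g₁ s, g₂ s] * Q.transpose) *
        (Q * Matrix.diagonal ![(g₁ s)⁻¹, (g₂ s)⁻¹] * Q.transpose) = 1 := by
      have h1 : Matrix.diagonal ![(1 : ℝ), 1] = 1 := by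
        ext i j
        fin_cases i <;> fin_cases j <;> simp
      rw [conj_diagonal_mul hQ, mul_inv_cancel₀ (hg₁n s hs), mul_inv_cancel₀ (hg₂n s hs), h1,
        Matrix.mul_one, orthogonal_mul_transpose hQ]
    calc _ = ((1 - A 0 .u .u * B s) • !![A s .l .l, A s .l .n; A s .n .l, A s .n .n]) *
          ((Q * Matrix.diagonal ![g₁ s, g₂ s] * Q.transpose) *
            (Q * Matrix.diagonal ![(g₁ s)⁻¹, (g₂ s)⁻¹] * Q.transpose)) := by
          rw [hinv, Matrix.mul_one]
      _ = _ := by rw [← Matrix.mul_assoc, hcomm, Matrix.mul_assoc, hinv, Matrix.mul_one]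
  -- No `e_u` component appears: the values on `x_u` solve the same homogeneous system with zero
  -- initial data.
  have hzero : E t .l (x .u) = 0 ∧ E t .n (x .u) = 0 := by
    have dl : ∀ s ∈ J, HasDerivAt (fun s => E s .l (x .u)) (-(b s / (1 - A 0 .u .u * B s) *
        (A 0 .l .l * E s .l (x .u) + A 0 .l .n * E s .n (x .u)))) s := by
      intro s hs
      refine (h.hasDerivAt s hs .l (x .u)).congr_deriv ?_
      have h0 := congrFun (congrFun (hshape s hs) 0) 0
      have h1 := congrFun (congrFun (hshape s hs) 0) 1
      simp at h0 h1
      rw [FrameIndex.sum_eq, h.symm s .l .u, h.shape_ul hs, hl, ← h0, ← h1]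
      have := hq s hs
      field_simp
      ring
    have dn : ∀ s ∈ J, HasDerivAt (fun s => E s .n (x .u)) (-(b s / (1 - A 0 .u .u * B s) *
        (A 0 .l .n * E s .l (x .u) + A 0 .n .n * E s .n (x .u)))) s := by
      intro s hs
      refine (h.hasDerivAt s hs .n (x .u)).congr_deriv ?_
      have h0 := congrFun (congrFun (hshape s hs) 1) 0
      have h1 := congrFun (congrFun (hshape s hs) 1) 1
      simp at h0 h1
      rw [FrameIndex.sum_eq, h.symm s .n .u, h.shape_un hs, hn, ← h0, ← h1]
      have := hq s hs
      field_simp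
      ring
    have := solve_symmetric_system h.ordConnected h.zero_mem hQ hθ hg₁ hg₂ hg₁0 hg₂0 hg₁n hg₂n
      dl dn ht rfl
    simpa [hx] using this
  have hUt := hU t ht
  have hPsymm : P 0 1 = P 1 0 := by
    rw [hP, conj_diagonal_apply, conj_diagonal_apply]
    ring
  rw [← hP] at hUt
  have h00 : P 0 0 = E t .l (x .l) := by rw [← hUt]; rfl
  have h01 : P 0 1 = E t .n (x .l) := by rw [← hUt]; rfl
  have h10 : P 1 0 = E t .l (x .n) := by rw [← hUt]; rfl
  have h11 : P 1 1 = E t .n (x .n) := by rw [← hUt]; rfl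
  refine ⟨hu t ht v, ?_, ?_⟩
  · conv_lhs => rw [hexp v]
    simp only [map_add, map_smul, smul_eq_mul, hzero.1, h00, hPsymm, h10]
    ring
  · conv_lhs => rw [hexp v]
    simp only [map_add, map_smul, smul_eq_mul, hzero.2, h11, ← hPsymm, h01]
    ring

end Quasidiagonal

end InvariantEvolution

/-- The orthogonal diagonalization of a symmetric two by two matrix. -/
theorem exists_orthogonal_diagonalization (θ : Matrix (Fin 2) (Fin 2) ℝ) (hθ : θ 1 0 = θ 0 1) :
    ∃ Q ∈ Matrix.orthogonalGroup (Fin 2) ℝ,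
      θ = Q * Matrix.diagonal ![(θ.trace + √(θ.trace ^ 2 - 4 * θ.det)) / 2,
        (θ.trace - √(θ.trace ^ 2 - 4 * θ.det)) / 2] * Q.transpose := by
  -- The modulus of `z` is the root of the discriminant, and half its argument is the angle of the
  -- rotation that diagonalizes `θ`.
  set z : ℂ := ⟨θ 0 0 - θ 1 1, 2 * θ 0 1⟩ with hz
  have hD : √(θ.trace ^ 2 - 4 * θ.det) = ‖z‖ := by
    rw [Complex.norm_def, Complex.normSq_apply, Matrix.trace_fin_two, Matrix.det_fin_two, hθ]
    congr 1
    simp only [hz]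
    ring
  have hc : ‖z‖ * Real.cos z.arg = θ 0 0 - θ 1 1 := Complex.norm_mul_cos_arg z
  have hs : ‖z‖ * Real.sin z.arg = 2 * θ 0 1 := Complex.norm_mul_sin_arg z
  set φ := z.arg / 2 with hφ
  have hφ2 : z.arg = 2 * φ := by rw [hφ]; ring
  rw [hφ2, Real.cos_two_mul] at hc
  rw [hφ2, Real.sin_two_mul] at hs
  have hcs := Real.sin_sq_add_cos_sq φ
  refine ⟨!![Real.cos φ, -Real.sin φ; Real.sin φ, Real.cos φ], ?_, ?_⟩
  · rw [Matrix.mem_orthogonalGroup_iff]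
    ext i j
    fin_cases i <;> fin_cases j <;> simp [Matrix.mul_apply, Fin.sum_univ_two]
    · linear_combination hcs
    · ring
    · ring
    · linear_combination hcs
  · rw [hD]
    have ht := Matrix.trace_fin_two θ
    ext i j
    rw [conj_diagonal_apply]
    fin_cases i <;> fin_cases j <;> simp
    · linear_combination (-(1 / 2) * (θ.trace - ‖z‖)) * hcs - hc / 2 - ht / 2
    · linear_combination -hs / 2
    · linear_combination hθ - hs / 2
    · linear_combination (-(1 / 2) * (θ.trace + ‖z‖)) * hcs + hc / 2 - ht / 2

theorem discriminant_nonneg (θ : Matrix (Fin 2) (Fin 2) ℝ) (hθ : θ 1 0 = θ 0 1) :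
    0 ≤ θ.trace ^ 2 - 4 * θ.det := by
  rw [Matrix.trace_fin_two, Matrix.det_fin_two, hθ]
  nlinarith [sq_nonneg (θ 0 0 - θ 1 1), sq_nonneg (θ 0 1)]

section Forms

variable {M : Type*} [TopologicalSpace M] [ChartedSpace (EuclideanSpace ℝ (Fin 3)) M]
  [IsManifold (𝓡 3) ∞ M]

theorem IsSmoothForm.combination {ε : FrameIndex → OneForm M} (hε : ∀ a, IsSmoothForm (ε a))
    (c : FrameIndex → ℝ) : IsSmoothForm (∑ a, c a • ε a) := by
  rw [FrameIndex.sum_eq]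
  exact ((hε _).const_smul _).add (((hε _).const_smul _).add ((hε _).const_smul _))

theorem IsExtDeriv.combination {ε : FrameIndex → OneForm M} {η : FrameIndex → TwoTensor M}
    (h : ∀ a, IsExtDeriv (ε a) (η a)) (hε : ∀ a, IsSmoothForm (ε a)) (c : FrameIndex → ℝ) :
    IsExtDeriv (∑ a, c a • ε a) (∑ a, c a • η a) := by
  simp only [FrameIndex.sum_eq]
  exact ((h _).const_smul (hε _) _).add (((h _).const_smul (hε _) _).add
    ((h _).const_smul (hε _) _) ((hε _).const_smul _) ((hε _).const_smul _))
    ((hε _).const_smul _) (((hε _).const_smul _).add ((hε _).const_smul _))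

theorem combination_apply {M : Type*} [TopologicalSpace M]
    [ChartedSpace (EuclideanSpace ℝ (Fin 3)) M] (ε : FrameIndex → OneForm M) (c : FrameIndex → ℝ)
    (p : M) (v : TangentSpace (𝓡 3) p) : (∑ a, c a • ε a) p v = ∑ a, c a * ε a p v := by
  simp only [FrameIndex.sum_eq]
  rfl

theorem tensor_combination_apply {M : Type*} [TopologicalSpace M]
    [ChartedSpace (EuclideanSpace ℝ (Fin 3)) M] (η : FrameIndex → TwoTensor M)
    (c : FrameIndex → ℝ) (p : M) (v w : TangentSpace (𝓡 3) p) :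
    (∑ a, c a • η a) p v w = ∑ a, c a * η a p v w := by
  simp only [FrameIndex.sum_eq]
  rfl

theorem wedge_apply {M : Type*} [TopologicalSpace M]
    [ChartedSpace (EuclideanSpace ℝ (Fin 3)) M] (α γ : OneForm M) (p : M)
    (v w : TangentSpace (𝓡 3) p) : wedge α γ p v w = α p v * γ p w - γ p v * α p w :=
  rfl

theorem smul_form_apply {M : Type*} [TopologicalSpace M]
    [ChartedSpace (EuclideanSpace ℝ (Fin 3)) M] (c : ℝ) (α : OneForm M) (p : M)
    (v : TangentSpace (𝓡 3) p) : (c • α) p v = c * α p v :=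
  rfl

theorem smul_tensor_apply {M : Type*} [TopologicalSpace M]
    [ChartedSpace (EuclideanSpace ℝ (Fin 3)) M] (c : ℝ) (η : TwoTensor M) (p : M)
    (v w : TangentSpace (𝓡 3) p) : (c • η) p v w = c * η p v w :=
  rfl

end Forms

/-! ### Which group carries the flow. -/

section Geometry

variable {G : Type*} [TopologicalSpace G] [ChartedSpace (EuclideanSpace ℝ (Fin 3)) G] [Group G]

theorem IsLeftInvariantForm.combination {ε : FrameIndex → OneForm G}
    (hε : ∀ a, IsLeftInvariantForm (ε a)) (c : FrameIndex → ℝ) :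
    IsLeftInvariantForm (∑ a, c a • ε a) := by
  rw [FrameIndex.sum_eq]
  exact ((hε _).const_smul _).add (((hε _).const_smul _).add ((hε _).const_smul _))

/-- `ℝ ⋉ ℝ²` with the trivial action is `ℝ³`. -/
theorem isIsoR3_of_isIsoTo (h : IsIsoTo G (SemidirectLine 0 0)) : IsIsoR3 G := by
  obtain ⟨φ, hφ⟩ := h
  let L : (ℝ × ℝ × ℝ) ≃L[ℝ] EuclideanSpace ℝ (Fin 3) :=
    ContinuousLinearEquiv.ofFinrankEq (by simp)
  let ψ : Diffeomorph 𝓘(ℝ, ℝ × ℝ × ℝ) (𝓡 3) (SemidirectLine 0 0) (EuclideanSpace ℝ (Fin 3)) ∞ :=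
    L.toDiffeomorph
  refine ⟨φ.trans ψ, fun g h => ?_⟩
  have h1 : ∀ x y : SemidirectLine 0 0, L (x * y) = L x + L y := by
    intro x y
    have hadd : ∀ x y : ℝ × ℝ × ℝ, L (x.1 + y.1, x.2.1 + Real.exp (0 * x.1) * y.2.1,
        x.2.2 + Real.exp (0 * x.1) * y.2.2) = L x + L y := by
      intro x y
      simp only [zero_mul, Real.exp_zero, one_mul]
      exact map_add L x y
    exact hadd x y
  exact (congrArg L (hφ g h)).trans (h1 _ _)

variable [LieGroup (𝓡 3) ∞ G] {J : Set ℝ} {β : ℝ → G → ℝ} {e : ℝ → FrameIndex → OneForm G}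

namespace IsLeftInvariantFlow

variable [SimplyConnectedSpace G]

/-- Here `e_u` is closed, and an eigenform `ε` of `θ` satisfies `dε = κ ε ∧ e_u`. Replacing `e_u` by
`c e_u` divides the eigenvalues by `c`; `c` and the order `i, j` serve to normalize the weights. -/
theorem isIsoTo_of_quasidiagonal (h : IsLeftInvariantFlow J β e)
    {Θ : Matrix FrameIndex FrameIndex ℝ} (hΘ : Θ = shapeComponents β e 0 1)
    (hl : Θ .u .l = 0) (hn : Θ .u .n = 0) {Q : Matrix (Fin 2) (Fin 2) ℝ}
    (hQ : Q ∈ Matrix.orthogonalGroup (Fin 2) ℝ) {κ : Fin 2 → ℝ}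
    (hθ : !![Θ .l .l, Θ .l .n; Θ .l .n, Θ .n .n] = Q * Matrix.diagonal κ * Q.transpose)
    {i j : Fin 2} (hij : i ≠ j) {c : ℝ} (hc : c ≠ 0) {a b : ℝ} (ha : a = κ i / c)
    (hb : b = κ j / c) : IsIsoTo G (SemidirectLine a b) := by
  subst ha hb
  have h0 := h.flow.zero_mem
  have hsymm : ∀ a c, Θ a c = Θ c a := by
    rw [hΘ]
    exact shapeComponents_symm β e 0 1
  have hsm := fun a => h.isSmoothForm h0 a
  have hinv := h.coframe_invariant 0 h0
  have hext := h.flow.structure_eq 0 h0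
  have hsh : ∀ a p v, shapeOn β e 0 a p v = ∑ c, Θ a c * e 0 c p v := by
    intro a p v
    rw [h.shapeOn_eq h0, ← hΘ, combination_apply]
  have hlu : Θ .l .u = 0 := by rw [hsymm, hl]
  have hnu : Θ .n .u = 0 := by rw [hsymm, hn]
  -- the columns of `Q` are eigenvectors
  have hθQ : !![Θ .l .l, Θ .l .n; Θ .l .n, Θ .n .n] * Q = Q * Matrix.diagonal κ := by
    rw [hθ, Matrix.mul_assoc, orthogonal_transpose_mul hQ, Matrix.mul_one]
  have e0 : ∀ k, Θ .l .l * Q 0 k + Θ .l .n * Q 1 k = κ k * Q 0 k := by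
    intro k
    have := congrFun (congrFun hθQ 0) k
    rw [Matrix.mul_diagonal] at this
    simpa [Matrix.mul_apply, Fin.sum_univ_two, mul_comm (κ k)] using this
  have e1 : ∀ k, Θ .l .n * Q 0 k + Θ .n .n * Q 1 k = κ k * Q 1 k := by
    intro k
    have := congrFun (congrFun hθQ 1) k
    rw [Matrix.mul_diagonal] at this
    simpa [Matrix.mul_apply, Fin.sum_univ_two, mul_comm (κ k)] using this
  let co : Fin 2 → FrameIndex → ℝ := fun k a => match a with
    | .u => 0
    | .l => Q 0 k
    | .n => Q 1 k
  have hd : ∀ k, IsExtDeriv (∑ a, co k a • e 0 a)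
      ((κ k / c) • wedge (∑ a, co k a • e 0 a) (c • e 0 .u)) := by
    intro k
    convert IsExtDeriv.combination hext hsm (co k) using 1
    funext p v w
    rw [tensor_combination_apply]
    simp only [smul_tensor_apply, wedge_apply, smul_form_apply, combination_apply, hsh]
    simp only [FrameIndex.sum_eq, co, hlu, hnu, hsymm .n .l]
    field_simp
    linear_combination (-(e 0 .l p v * e 0 .u p w) + e 0 .l p w * e 0 .u p v) * e0 k +
      (-(e 0 .n p v * e 0 .u p w) + e 0 .n p w * e 0 .u p v) * e1 k
  refine isIsoTo_semidirectLine (α := c • e 0 .u) (α₁ := ∑ a, co i a • e 0 a)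
    (α₂ := ∑ a, co j a • e 0 a) ((hinv _).const_smul c) (.combination hinv _)
    (.combination hinv _) ((hsm _).const_smul c) (.combination hsm _) (.combination hsm _)
    ?_ ?_ (hd i) (hd j)
  · intro v hv hvi hvj
    have hv' : c * e 0 .u 1 v = 0 := hv
    have hu : e 0 .u 1 v = 0 := (mul_eq_zero.1 hv').resolve_left hc
    have hk : ∀ k, Q 0 k * e 0 .l 1 v + Q 1 k * e 0 .n 1 v = 0 := by
      have hk' : ∀ k, (∑ a, co k a • e 0 a) 1 v = 0 →
          Q 0 k * e 0 .l 1 v + Q 1 k * e 0 .n 1 v = 0 := by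
        intro k hk
        rw [combination_apply, FrameIndex.sum_eq] at hk
        simpa [co] using hk
      intro k
      rcases (by omega : k = i ∨ k = j) with rfl | rfl
      exacts [hk' _ hvi, hk' _ hvj]
    have hQ1 := orthogonal_mul_transpose hQ
    have o00 : Q 0 0 * Q 0 0 + Q 0 1 * Q 0 1 = 1 := by
      simpa [Matrix.mul_apply, Fin.sum_univ_two] using congrFun (congrFun hQ1 0) 0
    have o01 : Q 0 0 * Q 1 0 + Q 0 1 * Q 1 1 = 0 := by
      simpa [Matrix.mul_apply, Fin.sum_univ_two] using congrFun (congrFun hQ1 0) 1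
    have o11 : Q 1 0 * Q 1 0 + Q 1 1 * Q 1 1 = 1 := by
      simpa [Matrix.mul_apply, Fin.sum_univ_two] using congrFun (congrFun hQ1 1) 1
    refine h.coframe_eq_zero h0 fun a => ?_
    cases a
    · exact hu
    · linear_combination Q 0 0 * hk 0 + Q 0 1 * hk 1 - e 0 .l 1 v * o00 - e 0 .n 1 v * o01
    · linear_combination Q 1 0 * hk 0 + Q 1 1 * hk 1 - e 0 .l 1 v * o01 - e 0 .n 1 v * o11
  · convert (hext .u).const_smul (hsm .u) c using 1
    funext p v w
    simp only [Pi.zero_apply, Pi.smul_apply, wedge, tensorProd, Pi.sub_apply, hsh, smul_eq_mul,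
      FrameIndex.sum_eq, hl, hn]
    ring

/-- The coframe `-w, e_u, k` has `dw = 0`, `de_u = e_u ∧ (-w)` and `dk = 0`, so the weights are `1`
and `0`. -/
theorem isIsoTo_of_rotating (h : IsLeftInvariantFlow J β e)
    {Θ : Matrix FrameIndex FrameIndex ℝ} (hΘ : Θ = shapeComponents β e 0 1)
    (hlam : Θ .u .l ^ 2 + Θ .u .n ^ 2 ≠ 0) : IsIsoTo G Tau2R := by
  have h0 := h.flow.zero_mem
  have hsm := fun a => h.isSmoothForm h0 a
  have hinv := h.coframe_invariant 0 h0
  have hext := h.flow.structure_eq 0 h0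
  have hsymm : ∀ a c, Θ a c = Θ c a := by
    rw [hΘ]
    exact shapeComponents_symm β e 0 1
  have hsh : ∀ a p v, shapeOn β e 0 a p v = ∑ c, Θ a c * e 0 c p v := by
    intro a p v
    rw [h.shapeOn_eq h0, ← hΘ, combination_apply]
  have hw : shapeOn β e 0 .u = ∑ c, Θ .u c • e 0 c := by rw [h.shapeOn_eq h0, ← hΘ]
  have hws : IsSmoothForm (shapeOn β e 0 .u) := by
    rw [hw]
    exact .combination hsm _
  let co : FrameIndex → ℝ := fun a => match a with
    | .u => 0
    | .l => -Θ .u .n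
    | .n => Θ .u .l
  have jac := h.invariantEvolution.jacobi 0 h0
  simp only [← hΘ] at jac
  refine isIsoTo_semidirectLine (α := (-1 : ℝ) • shapeOn β e 0 .u) (α₁ := e 0 .u)
    (α₂ := ∑ a, co a • e 0 a) ((h.shapeOn_leftInvariant h0 .u).const_smul _) (hinv _)
    (.combination hinv _) (hws.const_smul _) (hsm _) (.combination hsm _) ?_ ?_ ?_ ?_
  · intro v hv hu hk
    have hv' : (-1 : ℝ) * shapeOn β e 0 .u 1 v = 0 := hv
    rw [hsh, FrameIndex.sum_eq] at hv'
    rw [combination_apply, FrameIndex.sum_eq] at hk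
    simp only [co, hu] at hv' hk
    refine h.coframe_eq_zero h0 fun a => ?_
    cases a
    · exact hu
    · refine mul_left_cancel₀ hlam ?_
      linear_combination -(Θ .u .l) * hv' - (Θ .u .n) * hk
    · refine mul_left_cancel₀ hlam ?_
      linear_combination -(Θ .u .n) * hv' + (Θ .u .l) * hk
  · convert ((h.flow.cohomology 0 h0).1).const_smul hws (-1) using 1
    simp
  · convert hext .u using 1
    funext p v w
    simp only [smul_tensor_apply, wedge_apply, smul_form_apply]
    ring
  · convert IsExtDeriv.combination hext hsm co using 1
    funext p v w
    rw [tensor_combination_apply]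
    simp only [smul_tensor_apply, wedge_apply, combination_apply, hsh]
    have j1 := jac .l
    have j2 := jac .n
    rw [hsymm .n .l] at j2
    simp only [FrameIndex.sum_eq, co, hsymm .n .l, hsymm .l .u, hsymm .n .u]
    linear_combination (e 0 .l p v * e 0 .u p w - e 0 .l p w * e 0 .u p v) * j1 +
      (e 0 .n p v * e 0 .u p w - e 0 .n p w * e 0 .u p v) * j2

end IsLeftInvariantFlow

end Geometry

theorem sec_sq_eq {y : ℝ} (hy : Real.cos y ≠ 0) : (1 / Real.cos y) ^ 2 = 1 + Real.tan y ^ 2 := by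
  rw [Real.tan_eq_sin_div_cos]
  field_simp
  linear_combination -Real.sin_sq_add_cos_sq y

theorem sec_sq_mul_sin_two_mul {y : ℝ} (hy : Real.cos y ≠ 0) :
    (1 / Real.cos y) ^ 2 * Real.sin (2 * y) = 2 * Real.tan y := by
  rw [Real.tan_eq_sin_div_cos, Real.sin_two_mul]
  field_simp

theorem hasDerivAt_primitive {J : Set ℝ} (hJ : IsOpen J) (hJc : J.OrdConnected)
    (h0 : (0 : ℝ) ∈ J) {b : ℝ → ℝ} (hb : ContinuousOn b J) {t : ℝ} (ht : t ∈ J) :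
    HasDerivAt (fun t => ∫ τ in (0 : ℝ)..t, b τ) (b t) t :=
  intervalIntegral.integral_hasDerivAt_right
    (hb.mono (hJc.uIcc_subset h0 ht)).intervalIntegrable
    (hb.stronglyMeasurableAtFilter hJ t ht) (hb.continuousAt (hJ.mem_nhds ht))

/-! ### The metric of the flow in terms of the initial coframe. -/

section Geometry

variable {G : Type*} [TopologicalSpace G] [ChartedSpace (EuclideanSpace ℝ (Fin 3)) G] [Group G]
  [LieGroup (𝓡 3) ∞ G] {J : Set ℝ} {β : ℝ → G → ℝ} {e : ℝ → FrameIndex → OneForm G}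

namespace IsLeftInvariantFlow

theorem hasDerivAt_lapseIntegral (h : IsLeftInvariantFlow J β e) {B : ℝ → ℝ}
    (hB : ∀ t, B t = lapseIntegral β t) {t : ℝ} (ht : t ∈ J) : HasDerivAt B (β t 1) t := by
  rw [show B = lapseIntegral β from funext hB]
  exact hasDerivAt_primitive h.flow.isOpen h.flow.ordConnected h.flow.zero_mem
    h.contDiffOn_lapse.continuousOn ht

/-- A linear relation between left-invariant coframes holds everywhere if it does so at the
identity. -/
theorem coframe_apply_of_one (h : IsLeftInvariantFlow J β e) {t : ℝ} (ht : t ∈ J)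
    {a : FrameIndex} {U : FrameIndex → ℝ} (hU : ∀ v, e t a 1 v = ∑ c, U c * e 0 c 1 v) (p : G)
    (v : TangentSpace (𝓡 3) p) : e t a p v = ∑ c, U c * e 0 c p v := by
  rw [(h.coframe_invariant t ht a).ext
    (.combination (h.coframe_invariant 0 h.flow.zero_mem) U) fun v => ?_, combination_apply]
  rw [hU, combination_apply]

section Quasidiagonal

variable {B : ℝ → ℝ} {Θ : Matrix FrameIndex FrameIndex ℝ} {Q : Matrix (Fin 2) (Fin 2) ℝ}
  {κ₁ κ₂ : ℝ} {g₁ g₂ : ℝ → ℝ}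

theorem one_sub_pos (h : IsLeftInvariantFlow J β e) (hB : ∀ t, B t = lapseIntegral β t)
    (hΘ : Θ = shapeComponents β e 0 1) (hl : Θ .u .l = 0) (hn : Θ .u .n = 0) {t : ℝ}
    (ht : t ∈ J) : 0 < 1 - Θ .u .u * B t := by
  subst hΘ
  exact h.invariantEvolution.one_sub_pos (fun t ht => h.hasDerivAt_lapseIntegral hB ht)
    (by simp [hB, lapseIntegral]) hl hn ht

theorem coframeMetric_quasidiagonal (h : IsLeftInvariantFlow J β e)
    (hB : ∀ t, B t = lapseIntegral β t)
    (hΘ : Θ = shapeComponents β e 0 1) (hl : Θ .u .l = 0) (hn : Θ .u .n = 0)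
    (hQ : Q ∈ Matrix.orthogonalGroup (Fin 2) ℝ)
    (hθ : !![Θ .l .l, Θ .l .n; Θ .l .n, Θ .n .n] = Q * Matrix.diagonal ![κ₁, κ₂] * Q.transpose)
    (hg₁ : ∀ t ∈ J, HasDerivAt g₁ (-(β t 1 / (1 - Θ .u .u * B t) * κ₁ * g₁ t)) t)
    (hg₂ : ∀ t ∈ J, HasDerivAt g₂ (-(β t 1 / (1 - Θ .u .u * B t) * κ₂ * g₂ t)) t)
    (hg₁0 : g₁ 0 = 1) (hg₂0 : g₂ 0 = 1) (hg₁n : ∀ t ∈ J, g₁ t ≠ 0) (hg₂n : ∀ t ∈ J, g₂ t ≠ 0)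
    {t : ℝ} (ht : t ∈ J) :
    coframeMetric (e t) = (1 - Θ .u .u * B t) ^ 2 • tensorProd (e 0 .u) (e 0 .u) +
      matrixTensor (Q * Matrix.diagonal ![g₁ t * g₁ t, g₂ t * g₂ t] * Q.transpose)
        (e 0 .l) (e 0 .n) := by
  subst hΘ
  set P := Q * Matrix.diagonal ![g₁ t, g₂ t] * Q.transpose with hP
  have hcof := h.invariantEvolution.coframe_quasidiagonal
    (fun t ht => h.hasDerivAt_lapseIntegral hB ht) (by simp [hB, lapseIntegral]) hl hn hQ hθ hg₁
    hg₂ hg₁0 hg₂0 hg₁n hg₂n ht hP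
  have hPsymm : P 0 1 = P 1 0 := by
    rw [hP, conj_diagonal_apply, conj_diagonal_apply]
    ring
  -- The transverse metric is `Pᵀ P = P²`, which accounts for the squares of `g₁`, `g₂`.
  rw [← conj_diagonal_mul hQ, ← hP]
  funext p v w
  have hu := h.coframe_apply_of_one ht (a := .u) (U := fun c => match c with
    | .u => 1 - shapeComponents β e 0 1 .u .u * B t | .l => 0 | .n => 0) (fun v => by
      simpa [FrameIndex.sum_eq] using (hcof v).1) p
  have hl := h.coframe_apply_of_one ht (a := .l) (U := fun c => match c with
    | .u => 0 | .l => P 0 0 | .n => P 0 1) (fun v => by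
      simpa [FrameIndex.sum_eq] using (hcof v).2.1) p
  have hn := h.coframe_apply_of_one ht (a := .n) (U := fun c => match c with
    | .u => 0 | .l => P 1 0 | .n => P 1 1) (fun v => by
      simpa [FrameIndex.sum_eq] using (hcof v).2.2) p
  simp only [FrameIndex.sum_eq] at hu hl hn
  rw [coframeMetric_apply, FrameIndex.sum_eq]
  simp only [hu, hl, hn, matrixTensor, tensorProd, Pi.add_apply, Pi.smul_apply, smul_eq_mul,
    Matrix.mul_apply, Fin.sum_univ_two, hPsymm]
  ring

end Quasidiagonal

section Rotating

variable {B : ℝ → ℝ} {Θ : Matrix FrameIndex FrameIndex ℝ} {lam : ℝ}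

/-- The angle is `arctan (Θ_uu / λ)` at time `t`, so it cannot leave the range of `arctan` while the
flow exists. -/
theorem abs_angle_lt (h : IsLeftInvariantFlow J β e) (hB : ∀ t, B t = lapseIntegral β t)
    (hΘ : Θ = shapeComponents β e 0 1) (hlam : 0 < lam)
    (hlam2 : lam ^ 2 = Θ .u .l ^ 2 + Θ .u .n ^ 2) {t : ℝ} (ht : t ∈ J) :
    |lam * B t + Real.arctan (Θ .u .u / lam)| < Real.pi / 2 ∧
      shapeComponents β e t 1 .u .u =
        lam * Real.tan (lam * B t + Real.arctan (Θ .u .u / lam)) := by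
  subst hΘ
  have := h.invariantEvolution.arctan_shape_uu (fun t ht => h.hasDerivAt_lapseIntegral hB ht)
    (by simp [hB, lapseIntegral]) hlam hlam2 ht
  rw [← this, Real.tan_arctan, mul_div_cancel₀ _ hlam.ne']
  exact ⟨abs_lt.2 ⟨Real.neg_pi_div_two_lt_arctan _, Real.arctan_lt_pi_div_two _⟩, rfl⟩

/-- The common source of both formulas for `λ ≠ 0`: `h = U ⊗ U + λ⁻² (N ⊗ N + K ⊗ K)`, where `U =
e_u^t`, `N = w - Θ_uu U` with `Θ_uu` at time `t`, and `K` is the conserved form. -/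
theorem coframeMetric_rotating (h : IsLeftInvariantFlow J β e) (hB : ∀ t, B t = lapseIntegral β t)
    (hΘ : Θ = shapeComponents β e 0 1) (hlam : 0 < lam)
    (hlam2 : lam ^ 2 = Θ .u .l ^ 2 + Θ .u .n ^ 2) {t : ℝ} (ht : t ∈ J) {y : ℝ}
    (hy : y = lam * B t + Real.arctan (Θ .u .u / lam)) (p : G) (v w : TangentSpace (𝓡 3) p)
    {m : TangentSpace (𝓡 3) p → ℝ} {U : TangentSpace (𝓡 3) p → ℝ}
    (hm : ∀ v, m v = Θ .u .l * e 0 .l p v + Θ .u .n * e 0 .n p v)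
    (hU : ∀ v, U v = e 0 .u p v - B t * (Θ .u .u * e 0 .u p v + m v)) :
    coframeMetric (e t) p v w = U v * U w +
      (Θ .u .u * e 0 .u p v + m v - lam * Real.tan y * U v) *
        (Θ .u .u * e 0 .u p w + m w - lam * Real.tan y * U w) / lam ^ 2 +
      e 0 .l p v * e 0 .l p w + e 0 .n p v * e 0 .n p w - m v * m w / lam ^ 2 := by
  have ha := (h.abs_angle_lt hB hΘ hlam hlam2 ht).2
  subst hΘ
  rw [← hy] at ha
  set Θ := shapeComponents β e 0 1 with hΘ
  have hcu := h.invariantEvolution.coframe_u (fun t ht => h.hasDerivAt_lapseIntegral hB ht)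
    (by simp [hB, lapseIntegral]) ht
  have hcof := h.invariantEvolution.coframe_rotating hlam2 ht
  simp only [← hΘ, FrameIndex.sum_eq, ha] at hcu hcof
  have hl0 : lam ^ 2 ≠ 0 := by positivity
  have hu := h.coframe_apply_of_one ht (a := .u) (U := fun c => match c with
    | .u => 1 - B t * Θ .u .u | .l => - (B t * Θ .u .l) | .n => -(B t * Θ .u .n)) (fun v => by
      rw [FrameIndex.sum_eq]; refine (hcu v).trans ?_; simp; ring) p
  have hl := h.coframe_apply_of_one ht (a := .l) (U := fun c => match c with
    | .u => Θ .u .l * (Θ .u .u - lam * Real.tan y * (1 - B t * Θ .u .u)) / lam ^ 2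
    | .l => (Θ .u .l * (Θ .u .l + lam * Real.tan y * (B t * Θ .u .l)) + Θ .u .n ^ 2) / lam ^ 2
    | .n => (Θ .u .l * (lam * Real.tan y * (B t * Θ .u .n))) / lam ^ 2) (fun v => by
      have h1 := (hcof v).1
      rw [hcu v] at h1
      refine mul_left_cancel₀ hl0 (h1.trans ?_)
      rw [FrameIndex.sum_eq]
      simp
      field_simp
      ring) p
  have hn := h.coframe_apply_of_one ht (a := .n) (U := fun c => match c with
    | .u => Θ .u .n * (Θ .u .u - lam * Real.tan y * (1 - B t * Θ .u .u)) / lam ^ 2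
    | .l => (Θ .u .n * (lam * Real.tan y * (B t * Θ .u .l))) / lam ^ 2
    | .n => (Θ .u .n * (Θ .u .n + lam * Real.tan y * (B t * Θ .u .n)) + Θ .u .l ^ 2) / lam ^ 2)
    (fun v => by
      have h1 := (hcof v).2
      rw [hcu v] at h1
      refine mul_left_cancel₀ hl0 (h1.trans ?_)
      rw [FrameIndex.sum_eq]
      simp
      field_simp
      ring) p
  simp only [FrameIndex.sum_eq] at hu hl hn
  set K : TangentSpace (𝓡 3) p → ℝ := fun v => -(Θ .u .n * e 0 .l p v) + Θ .u .l * e 0 .n p v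
    with hK
  set N : TangentSpace (𝓡 3) p → ℝ := fun v =>
    Θ .u .u * e 0 .u p v + m v - lam * Real.tan y * U v with hN
  have hu' : ∀ v, e t .u p v = U v := by
    intro v
    rw [hu, hU, hm]
    ring
  have hl' : ∀ v, e t .l p v = (Θ .u .l * N v - Θ .u .n * K v) / lam ^ 2 := by
    intro v
    rw [hl, hN, hK]
    simp only [hU, hm]
    field_simp
    ring
  have hn' : ∀ v, e t .n p v = (Θ .u .n * N v + Θ .u .l * K v) / lam ^ 2 := by
    intro v
    rw [hn, hN, hK]
    simp only [hU, hm]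
    field_simp
    ring
  -- Lagrange's identity: `m` and `K` are orthogonal of length `λ` in the plane of `e_l`, `e_n`.
  have hkk : K v * K w = lam ^ 2 * (e 0 .l p v * e 0 .l p w + e 0 .n p v * e 0 .n p w) -
      m v * m w := by
    rw [hlam2, hm, hm]
    simp only [hK]
    ring
  have hsum : coframeMetric (e t) p v w = U v * U w + (N v * N w + K v * K w) / lam ^ 2 := by
    rw [coframeMetric_apply, FrameIndex.sum_eq]
    simp only [hu', hl', hn']
    field_simp
    linear_combination (-(N v * N w + K v * K w)) * hlam2
  rw [hsum, hkk]
  field_simp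
  ring

end Rotating

end IsLeftInvariantFlow

end Geometry

section Geometry

variable {G : Type*} [TopologicalSpace G] [ChartedSpace (EuclideanSpace ℝ (Fin 3)) G] [Group G]
  [LieGroup (𝓡 3) ∞ G] {J : Set ℝ} {β : ℝ → G → ℝ} {e : ℝ → FrameIndex → OneForm G}

namespace IsLeftInvariantFlow

variable {B : ℝ → ℝ} {Θ : Matrix FrameIndex FrameIndex ℝ} {Q θ : Matrix (Fin 2) (Fin 2) ℝ}

theorem coframeMetric_of_shape_uu_ne_zero (h : IsLeftInvariantFlow J β e)
    (hB : ∀ t, B t = lapseIntegral β t)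
    (hΘ : Θ = shapeComponents β e 0 1) (hl : Θ .u .l = 0) (hn : Θ .u .n = 0) (hu : Θ .u .u ≠ 0)
    (hθ : θ = !![Θ .l .l, Θ .l .n; Θ .l .n, Θ .n .n])
    (hQ : Q ∈ Matrix.orthogonalGroup (Fin 2) ℝ) {ρ₁ ρ₂ : ℝ}
    (hθQ : (Θ .u .u)⁻¹ • θ = Q * Matrix.diagonal ![ρ₁, ρ₂] * Q.transpose) {t : ℝ} (ht : t ∈ J) :
    coframeMetric (e t) = (1 - Θ .u .u * B t) ^ 2 • tensorProd (e 0 .u) (e 0 .u) +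
      matrixTensor (Q * Matrix.diagonal ![(1 - Θ .u .u * B t) ^ (2 * ρ₁),
        (1 - Θ .u .u * B t) ^ (2 * ρ₂)] * Q.transpose) (e 0 .l) (e 0 .n) := by
  have hq := fun {t} (ht : t ∈ J) => h.one_sub_pos hB hΘ hl hn ht
  have hB0 : B 0 = 0 := by simp [hB, lapseIntegral]
  have hθ' : !![Θ .l .l, Θ .l .n; Θ .l .n, Θ .n .n] =
      Q * Matrix.diagonal ![Θ .u .u * ρ₁, Θ .u .u * ρ₂] * Q.transpose := by
    have h1 : Matrix.diagonal ![Θ .u .u * ρ₁, Θ .u .u * ρ₂] =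
        Θ .u .u • Matrix.diagonal ![ρ₁, ρ₂] := by
      ext i j
      fin_cases i <;> fin_cases j <;> simp
    rw [h1, Matrix.mul_smul, Matrix.smul_mul, ← hθQ, smul_smul, mul_inv_cancel₀ hu, one_smul, hθ]
  -- For the eigenvalue `κ = Θ_uu ρ`, the scalar equation `g' = -β κ g / (1 - Θ_uu B)` is solved by
  -- a power.
  have hg : ∀ ρ : ℝ, ∀ s ∈ J, HasDerivAt (fun s => (1 - Θ .u .u * B s) ^ ρ)
      (-(β s 1 / (1 - Θ .u .u * B s) * (Θ .u .u * ρ) * (1 - Θ .u .u * B s) ^ ρ)) s := by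
    intro ρ s hs
    have h1 := (((h.hasDerivAt_lapseIntegral hB hs).const_mul (Θ .u .u)).const_sub 1).rpow_const
      (p := ρ) (Or.inl (hq hs).ne')
    refine h1.congr_deriv ?_
    rw [Real.rpow_sub_one (hq hs).ne']
    have := (hq hs).ne'
    field_simp
  have h2 : ∀ ρ : ℝ, (1 - Θ .u .u * B t) ^ ρ * (1 - Θ .u .u * B t) ^ ρ =
      (1 - Θ .u .u * B t) ^ (2 * ρ) := by
    intro ρ
    rw [← Real.rpow_add (hq ht)]
    ring_nf
  have := h.coframeMetric_quasidiagonal hB hΘ hl hn hQ hθ' (hg ρ₁) (hg ρ₂) (by simp [hB0])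
    (by simp [hB0]) (fun s hs => (Real.rpow_pos_of_pos (hq hs) _).ne')
    (fun s hs => (Real.rpow_pos_of_pos (hq hs) _).ne') ht
  rw [this, h2, h2]

theorem coframeMetric_of_shape_uu_eq_zero (h : IsLeftInvariantFlow J β e)
    (hB : ∀ t, B t = lapseIntegral β t)
    (hΘ : Θ = shapeComponents β e 0 1) (hl : Θ .u .l = 0) (hn : Θ .u .n = 0) (hu : Θ .u .u = 0)
    (hθ : θ = !![Θ .l .l, Θ .l .n; Θ .l .n, Θ .n .n])
    (hQ : Q ∈ Matrix.orthogonalGroup (Fin 2) ℝ) {κ₁ κ₂ : ℝ}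
    (hθQ : θ = Q * Matrix.diagonal ![κ₁, κ₂] * Q.transpose) {t : ℝ} (ht : t ∈ J) :
    coframeMetric (e t) = tensorProd (e 0 .u) (e 0 .u) +
      matrixTensor (Q * Matrix.diagonal ![Real.exp (-2 * κ₁ * B t), Real.exp (-2 * κ₂ * B t)] *
        Q.transpose) (e 0 .l) (e 0 .n) := by
  have hB0 : B 0 = 0 := by simp [hB, lapseIntegral]
  have hg : ∀ κ : ℝ, ∀ s ∈ J, HasDerivAt (fun s => Real.exp (-κ * B s))
      (-(β s 1 / (1 - Θ .u .u * B s) * κ * Real.exp (-κ * B s))) s := by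
    intro κ s hs
    refine ((h.hasDerivAt_lapseIntegral hB hs).const_mul (-κ)).exp.congr_deriv ?_
    rw [hu, zero_mul, sub_zero, div_one]
    ring
  have h2 : ∀ κ : ℝ, Real.exp (-κ * B t) * Real.exp (-κ * B t) = Real.exp (-2 * κ * B t) := by
    intro κ
    rw [← Real.exp_add]
    ring_nf
  have := h.coframeMetric_quasidiagonal hB hΘ hl hn hQ (hθ.symm.trans hθQ) (hg κ₁) (hg κ₂)
    (by simp [hB0]) (by simp [hB0]) (fun s hs => (Real.exp_pos _).ne')
    (fun s hs => (Real.exp_pos _).ne') ht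
  rw [this, h2, h2, hu]
  simp

section Isomorphism

variable [SimplyConnectedSpace G] {T Δ : ℝ}

theorem isIsoR3 (h : IsLeftInvariantFlow J β e)
    (hΘ : Θ = shapeComponents β e 0 1) (hl : Θ .u .l = 0) (hn : Θ .u .n = 0)
    (hθ : θ = !![Θ .l .l, Θ .l .n; Θ .l .n, Θ .n .n]) (h0 : θ = 0) : IsIsoR3 G := by
  refine isIsoR3_of_isIsoTo ?_
  exact h.isIsoTo_of_quasidiagonal hΘ hl hn (Q := 1) (κ := fun _ => 0)
    (one_mem _) (by rw [← hθ, h0]; simp) (i := 0) (j := 1) (by simp) one_ne_zero (by simp)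
    (by simp)

theorem exists_diagonalization (hθ : θ = !![Θ .l .l, Θ .l .n; Θ .l .n, Θ .n .n])
    (hT : T = θ.trace) (hΔ : Δ = θ.det) :
    ∃ Q ∈ Matrix.orthogonalGroup (Fin 2) ℝ, θ = Q * Matrix.diagonal
      ![(T + √(T ^ 2 - 4 * Δ)) / 2, (T - √(T ^ 2 - 4 * Δ)) / 2] * Q.transpose := by
  subst hT hΔ
  exact exists_orthogonal_diagonalization θ (by simp [hθ])

theorem isIsoTo_E11 (h : IsLeftInvariantFlow J β e)
    (hΘ : Θ = shapeComponents β e 0 1) (hl : Θ .u .l = 0) (hn : Θ .u .n = 0)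
    (hθ : θ = !![Θ .l .l, Θ .l .n; Θ .l .n, Θ .n .n]) (hT : T = θ.trace) (hΔ : Δ = θ.det)
    (hT0 : T = 0) (hθ0 : θ ≠ 0) : IsIsoTo G E11 := by
  obtain ⟨Q, hQ, hθQ⟩ := exists_diagonalization hθ hT hΔ
  rw [hT0] at hθQ
  set D := √((0 : ℝ) ^ 2 - 4 * Δ)
  have hD : D ≠ 0 := by
    intro hD
    refine hθ0 (hθQ.trans ?_)
    have : Matrix.diagonal ![((0 : ℝ) + D) / 2, (0 - D) / 2] = 0 := by
      ext i j
      fin_cases i <;> fin_cases j <;> simp [hD]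
    rw [this]
    simp
  -- The eigenvalues are `±D / 2`; the scale `c = D / 2` turns them into the weights `±1`.
  exact h.isIsoTo_of_quasidiagonal hΘ hl hn hQ (hθ.symm.trans hθQ) (i := 0) (j := 1)
    (by simp) (c := D / 2) (by positivity) (by simp; field_simp) (by simp; field_simp)

/-- The sign of `T` selects the eigenvalue of largest modulus, which is nonzero and is scaled to
`1`. The other weight is then the quotient of the eigenvalues; it vanishes when `Δ = 0`, so `τ₂ ⊕ ℝ`
is covered as well. -/
theorem isIsoTo_of_trace_ne_zero (h : IsLeftInvariantFlow J β e)
    (hΘ : Θ = shapeComponents β e 0 1) (hl : Θ .u .l = 0) (hn : Θ .u .n = 0)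
    (hθ : θ = !![Θ .l .l, Θ .l .n; Θ .l .n, Θ .n .n]) (hT : T = θ.trace) (hΔ : Δ = θ.det)
    (hT0 : T ≠ 0) : IsIsoTo G (SemidirectLine 1 ((T - Real.sign T * √(T ^ 2 - 4 * Δ)) /
      (T + Real.sign T * √(T ^ 2 - 4 * Δ)))) := by
  obtain ⟨Q, hQ, hθQ⟩ := exists_diagonalization hθ hT hΔ
  set D := √(T ^ 2 - 4 * Δ)
  have hD : 0 ≤ D := Real.sqrt_nonneg _
  rcases lt_or_gt_of_ne hT0 with hneg | hpos
  · have hc : T - D ≠ 0 := (by linarith : T - D < 0).ne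
    rw [Real.sign_of_neg hneg]
    exact h.isIsoTo_of_quasidiagonal hΘ hl hn hQ (hθ.symm.trans hθQ) (i := 1) (j := 0)
      (by simp) (c := (T - D) / 2) (div_ne_zero hc two_ne_zero)
      (by simp; field_simp) (by simp [← sub_eq_add_neg]; field_simp)
  · have hc : T + D ≠ 0 := by positivity
    rw [Real.sign_of_pos hpos]
    exact h.isIsoTo_of_quasidiagonal hΘ hl hn hQ (hθ.symm.trans hθQ) (i := 0) (j := 1)
      (by simp) (c := (T + D) / 2) (div_ne_zero hc two_ne_zero)
      (by simp; field_simp) (by simp; field_simp)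

end Isomorphism

/-- The parameter of the group `τ_{3,μ}`. -/
theorem modulus_bounds {T Δ μ : ℝ} (hT : T ≠ 0) (hΔ : Δ ≠ 0) (hD : 0 ≤ T ^ 2 - 4 * Δ)
    (hμ : μ = (T - Real.sign T * √(T ^ 2 - 4 * Δ)) / (T + Real.sign T * √(T ^ 2 - 4 * Δ))) :
    -1 < μ ∧ μ ≤ 1 ∧ μ ≠ 0 := by
  have hsq := Real.sq_sqrt hD
  have hD0 := Real.sqrt_nonneg (T ^ 2 - 4 * Δ)
  set D := √(T ^ 2 - 4 * Δ)
  rcases lt_or_gt_of_ne hT with hneg | hpos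
  · rw [Real.sign_of_neg hneg] at hμ
    have hc : T + -1 * D < 0 := by linarith
    subst hμ
    refine ⟨by rw [lt_div_iff_of_neg hc]; linarith, by rw [div_le_iff_of_neg hc]; linarith,
      div_ne_zero ?_ hc.ne⟩
    intro h0
    apply hΔ
    -- Numerator times denominator of `μ` is `T² - D² = 4 Δ`.
    linear_combination (T - D) / 4 * h0 + hsq / 4
  · rw [Real.sign_of_pos hpos] at hμ
    have hc : 0 < T + 1 * D := by linarith
    subst hμ
    refine ⟨by rw [lt_div_iff₀ hc]; linarith, by rw [div_le_iff₀ hc]; linarith,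
      div_ne_zero ?_ hc.ne'⟩
    intro h0
    apply hΔ
    linear_combination (T + D) / 4 * h0 + hsq / 4

section Rotating

variable {lam y : ℝ}

theorem cos_angle_ne_zero {y : ℝ} (hy : |y| < Real.pi / 2) : Real.cos y ≠ 0 :=
  (Real.cos_pos_of_mem_Ioo ⟨(abs_lt.1 hy).1, (abs_lt.1 hy).2⟩).ne'

theorem coframeMetric_of_one_ne_zero (h : IsLeftInvariantFlow J β e)
    (hB : ∀ t, B t = lapseIntegral β t)
    (hΘ : Θ = shapeComponents β e 0 1) (hlam : 0 < lam)
    (hlam2 : lam ^ 2 = Θ .u .l ^ 2 + Θ .u .n ^ 2) {i j : FrameIndex}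
    (hij : (i = .l ∧ j = .n) ∨ (i = .n ∧ j = .l)) (hi : Θ .u i = 0) {t : ℝ} (ht : t ∈ J)
    (hy : y = lam * B t + Real.arctan (Θ .u .u / lam)) :
    coframeMetric (e t) =
      ((1 - Θ .u .u * B t) ^ 2 * (1 / Real.cos y) ^ 2 + Θ .u .u ^ 2 / lam ^ 2 -
        2 * Θ .u .u / lam * (1 - Θ .u .u * B t) * Real.tan y) •
          tensorProd (e 0 .u) (e 0 .u) +
      (Θ .u .u / Θ .u j -
        Θ .u j * B t * (1 / Real.cos y) ^ 2 * (1 - Θ .u .u * B t) -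
        lam / Θ .u j * Real.tan y * (1 - 2 * Θ .u .u * B t)) •
          symProd (e 0 .u) (e 0 j) +
      tensorProd (e 0 i) (e 0 i) +
      (1 + lam ^ 2 * B t ^ 2 * (1 / Real.cos y) ^ 2 +
        2 * B t * lam * Real.tan y) • tensorProd (e 0 j) (e 0 j) := by
  have hab := (h.abs_angle_lt hB hΘ hlam hlam2 ht).1
  rw [← hy] at hab
  rw [sec_sq_eq (cos_angle_ne_zero hab)]
  funext p v w
  have hm : ∀ v, Θ .u j * e 0 j p v = Θ .u .l * e 0 .l p v + Θ .u .n * e 0 .n p v := by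
    intro v
    rcases hij with ⟨rfl, rfl⟩ | ⟨rfl, rfl⟩ <;> rw [hi] <;> ring
  have hs : e 0 .l p v * e 0 .l p w + e 0 .n p v * e 0 .n p w =
      e 0 i p v * e 0 i p w + e 0 j p v * e 0 j p w := by
    rcases hij with ⟨rfl, rfl⟩ | ⟨rfl, rfl⟩ <;> ring
  -- The claimed formula mixes `λ` and `Θ_uj`, which agree only up to sign.
  have hj2 : Θ .u j = lam ∨ Θ .u j = -lam := by
    rw [← sq_eq_sq_iff_eq_or_eq_neg, hlam2]
    rcases hij with ⟨rfl, rfl⟩ | ⟨rfl, rfl⟩ <;> rw [hi] <;> ring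
  have := h.coframeMetric_rotating hB hΘ hlam hlam2 ht hy p v w (m := fun v => Θ .u j * e 0 j p v)
    hm (fun v => rfl)
  rw [this, add_assoc (_ + _) (e 0 .l p v * e 0 .l p w), hs]
  simp only [symProd, tensorProd, Pi.add_apply, Pi.smul_apply, smul_eq_mul]
  have hne := hlam.ne'
  rcases hj2 with hj | hj <;> rw [hj] <;> field_simp <;> ring

theorem coframeMetric_of_both_ne_zero (h : IsLeftInvariantFlow J β e)
    (hB : ∀ t, B t = lapseIntegral β t)
    (hΘ : Θ = shapeComponents β e 0 1) (hlam : 0 < lam)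
    (hlam2 : lam ^ 2 = Θ .u .l ^ 2 + Θ .u .n ^ 2) {T : ℝ} (hT : T = Θ .l .l + Θ .n .n) {t : ℝ}
    (ht : t ∈ J) (hy : y = lam * B t + Real.arctan (Θ .u .u / lam)) :
    coframeMetric (e t) =
      ((1 + T * B t) ^ 2 + (Real.tan y * (1 + T * B t) + T / lam) ^ 2) •
          tensorProd (e 0 .u) (e 0 .u) -
      (T / lam ^ 2 + Real.tan y / lam * (1 + 2 * T * B t) +
        B t * (1 + T * B t) * (1 / Real.cos y) ^ 2) •
          (Θ .u .l • symProd (e 0 .u) (e 0 .l) + Θ .u .n • symProd (e 0 .u) (e 0 .n)) +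
      (1 + Θ .u .l ^ 2 * B t *
        (B t * (1 / Real.cos y) ^ 2 + 2 * Real.tan y / lam)) •
          tensorProd (e 0 .l) (e 0 .l) +
      (Θ .u .l * Θ .u .n * B t * (1 / Real.cos y) ^ 2 *
        (B t + Real.sin (2 * y) / lam)) • symProd (e 0 .l) (e 0 .n) +
      (1 + Θ .u .n ^ 2 * B t *
        (B t * (1 / Real.cos y) ^ 2 + 2 * Real.tan y / lam)) •
          tensorProd (e 0 .n) (e 0 .n) := by
  have hab := (h.abs_angle_lt hB hΘ hlam hlam2 ht).1
  rw [← hy] at hab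
  have hcos := cos_angle_ne_zero hab
  -- The only eigenvalues of `θ` are `-Θ_uu` and `0`, which explains why `T` replaces `Θ_uu` in the
  -- formula.
  have htr : T = -Θ .u .u := by
    subst hΘ
    rw [hT, h.invariantEvolution.trace_transverse hlam hlam2 h.flow.zero_mem]
  have hln : Θ .u .l * Θ .u .n * B t * (1 / Real.cos y) ^ 2 * (B t + Real.sin (2 * y) / lam) =
      Θ .u .l * Θ .u .n * B t * (B t * (1 / Real.cos y) ^ 2 + 2 * Real.tan y / lam) := by
    rw [← sec_sq_mul_sin_two_mul hcos]
    ring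
  rw [hln, sec_sq_eq hcos]
  funext p v w
  have := h.coframeMetric_rotating hB hΘ hlam hlam2 ht hy p v w (fun v => rfl) (fun v => rfl)
  rw [this, htr]
  simp only [symProd, tensorProd, Pi.add_apply, Pi.sub_apply, Pi.smul_apply, smul_eq_mul]
  have hne := hlam.ne'
  field_simp
  ring

end Rotating

end IsLeftInvariantFlow

end Geometry

/-! ### Global existence. -/

section Geometry

variable {G : Type*} [TopologicalSpace G] [ChartedSpace (EuclideanSpace ℝ (Fin 3)) G] [Group G]
  [LieGroup (𝓡 3) ∞ G] {J : Set ℝ} {β : ℝ → G → ℝ} {e : ℝ → FrameIndex → OneForm G}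

namespace IsLeftInvariantFlow

/-- A solution of the evolution equations for the matrix `U t` that expresses the coframe at time
`t` in terms of the initial one gives a left-invariant parallel spinor flow. -/
theorem of_matrix (h : IsLeftInvariantFlow J β e) (hβ : IsLapse Set.univ β)
    (hβi : ∀ t, IsLeftInvariantFun (β t)) {Θ : Matrix FrameIndex FrameIndex ℝ}
    (hΘ : Θ = shapeComponents β e 0 1) {U A : ℝ → Matrix FrameIndex FrameIndex ℝ}
    {e' : ℝ → FrameIndex → OneForm G} (he' : ∀ t a, e' t a = ∑ c, U t a c • e 0 c)
    (hUs : ∀ a c, ContDiff ℝ ∞ fun t => U t a c)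
    (hUd : ∀ t a c, HasDerivAt (fun s => U s a c) (-(β t 1 * ∑ k, A t a k * U t k c)) t)
    (hA : ∀ t a c, A t a c = A t c a)
    (hUinj : ∀ t (x : FrameIndex → ℝ), (∀ a, ∑ c, U t a c * x c = 0) → ∀ c, x c = 0)
    (hAU : ∀ t c, ∑ k, A t .u k * U t k c = Θ .u c)
    (hstr : ∀ t a (x z : FrameIndex → ℝ),
      (∑ k, U t a k * ∑ c, Θ k c * x c) * z .u - (∑ k, U t a k * ∑ c, Θ k c * z c) * x .u =
        (∑ k, A t a k * ∑ c, U t k c * x c) * (∑ c, U t .u c * z c) -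
          (∑ k, A t a k * ∑ c, U t k c * z c) * (∑ c, U t .u c * x c)) :
    IsLeftInvariantFlow Set.univ β e' := by
  have h0 := h.flow.zero_mem
  have hsm := fun a => h.isSmoothForm h0 a
  have hinv := h.coframe_invariant 0 h0
  have hext := h.flow.structure_eq 0 h0
  have hsh : ∀ a p v, shapeOn β e 0 a p v = ∑ c, Θ a c * e 0 c p v := by
    intro a p v
    rw [h.shapeOn_eq h0, ← hΘ, combination_apply]
  have hdβ : ∀ t, differential (β t) = 0 := fun t => differential_eq_zero_of_leftInvariant (hβi t)
  have hcomb : ∀ t a p v, e' t a p v = ∑ c, U t a c * e 0 c p v := by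
    intro t a p v
    rw [he', combination_apply]
  have hLI : ∀ t p, LinearIndependent ℝ fun a => e' t a p := by
    intro t p
    refine linearIndependent_of_joint_kernel fun v hv => h.coframe_eq_zero h0 (p := p) ?_
    exact hUinj t (fun c => e 0 c p v) fun a => (hcomb t a p v).symm.trans (hv a)
  have hder : ∀ t a p v, HasDerivAt (fun s => e' s a p v)
      (-(β t p * ∑ k, A t a k * e' t k p v)) t := by
    intro t a p v
    simp only [hcomb]
    refine (HasDerivAt.fun_sum fun c _ => (hUd t a c).mul_const (e 0 c p v)).congr_deriv ?_
    rw [(hβi t).eq_one p]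
    simp only [FrameIndex.sum_eq]
    ring
  -- The shape operator is defined by the metric, so the symmetric matrix `A` driving the evolution
  -- must be identified with it.
  have hcomp : ∀ t p, shapeComponents β e' t p = A t :=
    fun t p => shapeComponents_eq_of_hasDerivAt (hLI t p) (hβ.pos t trivial p).ne' (hA t)
      (fun a v => hder t a p v)
  have hshape : ∀ t a p v, shapeOn β e' t a p v =
      ∑ k, A t a k * ∑ c, U t k c * e 0 c p v := by
    intro t a p v
    rw [shapeOn_apply, hcomp]
    simp only [hcomb]
  -- `w` is the initial one at all times; its evolution equation and its cohomology condition are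
  -- thus inherited.
  have hshape_u : ∀ t, shapeOn β e' t .u = shapeOn β e 0 .u := by
    intro t
    funext p
    ext v
    rw [hshape, hsh]
    simp only [← hAU t, FrameIndex.sum_eq]
    ring
  have hlapse : ∀ t a, lapseDeriv β e' t a = 0 := by
    intro t a
    funext p
    rw [lapseDeriv, hdβ]
    rfl
  refine ⟨⟨isOpen_univ, Set.ordConnected_univ, trivial, hβ, ⟨?_, fun t _ => hLI t⟩, ?_, ?_, ?_, ?_⟩,
    fun t _ => hβi t, fun t _ a => he' t a ▸ .combination hinv _⟩
  · intro X hX a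
    simp only [hcomb, FrameIndex.sum_eq]
    have h1 : ∀ c, ContMDiffOn (𝓘(ℝ, ℝ).prod (𝓡 3)) 𝓘(ℝ, ℝ) ∞
        (fun q : ℝ × G => U q.1 a c * e 0 c q.2 (X q.2)) (Set.univ ×ˢ Set.univ) := fun c =>
      (((hUs a c).contMDiff.comp contMDiff_fst).mul ((hsm c X hX).comp contMDiff_snd)).contMDiffOn
    exact (h1 _).add ((h1 _).add (h1 _))
  · intro t _ a p v
    rw [(hder t a p v).deriv, hlapse, hdβ, shapeOn_apply, hcomp]
    simp
  · intro t _ a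
    rw [he' t a]
    convert IsExtDeriv.combination hext hsm (U t a) using 1
    funext p v w
    rw [tensor_combination_apply, wedge_apply]
    simp only [wedge_apply, hshape, hcomb, hsh]
    have := hstr t a (fun c => e 0 c p v) (fun c => e 0 c p w)
    simp only [FrameIndex.sum_eq] at this ⊢
    linear_combination -this
  · intro t _ p v
    simp only [hshape_u, hlapse]
    rw [deriv_const, zero_add]
    exact differential_const _ _ _
  · intro t _
    rw [hshape_u]
    exact h.flow.cohomology 0 h0

theorem isGloballyDefined_of_matrix (h : IsLeftInvariantFlow J β e)
    {U : ℝ → Matrix FrameIndex FrameIndex ℝ}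
    (hU : IsLeftInvariantFlow Set.univ β (fun t a => ∑ c, U t a c • e 0 c))
    (hUJ : ∀ t ∈ J, ∀ a v, e t a 1 v = ∑ c, U t a c * e 0 c 1 v) : IsGloballyDefined J β e := by
  refine ⟨_, fun t ht => funext fun a => ?_, hU⟩
  funext p
  ext v
  rw [combination_apply, h.coframe_apply_of_one ht (hUJ t ht a)]

/-- The initial shape operator only depends on the coframes near time zero. -/
theorem shapeComponents_extension (h : IsLeftInvariantFlow J β e) {e' : ℝ → FrameIndex → OneForm G}
    (he : ∀ t ∈ J, e' t = e t) : shapeComponents β e' 0 1 = shapeComponents β e 0 1 := by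
  have h0 := h.flow.zero_mem
  ext a c
  simp only [shapeComponents, Matrix.of_apply, shapeOperator, he 0 h0]
  congr 1
  refine Filter.EventuallyEq.deriv_eq ?_
  filter_upwards [h.flow.isOpen.mem_nhds h0] with s hs
  rw [he s hs]

end IsLeftInvariantFlow

end Geometry

section Calculus

theorem contDiff_primitive {b : ℝ → ℝ} (hb : ContDiff ℝ ∞ b) :
    ContDiff ℝ ∞ fun t => ∫ τ in (0 : ℝ)..t, b τ := by
  have hd : ∀ t, HasDerivAt (fun t => ∫ τ in (0 : ℝ)..t, b τ) (b t) t := fun t =>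
    hasDerivAt_primitive isOpen_univ Set.ordConnected_univ trivial hb.continuous.continuousOn
      trivial
  rw [contDiff_infty_iff_deriv]
  refine ⟨fun t => (hd t).differentiableAt, ?_⟩
  rwa [show deriv (fun t => ∫ τ in (0 : ℝ)..t, b τ) = b from funext fun t => (hd t).deriv]

theorem ofReal_primitive {b : ℝ → ℝ} (hb : Continuous b) (hpos : ∀ t, 0 < b t) {t : ℝ}
    (ht : 0 ≤ t) : ENNReal.ofReal (∫ τ in (0 : ℝ)..t, b τ) =
      ∫⁻ τ in Set.Ioc (0 : ℝ) t, ENNReal.ofReal (b τ) := by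
  rw [intervalIntegral.integral_of_le ht, MeasureTheory.ofReal_integral_eq_lintegral_ofReal]
  · exact hb.integrableOn_Ioc
  · exact Filter.Eventually.of_forall fun τ => (hpos τ).le

/-- The primitive of a positive function stays below `c⁻¹` if and only if its integral over the
half-line is at most `c⁻¹`. -/
theorem forall_primitive_lt_iff {b : ℝ → ℝ} (hb : Continuous b) (hpos : ∀ t, 0 < b t) {c : ℝ}
    (hc : 0 < c) : (∀ t, c * (∫ τ in (0 : ℝ)..t, b τ) < 1) ↔
      ∫⁻ τ in Set.Ioi (0 : ℝ), ENNReal.ofReal (b τ) ≤ ENNReal.ofReal c⁻¹ := by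
  constructor
  · intro h
    have hcov : MeasureTheory.AECover (MeasureTheory.volume.restrict (Set.Ioi (0 : ℝ)))
        Filter.atTop fun n : ℝ => Set.Iic n := MeasureTheory.aecover_Iic Filter.tendsto_id
    refine le_of_tendsto (hcov.lintegral_tendsto_of_countably_generated
      (f := fun τ => ENNReal.ofReal (b τ)) (by fun_prop)) ?_
    filter_upwards [Filter.eventually_ge_atTop 0] with t ht
    rw [MeasureTheory.Measure.restrict_restrict measurableSet_Iic, Set.inter_comm,
      Set.Ioi_inter_Iic, ← ofReal_primitive hb hpos ht]
    refine ENNReal.ofReal_le_ofReal ?_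
    rw [← one_div, le_div_iff₀' hc]
    exact (h t).le
  · intro h t
    rcases le_or_gt t 0 with ht | ht
    · have : ∫ τ in (0 : ℝ)..t, b τ ≤ 0 := by
        rw [intervalIntegral.integral_symm, neg_nonpos]
        exact intervalIntegral.integral_nonneg ht fun τ _ => (hpos τ).le
      nlinarith
    -- Bounding the integral up to `t + 1` leaves room for a strict inequality at `t`, as `b` is
    -- positive.
    · have h1 : ENNReal.ofReal (∫ τ in (0 : ℝ)..(t + 1), b τ) ≤ ENNReal.ofReal c⁻¹ := by
        rw [ofReal_primitive hb hpos (by linarith)]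
        exact (MeasureTheory.lintegral_mono_set Set.Ioc_subset_Ioi_self).trans h
      rw [ENNReal.ofReal_le_ofReal_iff (by positivity)] at h1
      have h2 : 0 < ∫ τ in t..(t + 1), b τ := intervalIntegral.intervalIntegral_pos_of_pos
        (hb.intervalIntegrable _ _) hpos (by linarith)
      have h3 := intervalIntegral.integral_add_adjacent_intervals (μ := MeasureTheory.volume)
        (hb.intervalIntegrable 0 t) (hb.intervalIntegrable t (t + 1))
      have h4 : ∫ τ in (0 : ℝ)..t, b τ < c⁻¹ := by linarith
      rwa [← one_div, lt_div_iff₀' hc] at h4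

theorem forall_primitive_lt_iff_of_neg {b : ℝ → ℝ} (hb : Continuous b) (hpos : ∀ t, 0 < b t)
    {c : ℝ} (hc : c < 0) : (∀ t, c * (∫ τ in (0 : ℝ)..t, b τ) < 1) ↔
      ∫⁻ τ in Set.Iio (0 : ℝ), ENNReal.ofReal (b τ) ≤ ENNReal.ofReal (-c)⁻¹ := by
  have h1 := forall_primitive_lt_iff (b := fun t => b (-t)) (by fun_prop) (fun t => hpos _)
    (neg_pos.2 hc)
  have h2 : ∫⁻ τ in Set.Ioi (0 : ℝ), ENNReal.ofReal (b (-τ)) =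
      ∫⁻ τ in Set.Iio (0 : ℝ), ENNReal.ofReal (b τ) := by
    have := (MeasureTheory.Measure.measurePreserving_neg
      (MeasureTheory.volume : MeasureTheory.Measure ℝ)).setLIntegral_comp_preimage_emb
      (Homeomorph.neg ℝ).measurableEmbedding (fun τ => ENNReal.ofReal (b τ)) (Set.Iio 0)
    simpa using this
  rw [← h2, ← h1]
  have h3 : ∀ t, -c * (∫ τ in (0 : ℝ)..t, b (-τ)) = c * ∫ τ in (0 : ℝ)..(-t), b τ := by
    intro t
    rw [intervalIntegral.integral_comp_neg (fun τ => b τ), neg_zero,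
      intervalIntegral.integral_symm]
    ring
  simp only [h3]
  exact ⟨fun h t => h (-t), fun h t => by simpa using h (-t)⟩

end Calculus

section Geometry

variable {G : Type*} [TopologicalSpace G] [ChartedSpace (EuclideanSpace ℝ (Fin 3)) G] [Group G]
  {J : Set ℝ} {β : ℝ → G → ℝ} {e : ℝ → FrameIndex → OneForm G}

theorem IsLapse.contDiff (hβ : IsLapse Set.univ β) : ContDiff ℝ ∞ fun t => β t 1 := by
  have h2 : ContMDiff 𝓘(ℝ, ℝ) (𝓘(ℝ, ℝ).prod (𝓡 3)) ∞ (fun s : ℝ => (s, (1 : G))) :=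
    contMDiff_id.prodMk contMDiff_const
  have h1 := hβ.smooth.comp (h2.contMDiffOn (s := Set.univ)) fun s _ => ⟨trivial, trivial⟩
  exact (contMDiffOn_univ.1 h1).contDiff

theorem IsLapse.contDiff_lapseIntegral (hβ : IsLapse Set.univ β) :
    ContDiff ℝ ∞ (lapseIntegral β) := contDiff_primitive hβ.contDiff

theorem IsLapse.hasDerivAt_lapseIntegral (hβ : IsLapse Set.univ β) (t : ℝ) :
    HasDerivAt (lapseIntegral β) (β t 1) t :=
  hasDerivAt_primitive isOpen_univ Set.ordConnected_univ trivial
    hβ.contDiff.continuous.continuousOn trivial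

variable [LieGroup (𝓡 3) ∞ G]

namespace IsLeftInvariantFlow

variable {B : ℝ → ℝ} {Θ : Matrix FrameIndex FrameIndex ℝ}

/-- The explicit solution in terms of `a = λ tan y` is smooth on all of `ℝ` under the angle bound.
The matrices `U` and `A` are the formulas found for the coframe and the shape operator. -/
theorem isGloballyDefined_of_rotating (h : IsLeftInvariantFlow J β e) (hβ : IsLapse Set.univ β)
    (hβi : ∀ t, IsLeftInvariantFun (β t)) (hB : ∀ t, B t = lapseIntegral β t)
    (hΘ : Θ = shapeComponents β e 0 1) {lam : ℝ} (hlam : 0 < lam)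
    (hlam2 : lam ^ 2 = Θ .u .l ^ 2 + Θ .u .n ^ 2)
    (hy : ∀ t, |lam * B t + Real.arctan (Θ .u .u / lam)| < Real.pi / 2) :
    IsGloballyDefined J β e := by
  have hB' : B = lapseIntegral β := funext hB
  have hBs : ContDiff ℝ ∞ B := hB' ▸ hβ.contDiff_lapseIntegral
  have hBd : ∀ t, HasDerivAt B (β t 1) t := hB' ▸ hβ.hasDerivAt_lapseIntegral
  have hB0 : B 0 = 0 := by simp [hB, lapseIntegral]
  have hcos : ∀ t, Real.cos (lam * B t + Real.arctan (Θ .u .u / lam)) ≠ 0 :=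
    fun t => cos_angle_ne_zero (hy t)
  set a : ℝ → ℝ := fun t => lam * Real.tan (lam * B t + Real.arctan (Θ .u .u / lam)) with ha
  have has : ContDiff ℝ ∞ a := by
    have h1 : ContDiff ℝ ∞ fun t => lam * B t + Real.arctan (Θ .u .u / lam) := by fun_prop
    simp only [ha, Real.tan_eq_sin_div_cos]
    exact contDiff_const.mul ((Real.contDiff_sin.comp h1).div (Real.contDiff_cos.comp h1) hcos)
  have had : ∀ t, HasDerivAt a (β t 1 * (a t ^ 2 + (Θ .u .l ^ 2 + Θ .u .n ^ 2))) t := by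
    intro t
    have h1 := ((Real.hasDerivAt_tan (hcos t)).comp t
      (((hBd t).const_mul lam).add_const (Real.arctan (Θ .u .u / lam)))).const_mul lam
    refine h1.congr_deriv ?_
    rw [← one_div_pow, sec_sq_eq (hcos t), ← hlam2]
    simp only [ha]
    ring
  have hev := h.invariantEvolution
  have htr := hev.shape_transverse (by rw [← hΘ]; exact hlam2) h.flow.zero_mem
  have hsymm : ∀ a c, Θ a c = Θ c a := by
    rw [hΘ]
    exact shapeComponents_symm β e 0 1
  simp only [← hΘ] at htr
  have hne : Θ .u .l ^ 2 + Θ .u .n ^ 2 ≠ 0 := by rw [← hlam2]; positivity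
  rw [hlam2] at htr
  obtain ⟨t1, t2, t3⟩ := htr
  have tll : Θ .l .l = -(Θ .u .u * Θ .u .l ^ 2) / (Θ .u .l ^ 2 + Θ .u .n ^ 2) := by
    rw [eq_div_iff hne, ← t1]; ring
  have tln : Θ .l .n = -(Θ .u .u * Θ .u .l * Θ .u .n) / (Θ .u .l ^ 2 + Θ .u .n ^ 2) := by
    rw [eq_div_iff hne, ← t2]; ring
  have tnn : Θ .n .n = -(Θ .u .u * Θ .u .n ^ 2) / (Θ .u .l ^ 2 + Θ .u .n ^ 2) := by
    rw [eq_div_iff hne, ← t3]; ring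
  let U : ℝ → Matrix FrameIndex FrameIndex ℝ := fun t => Matrix.of fun i j => match i, j with
    | .u, .u => 1 - B t * Θ .u .u
    | .u, .l => -(B t * Θ .u .l)
    | .u, .n => -(B t * Θ .u .n)
    | .l, .u => Θ .u .l * (Θ .u .u - a t * (1 - B t * Θ .u .u)) / (Θ .u .l ^ 2 + Θ .u .n ^ 2)
    | .l, .l => 1 + a t * B t * Θ .u .l ^ 2 / (Θ .u .l ^ 2 + Θ .u .n ^ 2)
    | .l, .n => a t * B t * Θ .u .l * Θ .u .n / (Θ .u .l ^ 2 + Θ .u .n ^ 2)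
    | .n, .u => Θ .u .n * (Θ .u .u - a t * (1 - B t * Θ .u .u)) / (Θ .u .l ^ 2 + Θ .u .n ^ 2)
    | .n, .l => a t * B t * Θ .u .l * Θ .u .n / (Θ .u .l ^ 2 + Θ .u .n ^ 2)
    | .n, .n => 1 + a t * B t * Θ .u .n ^ 2 / (Θ .u .l ^ 2 + Θ .u .n ^ 2)
  let A : ℝ → Matrix FrameIndex FrameIndex ℝ := fun t => Matrix.of fun i j => match i, j with
    | .u, .u => a t
    | .u, .l => Θ .u .l
    | .u, .n => Θ .u .n
    | .l, .u => Θ .u .l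
    | .l, .l => -(a t * Θ .u .l ^ 2) / (Θ .u .l ^ 2 + Θ .u .n ^ 2)
    | .l, .n => -(a t * Θ .u .l * Θ .u .n) / (Θ .u .l ^ 2 + Θ .u .n ^ 2)
    | .n, .u => Θ .u .n
    | .n, .l => -(a t * Θ .u .l * Θ .u .n) / (Θ .u .l ^ 2 + Θ .u .n ^ 2)
    | .n, .n => -(a t * Θ .u .n ^ 2) / (Θ .u .l ^ 2 + Θ .u .n ^ 2)
  refine h.isGloballyDefined_of_matrix (U := U) (h.of_matrix hβ hβi hΘ (U := U) (A := A)
    (fun _ _ => rfl) ?_ ?_ ?_ ?_ ?_ ?_) ?_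
  · intro i j
    cases i <;> cases j <;> simp only [U, Matrix.of_apply] <;> fun_prop
  · intro t i j
    have haB := (had t).fun_mul (hBd t)
    have haq := (had t).fun_mul (((hBd t).mul_const (Θ .u .u)).const_sub 1)
    cases i <;> cases j <;> simp only [U, A, Matrix.of_apply, FrameIndex.sum_eq]
    · refine (((hBd t).mul_const _).const_sub 1).congr_deriv ?_
      field_simp
      ring
    · refine ((hBd t).mul_const _).fun_neg.congr_deriv ?_
      field_simp
      ring
    · refine ((hBd t).mul_const _).fun_neg.congr_deriv ?_
      field_simp
      ring
    · refine ((haq.const_sub _).const_mul _ |>.div_const _).congr_deriv ?_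
      field_simp
      ring
    · refine ((haB.mul_const _).div_const _ |>.const_add 1).congr_deriv ?_
      field_simp
      ring
    · refine ((haB.mul_const _).mul_const _ |>.div_const _).congr_deriv ?_
      field_simp
      ring
    · refine ((haq.const_sub _).const_mul _ |>.div_const _).congr_deriv ?_
      field_simp
      ring
    · refine ((haB.mul_const _).mul_const _ |>.div_const _).congr_deriv ?_
      field_simp
      ring
    · refine ((haB.mul_const _).div_const _ |>.const_add 1).congr_deriv ?_
      field_simp
      ring
  · intro t i j
    cases i <;> cases j <;> rfl
  · intro t x hx
    have hu := hx .u
    have hl := hx .l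
    have hn := hx .n
    simp only [U, Matrix.of_apply, FrameIndex.sum_eq] at hu hl hn
    -- Injectivity of `U`: the coframe at time `t` recovers the conserved forms `w` and `k`, and
    -- then `e_u = e_u^t + B_t w`.
    have hW : Θ .u .u * x .u + Θ .u .l * x .l + Θ .u .n * x .n = 0 := by
      linear_combination (norm := (field_simp; ring)) a t * hu + Θ .u .l * hl + Θ .u .n * hn
    have hK : -(Θ .u .n * x .l) + Θ .u .l * x .n = 0 := by
      linear_combination (norm := (field_simp; ring)) -(Θ .u .n) * hl + Θ .u .l * hn
    have hxu : x .u = 0 := by linear_combination hu + B t * hW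
    rw [hxu] at hW
    intro c
    cases c
    · exact hxu
    · refine mul_left_cancel₀ hne ?_
      linear_combination Θ .u .l * hW - Θ .u .n * hK
    · refine mul_left_cancel₀ hne ?_
      linear_combination Θ .u .n * hW + Θ .u .l * hK
  · intro t c
    cases c <;> simp only [U, A, Matrix.of_apply, FrameIndex.sum_eq] <;> field_simp <;> ring
  · intro t i x z
    cases i <;> simp only [U, A, Matrix.of_apply, FrameIndex.sum_eq, tll, tln, tnn, hsymm .l .u,
      hsymm .n .u, hsymm .n .l] <;> field_simp <;> ring
  · intro t ht i v
    have hcu := hev.coframe_u (fun t _ => hBd t) hB0 ht v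
    have hcof := hev.coframe_rotating (lam := lam) (by rw [← hΘ]; exact hlam2) ht v
    have hat : shapeComponents β e t 1 .u .u = a t := (h.abs_angle_lt hB hΘ hlam hlam2 ht).2
    simp only [← hΘ, FrameIndex.sum_eq, hat] at hcu hcof
    rw [hcu, hlam2] at hcof
    cases i <;> simp only [U, Matrix.of_apply, FrameIndex.sum_eq]
    · refine hcu.trans ?_
      simp
      ring
    · refine mul_left_cancel₀ hne (hcof.1.trans ?_)
      simp
      field_simp
      ring
    · refine mul_left_cancel₀ hne (hcof.2.trans ?_)
      simp
      field_simp
      ring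

end IsLeftInvariantFlow

end Geometry

section Geometry

variable {G : Type*} [TopologicalSpace G] [ChartedSpace (EuclideanSpace ℝ (Fin 3)) G] [Group G]
  [LieGroup (𝓡 3) ∞ G] {J : Set ℝ} {β : ℝ → G → ℝ} {e : ℝ → FrameIndex → OneForm G}

namespace IsLeftInvariantFlow

variable {B : ℝ → ℝ} {Θ : Matrix FrameIndex FrameIndex ℝ}

/-- The coframe is rescaled along `e_u` and multiplied by a function of `θ` transversally, and the
shape operator is the initial one divided by `1 - Θ_uu B`. -/
theorem isGloballyDefined_of_quasidiagonal (h : IsLeftInvariantFlow J β e)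
    (hβ : IsLapse Set.univ β) (hβi : ∀ t, IsLeftInvariantFun (β t))
    (hB : ∀ t, B t = lapseIntegral β t) (hΘ : Θ = shapeComponents β e 0 1)
    (hl : Θ .u .l = 0) (hn : Θ .u .n = 0) (hq : ∀ t, 0 < 1 - Θ .u .u * B t) :
    IsGloballyDefined J β e := by
  have hB' : B = lapseIntegral β := funext hB
  have hBs : ContDiff ℝ ∞ B := hB' ▸ hβ.contDiff_lapseIntegral
  have hBd : ∀ t, HasDerivAt B (β t 1) t := hB' ▸ hβ.hasDerivAt_lapseIntegral
  have hB0 : B 0 = 0 := by simp [hB, lapseIntegral]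
  have hsymm : ∀ a c, Θ a c = Θ c a := by
    rw [hΘ]
    exact shapeComponents_symm β e 0 1
  have hlu : Θ .l .u = 0 := by rw [hsymm, hl]
  have hnu : Θ .n .u = 0 := by rw [hsymm, hn]
  obtain ⟨Q, hQ, hθQ⟩ := exists_orthogonal_diagonalization
    !![Θ .l .l, Θ .l .n; Θ .l .n, Θ .n .n] rfl
  generalize (_ + √_) / 2 = κ₁ at hθQ
  generalize (_ - √_) / 2 = κ₂ at hθQ
  have hbq : ContDiff ℝ ∞ fun t => β t 1 / (1 - Θ .u .u * B t) :=
    hβ.contDiff.div (by fun_prop) fun t => (hq t).ne'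
  -- With this reparametrized time the solutions are `exp (-κ S)`, without distinguishing whether
  -- `Θ_uu` vanishes.
  set S : ℝ → ℝ := fun t => ∫ τ in (0 : ℝ)..t, β τ 1 / (1 - Θ .u .u * B τ) with hS
  have hSs : ContDiff ℝ ∞ S := contDiff_primitive hbq
  have hSd : ∀ t, HasDerivAt S (β t 1 / (1 - Θ .u .u * B t)) t := fun t =>
    hasDerivAt_primitive isOpen_univ Set.ordConnected_univ trivial hbq.continuous.continuousOn
      trivial
  have hg : ∀ κ t, HasDerivAt (fun t => Real.exp (-κ * S t))
      (-(β t 1 / (1 - Θ .u .u * B t) * κ * Real.exp (-κ * S t))) t := by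
    intro κ t
    refine ((hSd t).const_mul (-κ)).exp.congr_deriv ?_
    ring
  have hg0 : ∀ κ, Real.exp (-κ * S 0) = 1 := by simp [hS]
  set P : ℝ → Matrix (Fin 2) (Fin 2) ℝ := fun t =>
    Q * Matrix.diagonal ![Real.exp (-κ₁ * S t), Real.exp (-κ₂ * S t)] * Q.transpose with hP
  have hPs : ∀ i j, ContDiff ℝ ∞ fun t => P t i j := by
    intro i j
    simp only [hP, conj_diagonal_apply]
    fun_prop
  have hθP : ∀ t, !![Θ .l .l, Θ .l .n; Θ .l .n, Θ .n .n] * P t =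
      Q * Matrix.diagonal ![κ₁ * Real.exp (-κ₁ * S t), κ₂ * Real.exp (-κ₂ * S t)] *
        Q.transpose := by
    intro t
    rw [hθQ, conj_diagonal_mul hQ]
  have hcomm : ∀ t, P t * !![Θ .l .l, Θ .l .n; Θ .l .n, Θ .n .n] =
      !![Θ .l .l, Θ .l .n; Θ .l .n, Θ .n .n] * P t := by
    intro t
    rw [hθP, hθQ, conj_diagonal_mul hQ, mul_comm κ₁, mul_comm κ₂]
  have hPd : ∀ t i j, HasDerivAt (fun t => P t i j) (-(β t 1 / (1 - Θ .u .u * B t) *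
      (!![Θ .l .l, Θ .l .n; Θ .l .n, Θ .n .n] * P t) i j)) t := by
    intro t i j
    rw [hθP, conj_diagonal_apply]
    simp only [hP, conj_diagonal_apply]
    refine ((((hg κ₁ t).const_mul _).mul_const _).fun_add
      (((hg κ₂ t).const_mul _).mul_const _)).congr_deriv ?_
    ring
  have hinv : ∀ t, (Q * Matrix.diagonal ![(Real.exp (-κ₁ * S t))⁻¹, (Real.exp (-κ₂ * S t))⁻¹] *
      Q.transpose) * P t = 1 := by
    intro t
    have h1 : Matrix.diagonal ![(1 : ℝ), 1] = 1 := by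
      ext i j
      fin_cases i <;> fin_cases j <;> simp
    rw [conj_diagonal_mul hQ, inv_mul_cancel₀ (Real.exp_pos _).ne',
      inv_mul_cancel₀ (Real.exp_pos _).ne', h1, Matrix.mul_one, orthogonal_mul_transpose hQ]
  let U : ℝ → Matrix FrameIndex FrameIndex ℝ := fun t => Matrix.of fun i j => match i, j with
    | .u, .u => 1 - Θ .u .u * B t
    | .l, .l => P t 0 0
    | .l, .n => P t 0 1
    | .n, .l => P t 1 0
    | .n, .n => P t 1 1
    | _, _ => 0
  let A : ℝ → Matrix FrameIndex FrameIndex ℝ := fun t => (1 - Θ .u .u * B t)⁻¹ • Θ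
  have hAU : ∀ t c, ∑ k, A t .u k * U t k c = Θ .u c := by
    intro t c
    have := (hq t).ne'
    cases c <;> simp only [U, A, Matrix.of_apply, FrameIndex.sum_eq, Matrix.smul_apply, hl, hn,
      smul_eq_mul] <;> field_simp <;> ring
  refine h.isGloballyDefined_of_matrix (U := U) (h.of_matrix hβ hβi hΘ (U := U) (A := A)
    (fun _ _ => rfl) ?_ ?_ ?_ ?_ hAU ?_) ?_
  · intro i j
    cases i <;> cases j <;> simp only [U, Matrix.of_apply] <;>
      first | exact hPs _ _ | fun_prop
  · intro t i j
    have := (hq t).ne'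
    cases i
    · rw [hAU]
      cases j <;> simp only [U, Matrix.of_apply, hl, hn, mul_zero, neg_zero]
      · refine (((hBd t).const_mul _).const_sub 1).congr_deriv ?_
        ring
      · exact hasDerivAt_const _ _
      · exact hasDerivAt_const _ _
    all_goals
      cases j <;> simp only [U, A, Matrix.of_apply, FrameIndex.sum_eq, Matrix.smul_apply,
        smul_eq_mul, hlu, hnu]
      · simpa using hasDerivAt_const t (0 : ℝ)
      all_goals
        refine (hPd t _ _).congr_deriv ?_
        simp [Matrix.mul_apply, Fin.sum_univ_two, hsymm .n .l]
        field_simp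
  · intro t i j
    simp only [A, Matrix.smul_apply, hsymm i j]
  · intro t x hx
    have hu := hx .u
    have hl := hx .l
    have hn := hx .n
    simp only [U, Matrix.of_apply, FrameIndex.sum_eq] at hu hl hn
    have hi := hinv t
    set R := Q * Matrix.diagonal ![(Real.exp (-κ₁ * S t))⁻¹, (Real.exp (-κ₂ * S t))⁻¹] *
      Q.transpose
    have hR : ∀ i j, R i 0 * P t 0 j + R i 1 * P t 1 j = if i = j then 1 else 0 := by
      intro i j
      rw [← Fin.sum_univ_two (fun k => R i k * P t k j), ← Matrix.mul_apply, hi, Matrix.one_apply]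
    have h00 := hR 0 0
    have h01 := hR 0 1
    have h10 := hR 1 0
    have h11 := hR 1 1
    simp at h00 h01 h10 h11
    intro c
    cases c
    · refine mul_left_cancel₀ (hq t).ne' ?_
      linear_combination hu
    · linear_combination R 0 0 * hl + R 0 1 * hn - x .l * h00 - x .n * h01
    · linear_combination R 1 0 * hl + R 1 1 * hn - x .l * h10 - x .n * h11
  · intro t i x z
    have := (hq t).ne'
    have hc : ∀ i j, P t i 0 * !![Θ .l .l, Θ .l .n; Θ .l .n, Θ .n .n] 0 j +
        P t i 1 * !![Θ .l .l, Θ .l .n; Θ .l .n, Θ .n .n] 1 j =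
        !![Θ .l .l, Θ .l .n; Θ .l .n, Θ .n .n] i 0 * P t 0 j +
        !![Θ .l .l, Θ .l .n; Θ .l .n, Θ .n .n] i 1 * P t 1 j := by
      intro i j
      simpa [Matrix.mul_apply, Fin.sum_univ_two] using congrFun (congrFun (hcomm t) i) j
    have c00 := hc 0 0
    have c01 := hc 0 1
    have c10 := hc 1 0
    have c11 := hc 1 1
    simp at c00 c01 c10 c11
    cases i <;> simp only [U, A, Matrix.of_apply, FrameIndex.sum_eq, Matrix.smul_apply,
      smul_eq_mul, hl, hn, hlu, hnu, hsymm .n .l] <;> field_simp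
    · ring
    · linear_combination (1 - Θ .u .u * B t) *
        ((x .l * z .u - z .l * x .u) * c00 + (x .n * z .u - z .n * x .u) * c01)
    · linear_combination (1 - Θ .u .u * B t) *
        ((x .l * z .u - z .l * x .u) * c10 + (x .n * z .u - z .n * x .u) * c11)
  · intro t ht i v
    have hcof := h.invariantEvolution.coframe_quasidiagonal (g₁ := fun t => Real.exp (-κ₁ * S t))
      (g₂ := fun t => Real.exp (-κ₂ * S t)) (fun t _ => hBd t) hB0
      (by rw [← hΘ]; exact hl) (by rw [← hΘ]; exact hn) hQ (by simp only [← hΘ]; exact hθQ)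
      (fun t _ => by rw [← hΘ]; exact hg κ₁ t) (fun t _ => by rw [← hΘ]; exact hg κ₂ t) (hg0 κ₁)
      (hg0 κ₂) (fun t _ => (Real.exp_pos _).ne') (fun t _ => (Real.exp_pos _).ne') ht
      (P := P t) rfl v
    simp only [← hΘ] at hcof
    cases i <;> simp only [U, Matrix.of_apply, FrameIndex.sum_eq]
    · simpa using hcof.1
    · simpa using hcof.2.1
    · simpa using hcof.2.2

/-- Global existence in the quasi-diagonal case. -/
theorem isGloballyDefined_iff_of_quasidiagonal (h : IsLeftInvariantFlow J β e)
    (hβ : IsLapse Set.univ β) (hβi : ∀ t, IsLeftInvariantFun (β t))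
    (hΘ : Θ = shapeComponents β e 0 1)
    (hl : Θ .u .l = 0) (hn : Θ .u .n = 0) :
    IsGloballyDefined J β e ↔
      (0 < Θ .u .u →
        (∫⁻ t in Set.Ioi (0 : ℝ), ENNReal.ofReal (β t 1)) ≤ ENNReal.ofReal |(Θ .u .u)⁻¹|) ∧
      (Θ .u .u < 0 →
        (∫⁻ t in Set.Iio (0 : ℝ), ENNReal.ofReal (β t 1)) ≤ ENNReal.ofReal |(Θ .u .u)⁻¹|) := by
  have hb := hβ.contDiff.continuous
  have hpos : ∀ t, 0 < β t 1 := fun t => hβ.pos t trivial 1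
  have hiff : IsGloballyDefined J β e ↔ ∀ t, Θ .u .u * lapseIntegral β t < 1 := by
    constructor
    -- A global extension is itself a flow with the same initial shape operator, so the positivity
    -- that holds along flows applies at every real time.
    · rintro ⟨e', he, h'⟩ t
      have := h'.one_sub_pos (fun _ => rfl) (hΘ.trans (h.shapeComponents_extension he).symm) hl hn
        (Set.mem_univ t)
      linarith
    · intro hq
      exact h.isGloballyDefined_of_quasidiagonal hβ hβi (fun _ => rfl) hΘ hl hn
        fun t => sub_pos.2 (hq t)
  rw [hiff]
  simp only [lapseIntegral]
  rcases lt_trichotomy (Θ .u .u) 0 with hneg | hzero | hgt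
  · rw [forall_primitive_lt_iff_of_neg hb hpos hneg, abs_of_neg (inv_neg''.2 hneg), inv_neg]
    exact ⟨fun h => ⟨fun h' => absurd h' hneg.not_gt, fun _ => h⟩, fun h => h.2 hneg⟩
  · simp [hzero]
  · rw [forall_primitive_lt_iff hb hpos hgt, abs_of_pos (inv_pos.2 hgt)]
    exact ⟨fun h => ⟨fun _ => h, fun h' => absurd h' hgt.not_gt⟩, fun h => h.1 hgt⟩

/-- Global existence if `Θ(e_u)` is not a multiple of `e_u`. -/
theorem isGloballyDefined_iff_of_rotating (h : IsLeftInvariantFlow J β e)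
    (hβ : IsLapse Set.univ β) (hβi : ∀ t, IsLeftInvariantFun (β t))
    (hB : ∀ t, B t = lapseIntegral β t) (hΘ : Θ = shapeComponents β e 0 1) {lam : ℝ}
    (hlam : 0 < lam) (hlam2 : lam ^ 2 = Θ .u .l ^ 2 + Θ .u .n ^ 2) :
    IsGloballyDefined J β e ↔
      ∀ t, |lam * B t + Real.arctan (Θ .u .u / lam)| < Real.pi / 2 := by
  refine ⟨?_, h.isGloballyDefined_of_rotating hβ hβi hB hΘ hlam hlam2⟩
  rintro ⟨e', he, h'⟩ t
  exact (h'.abs_angle_lt hB (hΘ.trans (h.shapeComponents_extension he).symm) hlam hlam2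
    (Set.mem_univ t)).1

end IsLeftInvariantFlow

end Geometry

end ParallelSpinor

/-! ### The classification theorem. -/

theorem mainTheorem4 {G : Type*} [TopologicalSpace G] [T2Space G]
    [ChartedSpace (EuclideanSpace ℝ (Fin 3)) G] [Group G] [LieGroup (𝓡 3) ∞ G]
    [SimplyConnectedSpace G]
    (J : Set ℝ) (β : ℝ → G → ℝ) (e : ℝ → FrameIndex → OneForm G)
    (hflow : IsLeftInvariantFlow J β e)
    -- the components of the initial shape operator in the initial coframe
    (Θ : Matrix FrameIndex FrameIndex ℝ) (hΘ : Θ = shapeComponents β e 0 1)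
    (lam : ℝ) (hlam : lam = √(Θ .u .l ^ 2 + Θ .u .n ^ 2))
    (θ : Matrix (Fin 2) (Fin 2) ℝ) (hθ : θ = !![Θ .l .l, Θ .l .n; Θ .l .n, Θ .n .n])
    (T Δ : ℝ) (hT : T = θ.trace) (hΔ : Δ = θ.det)
    (B : ℝ → ℝ) (hB : ∀ t, B t = lapseIntegral β t)
    (y : ℝ → ℝ) (hy : ∀ t, y t = lam * B t + Real.arctan (Θ .u .u / lam)) :
    -- the quasi-diagonal case
    (Θ .u .l ^ 2 + Θ .u .n ^ 2 = 0 →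
      (Θ .u .u ≠ 0 → ∀ ρ₁ ρ₂ : ℝ,
        ρ₁ = (T + √(T ^ 2 - 4 * Δ)) / (2 * Θ .u .u) →
        ρ₂ = (T - √(T ^ 2 - 4 * Δ)) / (2 * Θ .u .u) →
        (∃ Q ∈ Matrix.orthogonalGroup (Fin 2) ℝ,
          (Θ .u .u)⁻¹ • θ = Q * Matrix.diagonal ![ρ₁, ρ₂] * Q.transpose) ∧
        ∀ Q ∈ Matrix.orthogonalGroup (Fin 2) ℝ,
          (Θ .u .u)⁻¹ • θ = Q * Matrix.diagonal ![ρ₁, ρ₂] * Q.transpose →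
          ∀ t ∈ J, 0 < 1 - Θ .u .u * B t ∧
            coframeMetric (e t) =
              (1 - Θ .u .u * B t) ^ 2 • tensorProd (e 0 .u) (e 0 .u) +
              matrixTensor
                (Q * Matrix.diagonal ![(1 - Θ .u .u * B t) ^ (2 * ρ₁),
                  (1 - Θ .u .u * B t) ^ (2 * ρ₂)] * Q.transpose)
                (e 0 .l) (e 0 .n)) ∧
      (Θ .u .u = 0 → ∀ κ₁ κ₂ : ℝ,
        κ₁ = (T + √(T ^ 2 - 4 * Δ)) / 2 → κ₂ = (T - √(T ^ 2 - 4 * Δ)) / 2 →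
        (∃ Q ∈ Matrix.orthogonalGroup (Fin 2) ℝ,
          θ = Q * Matrix.diagonal ![κ₁, κ₂] * Q.transpose) ∧
        ∀ Q ∈ Matrix.orthogonalGroup (Fin 2) ℝ,
          θ = Q * Matrix.diagonal ![κ₁, κ₂] * Q.transpose →
          ∀ t ∈ J, coframeMetric (e t) =
            tensorProd (e 0 .u) (e 0 .u) +
            matrixTensor
              (Q * Matrix.diagonal ![Real.exp (-2 * κ₁ * B t), Real.exp (-2 * κ₂ * B t)] *
                Q.transpose)
              (e 0 .l) (e 0 .n)) ∧
      (θ = 0 → IsIsoR3 G) ∧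
      (T = 0 → θ ≠ 0 → IsIsoTo G E11) ∧
      (T ≠ 0 → Δ = 0 → IsIsoTo G Tau2R) ∧
      (T ≠ 0 → Δ ≠ 0 → ∀ μ : ℝ,
        μ = (T - Real.sign T * √(T ^ 2 - 4 * Δ)) / (T + Real.sign T * √(T ^ 2 - 4 * Δ)) →
        -1 < μ ∧ μ ≤ 1 ∧ μ ≠ 0 ∧ IsIsoTo G (Tau3 μ))) ∧
    -- exactly one of `Θ_ul`, `Θ_un` is nonzero: `Θ_uj ≠ 0`, where `{i, j} = {l, n}`
    (∀ i j : FrameIndex, (i = .l ∧ j = .n) ∨ (i = .n ∧ j = .l) →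
      Θ .u i = 0 → Θ .u j ≠ 0 →
      (∀ t ∈ J, |y t| < Real.pi / 2 ∧
        coframeMetric (e t) =
          ((1 - Θ .u .u * B t) ^ 2 * (1 / Real.cos (y t)) ^ 2 + Θ .u .u ^ 2 / lam ^ 2 -
            2 * Θ .u .u / lam * (1 - Θ .u .u * B t) * Real.tan (y t)) •
              tensorProd (e 0 .u) (e 0 .u) +
          (Θ .u .u / Θ .u j -
            Θ .u j * B t * (1 / Real.cos (y t)) ^ 2 * (1 - Θ .u .u * B t) -
            lam / Θ .u j * Real.tan (y t) * (1 - 2 * Θ .u .u * B t)) •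
              symProd (e 0 .u) (e 0 j) +
          tensorProd (e 0 i) (e 0 i) +
          (1 + lam ^ 2 * B t ^ 2 * (1 / Real.cos (y t)) ^ 2 +
            2 * B t * lam * Real.tan (y t)) • tensorProd (e 0 j) (e 0 j)) ∧
      IsIsoTo G Tau2R) ∧
    -- both are nonzero
    (Θ .u .l * Θ .u .n ≠ 0 →
      (∀ t ∈ J, |y t| < Real.pi / 2 ∧
        coframeMetric (e t) =
          ((1 + T * B t) ^ 2 + (Real.tan (y t) * (1 + T * B t) + T / lam) ^ 2) •
              tensorProd (e 0 .u) (e 0 .u) -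
          (T / lam ^ 2 + Real.tan (y t) / lam * (1 + 2 * T * B t) +
            B t * (1 + T * B t) * (1 / Real.cos (y t)) ^ 2) •
              (Θ .u .l • symProd (e 0 .u) (e 0 .l) + Θ .u .n • symProd (e 0 .u) (e 0 .n)) +
          (1 + Θ .u .l ^ 2 * B t *
            (B t * (1 / Real.cos (y t)) ^ 2 + 2 * Real.tan (y t) / lam)) •
              tensorProd (e 0 .l) (e 0 .l) +
          (Θ .u .l * Θ .u .n * B t * (1 / Real.cos (y t)) ^ 2 *
            (B t + Real.sin (2 * y t) / lam)) • symProd (e 0 .l) (e 0 .n) +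
          (1 + Θ .u .n ^ 2 * B t *
            (B t * (1 / Real.cos (y t)) ^ 2 + 2 * Real.tan (y t) / lam)) •
              tensorProd (e 0 .n) (e 0 .n)) ∧
      IsIsoTo G Tau2R) ∧
    -- global existence, for a lapse that is given on the whole real line
    (IsLapse Set.univ β → (∀ t, IsLeftInvariantFun (β t)) →
      (lam = 0 →
        (IsGloballyDefined J β e ↔
          (0 < Θ .u .u →
            (∫⁻ t in Set.Ioi (0 : ℝ), ENNReal.ofReal (β t 1)) ≤ ENNReal.ofReal |(Θ .u .u)⁻¹|) ∧
          (Θ .u .u < 0 →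
            (∫⁻ t in Set.Iio (0 : ℝ), ENNReal.ofReal (β t 1)) ≤ ENNReal.ofReal |(Θ .u .u)⁻¹|))) ∧
      (lam ≠ 0 →
        (IsGloballyDefined J β e ↔ ∀ t : ℝ, |y t| < Real.pi / 2))) := by

  have hlam2 : lam ^ 2 = Θ .u .l ^ 2 + Θ .u .n ^ 2 := by
    rw [hlam, Real.sq_sqrt (by positivity)]
  have hlam0 : 0 ≤ lam := hlam ▸ Real.sqrt_nonneg _
  have hzero : Θ .u .l ^ 2 + Θ .u .n ^ 2 = 0 → Θ .u .l = 0 ∧ Θ .u .n = 0 := fun h0 =>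
    ⟨by nlinarith [sq_nonneg (Θ .u .l), sq_nonneg (Θ .u .n)],
      by nlinarith [sq_nonneg (Θ .u .l), sq_nonneg (Θ .u .n)]⟩
  have hpos : Θ .u .l ^ 2 + Θ .u .n ^ 2 ≠ 0 → 0 < lam := fun h0 =>
    lt_of_le_of_ne hlam0 fun h1 => h0 (by rw [← hlam2, ← h1]; ring)
  obtain ⟨Q₀, hQ₀, hθQ₀⟩ := IsLeftInvariantFlow.exists_diagonalization hθ hT hΔ
  have hT' : T = Θ .l .l + Θ .n .n := by rw [hT, hθ, Matrix.trace_fin_two]; rfl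
  refine ⟨fun h0 => ?_, ?_, ?_, ?_⟩
  · obtain ⟨hl, hn⟩ := hzero h0
    refine ⟨?_, ?_, ?_, ?_, ?_, ?_⟩
    · rintro hu ρ₁ ρ₂ rfl rfl
      refine ⟨⟨Q₀, hQ₀, ?_⟩, fun Q hQ hθQ t ht => ⟨hflow.one_sub_pos hB hΘ hl hn ht,
        hflow.coframeMetric_of_shape_uu_ne_zero hB hΘ hl hn hu hθ hQ hθQ ht⟩⟩
      conv_lhs => rw [hθQ₀]
      rw [← Matrix.smul_mul, ← Matrix.mul_smul]
      congr 2
      ext i j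
      fin_cases i <;> fin_cases j <;> simp <;> field_simp
    · rintro hu κ₁ κ₂ rfl rfl
      exact ⟨⟨Q₀, hQ₀, hθQ₀⟩, fun Q hQ hθQ t ht =>
        hflow.coframeMetric_of_shape_uu_eq_zero hB hΘ hl hn hu hθ hQ hθQ ht⟩
    · exact hflow.isIsoR3 hΘ hl hn hθ
    · exact hflow.isIsoTo_E11 hΘ hl hn hθ hT hΔ
    · intro hT0 hΔ0
      have h1 := hflow.isIsoTo_of_trace_ne_zero hΘ hl hn hθ hT hΔ hT0
      -- For `Δ = 0` the root is `|T|` and `sign T · |T| = T`, so the second weight vanishes.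
      have h2 : (T - Real.sign T * √(T ^ 2 - 4 * Δ)) / (T + Real.sign T * √(T ^ 2 - 4 * Δ)) =
          0 := by
        have h3 : Real.sign T * |T| = T := by
          rcases lt_or_gt_of_ne hT0 with hneg | hgt
          · rw [Real.sign_of_neg hneg, abs_of_neg hneg]
            ring
          · rw [Real.sign_of_pos hgt, abs_of_pos hgt, one_mul]
        rw [hΔ0, mul_zero, sub_zero, Real.sqrt_sq_eq_abs, h3, sub_self, zero_div]
      rwa [h2] at h1
    · rintro hT0 hΔ0 μ hμ
      have hD : 0 ≤ T ^ 2 - 4 * Δ := by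
        rw [hT, hΔ]
        exact discriminant_nonneg θ (by simp [hθ])
      obtain ⟨h1, h2, h3⟩ := IsLeftInvariantFlow.modulus_bounds hT0 hΔ0 hD hμ
      refine ⟨h1, h2, h3, ?_⟩
      rw [hμ]
      exact hflow.isIsoTo_of_trace_ne_zero hΘ hl hn hθ hT hΔ hT0
  · intro i j hij hi hj
    have hne : Θ .u .l ^ 2 + Θ .u .n ^ 2 ≠ 0 := by
      rcases hij with ⟨rfl, rfl⟩ | ⟨rfl, rfl⟩ <;> positivity
    refine ⟨fun t ht => ⟨?_, ?_⟩, hflow.isIsoTo_of_rotating hΘ hne⟩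
    · rw [hy]
      exact (hflow.abs_angle_lt hB hΘ (hpos hne) hlam2 ht).1
    · exact hflow.coframeMetric_of_one_ne_zero hB hΘ (hpos hne) hlam2 hij hi ht (hy t)
  · intro hln
    have hne : Θ .u .l ^ 2 + Θ .u .n ^ 2 ≠ 0 := by
      have := left_ne_zero_of_mul hln
      positivity
    refine ⟨fun t ht => ⟨?_, ?_⟩, hflow.isIsoTo_of_rotating hΘ hne⟩
    · rw [hy]
      exact (hflow.abs_angle_lt hB hΘ (hpos hne) hlam2 ht).1
    · exact hflow.coframeMetric_of_both_ne_zero hB hΘ (hpos hne) hlam2 hT' ht (hy t)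
  · intro hβ hβi
    refine ⟨fun h0 => ?_, fun h0 => ?_⟩
    · obtain ⟨hl, hn⟩ := hzero (by rw [← hlam2, h0]; ring)
      exact hflow.isGloballyDefined_iff_of_quasidiagonal hβ hβi hΘ hl hn
    · simp only [hy]
      exact hflow.isGloballyDefined_iff_of_rotating hβ hβi hB hΘ (lt_of_le_of_ne hlam0 h0.symm)
        hlam2
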